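/- Let $\tau:E\to M$ be a Lie algebroid of finite rank over a smooth finite-dimensional (Hausdorff, $\sigma$-compact) manifold, with anchor $\rho$ and bracket $[\cdot,\cdot]$. A curve $a$ in $E$ is admissible if $\rho\circ a$ is the velocity of its base curve $\tau\circ a$. For $k\ge 1$ let $E^k$ be the manifold of $(k-1)$-jets $[a]^{k-1}$ at $0$ of admissible curves (so $E^1=E$), put $E^0=M$, and let $\tau_{k,l}:E^k\to E^l$ be the projections. Let $\mathcal T^EE^k\to E^k$ be the Lie algebroid with fibre $\{(b,v)\in E_{\tau_{k,0}(A)}\times T_AE^k : \rho(b)=T\tau_{k,0}(v)\}$ at $A$, with anchor $(b,v)\mapsto v$, with the bracket determined on projectable sections by $[(\sigma\circ\tau_{k,0},X),(\eta\circ\tau_{k,0},Y)]=([\sigma,\eta]\circ\tau_{k,0},[X,Y])$, and with exterior differential $d$. By a $p$-form on $\mathcal T^EE^k$ we mean a smooth section of $\Lambda^p(\mathcal T^EE^k)^*$. Let $T$ be the section of $\mathcal T^EE^k$ along $\tau_{k+1,k}$ given by $T([a]^k)=\bigl(a(0),\frac{d}{dt}\big|_{t=0}[s\mapsto a(t+s)]^{k-1}\bigr)$.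 Put $(i_T\omega)(z_1,\dots,z_p)=\omega(T,\mathcal T\tau_{k+1,k}z_1,\dots,\mathcal T\tau_{k+1,k}z_p)$, where $\mathcal T\tau_{k+1,k}(b,v)=(b,T\tau_{k+1,k}v)$, with $i_T=0$ on functions, and let $d_T=i_T\circ d+d\circ i_T$, which maps $p$-forms on $\mathcal T^EE^k$ to $p$-forms on $\mathcal T^EE^{k+1}$. Let $\eta$ be a smooth section of $E$ and let $(\Phi_s,\varphi_s)$ be its local flow: the local one-parameter group of vector bundle maps $\Phi_s$ of $E$ over $\varphi_s$ with $\frac{d}{ds}\big|_{s=0}\varphi_s=\rho(\eta)$ and $\frac{d}{ds}\big|_{s=0}\Phi_{-s}\circ\beta\circ\varphi_s=[\eta,\beta]$ for all sections $\beta$ of $E$. The $k$-th order complete lift $\eta^k$ of $\eta$ is defined by $\eta^k([a]^{k-1})=\bigl(\eta(\tau(a(0))),\frac{d}{ds}\big|_{s=0}[\Phi_s\circ a]^{k-1}\bigr)$ (for $k=0$ the second component is $\frac{d}{ds}\big|_{s=0}\varphi_s$). Then for every $k\ge 0$ the complete lift $\eta^k$ is a well-defined smooth section of $\mathcal T^EE^k$,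 and $$d_T\circ i_{\eta^k}=i_{\eta^{k+1}}\circ d_T$$ on forms of every positive degree on $\mathcal T^EE^k$ (on functions both sides are zero). Conversely, if $Z$ is a smooth section of $\mathcal T^EE^{k+1}$ that projects to $\eta$ (its first component at $A$ is $\eta(\tau_{k+1,0}(A))$) and satisfies $d_T\circ i_{\eta^k}=i_Z\circ d_T$ on all $1$-forms on $\mathcal T^EE^k$, then $Z=\eta^{k+1}$. -/

import Mathlib

open Bundle Set Filter Topology
open scoped Manifold ContDiff

noncomputable section

variable (B : Type*) [NormedAddCommGroup B] [NormedSpace ℝ B]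
  {M : Type*} [TopologicalSpace M] [ChartedSpace B M]
  (F : Type*) [NormedAddCommGroup F] [NormedSpace ℝ F]
  (E : M → Type*) [∀ x, AddCommGroup (E x)] [∀ x, Module ℝ (E x)]
  [∀ x, TopologicalSpace (E x)] [TopologicalSpace (TotalSpace F E)]
  [FiberBundle F E]

/-- The real vector space of smooth sections of the vector bundle `E → M`. -/
abbrev Sec := Cₛ^∞⟮𝓘(ℝ, B); F, E⟯

/-- Smooth functions on the base manifold `M`. -/
abbrev BaseFun (M : Type*) [TopologicalSpace M] [ChartedSpace B M] :=
  C^∞⟮𝓘(ℝ, B), M; 𝓘(ℝ, ℝ), ℝ⟯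

/-- Smooth functions on the total space of the vector bundle `E → M`. -/
abbrev TotFun := C^∞⟮𝓘(ℝ, B).prod 𝓘(ℝ, F), TotalSpace F E; 𝓘(ℝ, ℝ), ℝ⟯

variable {B} in
/-- The derivative `v f = df(v)` of a function on `M` along a tangent vector. -/
def dirDeriv (f : M → ℝ) (x : M) (v : TangentSpace 𝓘(ℝ, B) x) : ℝ :=
  mfderiv 𝓘(ℝ, B) 𝓘(ℝ, ℝ) f x v

variable [IsManifold 𝓘(ℝ, B) ∞ M] [VectorBundle ℝ F E]

/-- A Lie algebroid structure on the smooth vector bundle `E → M`: a vector bundle map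
`ρ : E → TM` over the identity (the anchor) and a Lie algebra structure on the space of smooth
sections such that `[σ, f η] = f [σ, η] + (ρ(σ) f) η`. -/
structure LieAlgebroid where
  anchor : ∀ x : M, E x →ₗ[ℝ] TangentSpace 𝓘(ℝ, B) x
  contMDiff_anchor : ContMDiff (𝓘(ℝ, B).prod 𝓘(ℝ, F)) 𝓘(ℝ, B).tangent ∞
    (fun e : TotalSpace F E ↦ (⟨e.proj, anchor e.proj e.2⟩ : TangentBundle 𝓘(ℝ, B) M))
  bracket : Sec B F E →ₗ[ℝ] Sec B F E →ₗ[ℝ] Sec B F E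
  bracket_self : ∀ σ, bracket σ σ = 0
  jacobi : ∀ σ η ζ, bracket σ (bracket η ζ) = bracket (bracket σ η) ζ + bracket η (bracket σ ζ)
  leibniz : ∀ (σ η ζ : Sec B F E) (f : BaseFun B M), (∀ x, ζ x = f x • η x) →
    ∀ x, bracket σ ζ x = f x • bracket σ η x + dirDeriv f x (anchor x (σ x)) • η x

namespace LieAlgebroid

variable {B F E}
variable (L : LieAlgebroid B F E)

/-- The function `ρ(η) f` on `M`. -/
def anchorDeriv (η : Sec B F E) (f : BaseFun B M) : BaseFun B M where
  val x := dirDeriv f x (L.anchor x (η x))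
  property := by
    have h1 : ContMDiff 𝓘(ℝ, B) 𝓘(ℝ, B).tangent ∞
        (fun x ↦ (⟨x, L.anchor x (η x)⟩ : TangentBundle 𝓘(ℝ, B) M)) :=
      L.contMDiff_anchor.comp η.contMDiff
    have h2 := (f.contMDiff.contMDiff_tangentMap (m := ∞) (by simp)).comp h1
    exact (contMDiff_snd_tangentBundle_modelSpace ℝ 𝓘(ℝ, ℝ)).comp h2

lemma anchorDeriv_apply (η : Sec B F E) (f : BaseFun B M) (x : M) :
    L.anchorDeriv η f x = dirDeriv f x (L.anchor x (η x)) := rfl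

/-! ### Jets of admissible curves -/

/-- A curve `a` in `E`, defined and smooth near `0`, is admissible if `ρ ∘ a` is the velocity of
its base curve. Only the germ of `a` at `0` matters. -/
def IsAdmissible (a : ℝ → TotalSpace F E) : Prop :=
  ∃ U : Set ℝ, IsOpen U ∧ (0 : ℝ) ∈ U ∧
    ContMDiffOn 𝓘(ℝ, ℝ) (𝓘(ℝ, B).prod 𝓘(ℝ, F)) ∞ a U ∧
    ∀ t ∈ U, mfderiv 𝓘(ℝ, ℝ) 𝓘(ℝ, B) (fun s ↦ (a s).proj) t (1 : ℝ) =
      L.anchor (a t).proj (a t).2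

/-- The manifold `E^k` of `(k - 1)`-jets at `0` of admissible curves. Two curves have the same
`(k - 1)`-jet when, for every smooth function `f` on the total space, the derivatives at `0` of
orders `0, …, k - 1` of `f` along both curves agree; so the jet of `a` is recorded as the family
of the numbers `(f ∘ a)^(j)(0)`, `j < k`, together with its base point in `M`. For `k = 0` this
is `M`. -/
structure EJet (k : ℕ) where
  base : M
  jet : TotFun B F E → Fin k → ℝ
  exists_curve : ∃ a : ℝ → TotalSpace F E, L.IsAdmissible a ∧ (a 0).proj = base ∧
    ∀ f j, jet f j = iteratedDeriv (j : ℕ) (fun t ↦ f (a t)) 0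

variable {L} {k : ℕ}

/-- `A.IsJetOf a` : the point `A` of `E^k` is the jet `[a]^{k-1}` of the admissible curve `a`. -/
def EJet.IsJetOf (A : L.EJet k) (a : ℝ → TotalSpace F E) : Prop :=
  L.IsAdmissible a ∧ (a 0).proj = A.base ∧
    ∀ f j, A.jet f j = iteratedDeriv (j : ℕ) (fun t ↦ f (a t)) 0

/-- The projection `τ_{k+1,k} : E^{k+1} → E^k`. -/
def EJet.trunc (A : L.EJet (k + 1)) : L.EJet k where
  base := A.base
  jet f j := A.jet f j.castSucc
  exists_curve := by
    obtain ⟨a, h, h0, hj⟩ := A.exists_curve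
    exact ⟨a, h, h0, fun f j ↦ by simpa using hj f j.castSucc⟩

variable (B F E) in
/-- The domain in `M` of a preferred chart of `M` and a preferred local trivialization of `E`. -/
def chartDomain (x₀ : M) : Set M :=
  (extChartAt 𝓘(ℝ, B) x₀).source ∩ (trivializationAt F E x₀).baseSet

variable (B F E) in
/-- The coordinates `(x^i, y^α_r)` of the jet `[a]^{k-1}`: the coordinates of the base point
`τ(a(0))` and the derivatives of orders `0, …, k - 1` at `0` of the fibre coordinates of `a`. -/
def jetCoord (k : ℕ) (x₀ : M) (a : ℝ → TotalSpace F E) : B × (Fin k → F) :=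
  (extChartAt 𝓘(ℝ, B) x₀ (a 0).proj,
    fun r ↦ iteratedDeriv (r : ℕ) (fun t ↦ (trivializationAt F E x₀ (a t)).2) 0)

/-- A function on `E^k` is smooth if it is a smooth function of the coordinates `(x^i, y^α_r)`,
which identify the part of `E^k` over a chart domain with an open set. -/
def IsSmooth (φ : L.EJet k → ℝ) : Prop :=
  ∀ x₀ : M, ∃ g : B × (Fin k → F) → ℝ,
    ContDiffOn ℝ ∞ g ((extChartAt 𝓘(ℝ, B) x₀ '' chartDomain B F E x₀) ×ˢ univ) ∧
    ∀ (A : L.EJet k) (a : ℝ → TotalSpace F E), A.IsJetOf a → A.base ∈ chartDomain B F E x₀ →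
      φ A = g (jetCoord B F E k x₀ a)

variable (L k) in
/-- The algebra `C^∞(E^k)`. -/
def smoothFun : Subalgebra ℝ (L.EJet k → ℝ) where
  carrier := {φ | IsSmooth φ}
  mul_mem' {φ ψ} hφ hψ x₀ := by
    obtain ⟨g, hg, h⟩ := hφ x₀
    obtain ⟨g', hg', h'⟩ := hψ x₀
    exact ⟨fun z ↦ g z * g' z, hg.mul hg', fun A a ha hA ↦ by
      rw [Pi.mul_apply, h A a ha hA, h' A a ha hA]⟩
  add_mem' {φ ψ} hφ hψ x₀ := by
    obtain ⟨g, hg, h⟩ := hφ x₀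
    obtain ⟨g', hg', h'⟩ := hψ x₀
    exact ⟨fun z ↦ g z + g' z, hg.add hg', fun A a ha hA ↦ by
      rw [Pi.add_apply, h A a ha hA, h' A a ha hA]⟩
  algebraMap_mem' r x₀ := ⟨fun _ ↦ r, contDiffOn_const, fun _ _ _ _ ↦ rfl⟩

variable (L k) in
/-- The pullback `τ_{k,0}^* f` of a function `f` on `M`. -/
def pullbackBase (f : BaseFun B M) : L.smoothFun k where
  val A := f A.base
  property x₀ := by
    refine ⟨fun z ↦ f ((extChartAt 𝓘(ℝ, B) x₀).symm z.1), ?_, ?_⟩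
    · have h1 : ContMDiffOn 𝓘(ℝ, B) 𝓘(ℝ, ℝ) ∞ (fun z ↦ f ((extChartAt 𝓘(ℝ, B) x₀).symm z))
          (extChartAt 𝓘(ℝ, B) x₀).target :=
        f.contMDiff.comp_contMDiffOn (contMDiffOn_extChartAt_symm x₀)
      refine h1.contDiffOn.comp contDiff_fst.contDiffOn ?_
      rintro ⟨z, y⟩ ⟨⟨x, hx, rfl⟩, -⟩
      exact (extChartAt 𝓘(ℝ, B) x₀).map_source hx.1
    · intro A a ha hA
      simp only [jetCoord, ha.2.1]
      rw [(extChartAt 𝓘(ℝ, B) x₀).left_inv hA.1]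

/-- The pullback `τ_{k+1,k}^* : C^∞(E^k) → C^∞(E^{k+1})`. -/
def pullbackTrunc : L.smoothFun k →ₗ[ℝ] L.smoothFun (k + 1) where
  toFun φ := ⟨fun A ↦ φ.1 A.trunc, fun x₀ ↦ by
    obtain ⟨g, hg, h⟩ := φ.2 x₀
    refine ⟨fun z ↦ g (z.1, fun r ↦ z.2 r.castSucc), ?_, ?_⟩
    · refine hg.comp (ContDiff.contDiffOn (by fun_prop)) ?_
      rintro ⟨z, y⟩ hz
      exact ⟨hz.1, trivial⟩
    · intro A a ha hA
      exact h A.trunc a ⟨ha.1, ha.2.1, fun f j ↦ ha.2.2 f j.castSucc⟩ hA⟩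
  map_add' _ _ := rfl
  map_smul' _ _ := rfl

/-- The tangent space `T_A E^k`, as the space of derivations at `A` of `C^∞(E^k)`. -/
def tangentAt (A : L.EJet k) : Submodule ℝ (L.smoothFun k →ₗ[ℝ] ℝ) where
  carrier := {v | ∀ φ ψ, v (φ * ψ) = φ.1 A * v ψ + ψ.1 A * v φ}
  add_mem' {v w} hv hw φ ψ := by
    simp only [LinearMap.add_apply, hv φ ψ, hw φ ψ]; ring
  zero_mem' φ ψ := by simp
  smul_mem' c v hv φ ψ := by
    simp only [LinearMap.smul_apply, hv φ ψ, smul_eq_mul]; ring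

/-- The derivative `v φ` of a function on `E^k` along a tangent vector
(`0` by convention if `φ` is not smooth). -/
def tangentApp {A : L.EJet k} (v : tangentAt A) (φ : L.EJet k → ℝ) : ℝ :=
  open Classical in if h : φ ∈ L.smoothFun k then v.1 ⟨φ, h⟩ else 0

/-- `v` is the velocity at parameter `0` of the curve `c` in `E^k`. -/
def IsVelocity {A : L.EJet k} (c : ℝ → L.EJet k) (v : tangentAt A) : Prop :=
  ∀ φ : L.smoothFun k, HasDerivAt (fun s ↦ φ.1 (c s)) (v.1 φ) 0

/-! ### The `E`-tangent bundle of `E^k` -/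

/-- The fibre at `A` of the `E`-tangent `𝒯^E E^k`: the pairs `(b, v)` with `b ∈ E` over the base
point of `A`, `v ∈ T_A E^k` and `ρ(b) = Tτ_{k,0}(v)`. -/
def ETangent (A : L.EJet k) : Submodule ℝ (E A.base × tangentAt A) where
  carrier := {z | ∀ f : BaseFun B M,
    z.2.1 (pullbackBase L k f) = dirDeriv f A.base (L.anchor A.base z.1)}
  add_mem' {z w} hz hw f := by
    have h1 := hz f
    have h2 := hw f
    simp only [dirDeriv] at h1 h2
    simp [dirDeriv, h1, h2]
    rfl
  zero_mem' f := by simp [dirDeriv]; rfl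
  smul_mem' c z hz f := by
    have h1 := hz f
    simp only [dirDeriv] at h1
    simp [dirDeriv, h1]
    rfl

/-- The first component `b` of `(b, v)`. -/
abbrev fib {A : L.EJet k} (z : ETangent A) : E A.base := z.1.1

/-- The second component `v` of `(b, v)`, which is also its image under the anchor
`𝒯^E E^k → T E^k`. -/
abbrev vec {A : L.EJet k} (z : ETangent A) : tangentAt A := z.1.2

/-- The map `𝒯τ_{k+1,k} : 𝒯^E E^{k+1} → 𝒯^E E^k`, `(b, v) ↦ (b, Tτ_{k+1,k}(v))`. -/
def ETangent.trunc (A : L.EJet (k + 1)) : ETangent A →ₗ[ℝ] ETangent A.trunc where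
  toFun z := ⟨(fib (A := A) z, ⟨(vec (A := A) z).1 ∘ₗ pullbackTrunc, fun φ ψ ↦
    (vec (A := A) z).2 (pullbackTrunc φ) (pullbackTrunc ψ)⟩), fun f ↦ z.2 f⟩
  map_add' _ _ := rfl
  map_smul' _ _ := rfl
/-! ### The canonical section `T` along `τ_{k+1,k}` -/

lemma IsAdmissible.shift {a : ℝ → TotalSpace F E} (ha : L.IsAdmissible a) :
    ∀ᶠ t in 𝓝 (0 : ℝ), L.IsAdmissible (fun s ↦ a (t + s)) := by
  obtain ⟨U, hU, h0, hs, had⟩ := ha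
  filter_upwards [hU.mem_nhds h0] with t ht
  have hcont : Continuous fun s : ℝ ↦ t + s := by fun_prop
  have hsm : ContMDiff 𝓘(ℝ, ℝ) 𝓘(ℝ, ℝ) ∞ fun s : ℝ ↦ t + s :=
    ContDiff.contMDiff (by fun_prop)
  refine ⟨(fun s ↦ t + s) ⁻¹' U, hU.preimage hcont, by simpa using ht,
    hs.comp hsm.contMDiffOn (fun s hs ↦ hs), fun s hsU ↦ ?_⟩
  rw [← had (t + s) hsU]
  have hd : MDifferentiableAt 𝓘(ℝ, ℝ) 𝓘(ℝ, B) (fun r ↦ (a r).proj) (t + s) :=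
    ((Bundle.contMDiff_proj E).contMDiffAt.comp _
      (hs.contMDiffAt (hU.mem_nhds hsU))).mdifferentiableAt (n := ∞) (by simp)
  have hl : HasMFDerivAt 𝓘(ℝ, ℝ) 𝓘(ℝ, ℝ) (fun r : ℝ ↦ t + r) s (ContinuousLinearMap.id ℝ ℝ) :=
    ((hasFDerivAt_id s).const_add t).hasMFDerivAt
  have := (hd.hasMFDerivAt.comp s hl).mfderiv
  exact congrArg (fun l : ℝ →L[ℝ] B ↦ l 1) this

set_option linter.unusedSectionVars false in
lemma isOpen_image_chartDomain (x₀ : M) :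
    IsOpen (extChartAt 𝓘(ℝ, B) x₀ '' chartDomain B F E x₀) := by
  have h : chartDomain B F E x₀ ⊆ (chartAt B x₀).source := by
    intro x hx; simpa using hx.1
  have := (chartAt B x₀).isOpen_image_of_subset_source (s := chartDomain B F E x₀)
    ((isOpen_extChartAt_source x₀).inter (trivializationAt F E x₀).open_baseSet) h
  simpa [extChartAt] using this

lemma differentiableAt_jet {a : ℝ → TotalSpace F E} (ha : L.IsAdmissible a) {c : ℝ → L.EJet k}
    (hc : ∀ᶠ t in 𝓝 (0 : ℝ), (c t).IsJetOf (fun s ↦ a (t + s))) (φ : L.smoothFun k) :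
    DifferentiableAt ℝ (fun t ↦ φ.1 (c t)) 0 := by
  obtain ⟨U, hU, h0, hs, had⟩ := ha
  have hsm := hs.contMDiffAt (hU.mem_nhds h0)
  set x₀ := (a 0).proj with hx₀
  obtain ⟨g, hg, hφ⟩ := φ.2 x₀
  have hdom : chartDomain B F E x₀ ∈ 𝓝 x₀ :=
    inter_mem (extChartAt_source_mem_nhds x₀)
      ((trivializationAt F E x₀).open_baseSet.mem_nhds (FiberBundle.mem_baseSet_trivializationAt' x₀))
  have hproj : ContMDiffAt 𝓘(ℝ, ℝ) 𝓘(ℝ, B) ∞ (fun r ↦ (a r).proj) 0 :=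
    (Bundle.contMDiff_proj E).contMDiffAt.comp _ hsm
  have hy : ContDiffAt ℝ ∞ (fun t ↦ (trivializationAt F E x₀ (a t)).2) 0 :=
    ((Bundle.contMDiffAt_totalSpace.mp hsm).2).contDiffAt
  have hx : ContDiffAt ℝ ∞ (fun t ↦ extChartAt 𝓘(ℝ, B) x₀ (a t).proj) 0 := by
    refine ContMDiffAt.contDiffAt ?_
    exact ContMDiffAt.comp (0 : ℝ) (contMDiffAt_extChartAt (n := ∞)) hproj
  have heq : (fun t ↦ φ.1 (c t)) =ᶠ[𝓝 0] fun t ↦ g (extChartAt 𝓘(ℝ, B) x₀ (a t).proj,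
      fun r : Fin k ↦ iteratedDeriv (r : ℕ) (fun t ↦ (trivializationAt F E x₀ (a t)).2) t) := by
    filter_upwards [hc, hproj.continuousAt.preimage_mem_nhds hdom] with t ht htd
    have hb : (a t).proj = (c t).base := by simpa using ht.2.1
    rw [hφ (c t) _ ht (hb ▸ htd)]
    simp only [jetCoord, add_zero]
    congr 2
    funext r
    have := congrFun (iteratedDeriv_comp_const_add (r : ℕ)
      (fun t ↦ (trivializationAt F E x₀ (a t)).2) t) 0
    simpa using this
  refine DifferentiableAt.congr_of_eventuallyEq ?_ heq
  have hgd : DifferentiableAt ℝ g (extChartAt 𝓘(ℝ, B) x₀ (a 0).proj,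
      fun r : Fin k ↦ iteratedDeriv (r : ℕ) (fun t ↦ (trivializationAt F E x₀ (a t)).2) 0) := by
    refine (hg.contDiffAt (((isOpen_image_chartDomain x₀).prod isOpen_univ).mem_nhds
      ⟨⟨x₀, mem_of_mem_nhds hdom, rfl⟩, trivial⟩)).differentiableAt (by simp)
  refine hgd.comp (0 : ℝ) ((hx.differentiableAt (by simp)).prodMk (differentiableAt_pi.mpr fun r ↦ ?_))
  have hr : ∀ r : ℕ, ContDiffAt ℝ ∞
      (iteratedDeriv r fun t ↦ (trivializationAt F E x₀ (a t)).2) 0 := by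
    intro r
    induction r with
    | zero => simpa using hy
    | succ r ih =>
      rw [iteratedDeriv_succ]
      exact (ih.fderiv_right (m := ∞) (by simp)).clm_apply contDiffAt_const
  exact (hr r).differentiableAt (by simp)

/-- `T([a]^k) = (a^k(0), a(0), (d a^k / dt)(0))`, where `a^k(t) = [s ↦ a(t + s)]^{k-1}`; the point
`a^k(0)` of `E^k` is the projection of `[a]^k`. -/
def IsCanonicalAt (A : L.EJet (k + 1)) (z : ETangent A.trunc) : Prop :=
  ∃ (a : ℝ → TotalSpace F E) (c : ℝ → L.EJet k), A.IsJetOf a ∧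
    (⟨A.base, fib (A := A.trunc) z⟩ : TotalSpace F E) = a 0 ∧
    (∀ᶠ t in 𝓝 (0 : ℝ), (c t).IsJetOf (fun s ↦ a (t + s))) ∧
    IsVelocity c (vec (A := A.trunc) z)

lemma exists_isCanonicalAt (A : L.EJet (k + 1)) : ∃ z, IsCanonicalAt A z := by
  classical
  obtain ⟨a, ha, hb, hj⟩ := A.exists_curve
  let c : ℝ → L.EJet k := fun t ↦ if h : L.IsAdmissible (fun s ↦ a (t + s)) then
    ⟨(a t).proj, fun f j ↦ iteratedDeriv (j : ℕ) (fun s ↦ f (a (t + s))) 0,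
      _, h, by simp, fun _ _ ↦ rfl⟩ else A.trunc
  have hc : ∀ᶠ t in 𝓝 (0 : ℝ), (c t).IsJetOf (fun s ↦ a (t + s)) := by
    filter_upwards [ha.shift] with t ht
    simp only [c, dif_pos ht]
    exact ⟨ht, by simp, fun _ _ ↦ rfl⟩
  have hc0 : c 0 = A.trunc := by
    have h : L.IsAdmissible (fun s ↦ a (0 + s)) := by simpa using ha
    simp only [c, dif_pos h]
    obtain ⟨x, J, hJ⟩ := A
    simp only at hb hj
    subst hb
    simp only [EJet.trunc, EJet.mk.injEq, true_and]
    funext f j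
    simpa using (hj f j.castSucc).symm
  have hd (φ : L.smoothFun k) := (differentiableAt_jet ha hc φ).hasDerivAt
  have hbase : ∃ b : E A.base, (⟨A.base, b⟩ : TotalSpace F E) = a 0 := by
    obtain ⟨x, J, hJ⟩ := A
    simp only at hb
    subst hb
    exact ⟨(a 0).2, rfl⟩
  obtain ⟨b, hab⟩ := hbase
  let v : L.smoothFun k →ₗ[ℝ] ℝ :=
    { toFun φ := deriv (fun t ↦ φ.1 (c t)) 0
      map_add' φ ψ := ((hd φ).add (hd ψ)).deriv
      map_smul' r φ := ((hd φ).const_mul r).deriv }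
  have hv : v ∈ tangentAt A.trunc := by
    intro φ ψ
    have := ((hd φ).mul (hd ψ)).deriv
    rw [hc0] at this
    refine Eq.trans this ?_
    simp only [v, LinearMap.coe_mk, AddHom.coe_mk]
    ring
  refine ⟨⟨(b, ⟨v, hv⟩), fun f ↦ ?_⟩, a, c, ⟨ha, hb, hj⟩, hab, hc, hd⟩
  obtain ⟨U, hU, h0, hs, had⟩ := ha
  have hproj : MDifferentiableAt 𝓘(ℝ, ℝ) 𝓘(ℝ, B) (fun r ↦ (a r).proj) 0 :=
    ((Bundle.contMDiff_proj E).contMDiffAt.comp _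
      (hs.contMDiffAt (hU.mem_nhds h0))).mdifferentiableAt (n := ∞) (by simp)
  have hf : MDifferentiableAt 𝓘(ℝ, B) 𝓘(ℝ, ℝ) f (a 0).proj :=
    f.contMDiff.mdifferentiable (by simp) _
  have h1 : HasDerivAt (fun t ↦ f (a t).proj) (dirDeriv f (a 0).proj
      (mfderiv 𝓘(ℝ, ℝ) 𝓘(ℝ, B) (fun s ↦ (a s).proj) 0 (1 : ℝ))) 0 :=
    hasDerivAt_iff_hasFDerivAt.mpr (by
      have h := (hf.hasMFDerivAt.comp (0 : ℝ) hproj.hasMFDerivAt).hasFDerivAt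
      refine h.congr_fderiv ?_
      ext
      exact (one_smul ℝ _).symm)
  have h2 : (fun t ↦ f (c t).base) =ᶠ[𝓝 0] fun t ↦ f (a t).proj := by
    filter_upwards [hc] with t ht
    have h := ht.2.1
    simp only [add_zero] at h
    rw [h]
  have h3 : (⟨A.base, b⟩ : TotalSpace F E) = a 0 := hab
  refine (h1.congr_of_eventuallyEq h2).deriv.trans ?_
  rw [had 0 h0, ← h3]
  rfl

/-- The canonical section `T = i_{k,1}` of `𝒯^E E^k` along `τ_{k+1,k}`. -/
def canonicalT (A : L.EJet (k + 1)) : ETangent A.trunc :=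
  (exists_isCanonicalAt A).choose
/-! ### Sections of `𝒯^E E^k` and their bracket -/

variable (L k) in
/-- The smooth sections of `𝒯^E E^k → E^k`: both components depend smoothly on the point, that is,
`A ↦ v_A(φ)` is smooth for every `φ` in `C^∞(E^k)`, and `A ↦ b_A` pulls smooth functions on the
manifold `E` back to smooth functions on `E^k`. -/
structure ESection where
  toFun : ∀ A : L.EJet k, ETangent A
  smooth_vec : ∀ φ : L.smoothFun k, (fun A ↦ (vec (toFun A)).1 φ) ∈ L.smoothFun k
  smooth_fib : ∀ f : TotFun B F E,
    (fun A ↦ f (⟨A.base, fib (toFun A)⟩ : TotalSpace F E)) ∈ L.smoothFun k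

/-- The section `Z` of `𝒯^E E^k` projects to the section `η` of `E`:
`𝒯τ_{k,0} ∘ Z = η ∘ τ_{k,0}`. -/
def ESection.ProjectsTo (Z : L.ESection k) (η : Sec B F E) : Prop :=
  ∀ A : L.EJet k, fib (Z.toFun A) = η A.base

/-- The function `v(φ)` on `E^k`, where `v` is the vector component (the anchor) of `Z`. -/
def ESection.deriv (Z : L.ESection k) (φ : L.smoothFun k) : L.smoothFun k :=
  ⟨fun A ↦ (vec (Z.toFun A)).1 φ, Z.smooth_vec φ⟩
variable [FiniteDimensional ℝ B] [T2Space M] [SigmaCompactSpace M]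
  [ContMDiffVectorBundle ∞ F E 𝓘(ℝ, B)]

lemma exists_section (x : M) (v : E x) : ∃ β : Sec B F E, β x = v := by
  let t : ∀ y, Set (E y) := fun y ↦ {w : E y | ∀ h : y = x, w = h ▸ v}
  have ht : ∀ y, Convex ℝ (t y) := by
    intro y
    by_cases h : y = x
    · subst h
      have : t y = {v} := by ext; simp [t]
      rw [this]; exact convex_singleton v
    · have : t y = univ := by ext; simp [t, h]
      rw [this]; exact convex_univ
  have hloc : ∀ x₀ : M, ∃ U ∈ 𝓝 x₀, ∃ s : (y : M) → E y,
      ContMDiffOn 𝓘(ℝ, B) (𝓘(ℝ, B).prod 𝓘(ℝ, F)) ∞ (fun y ↦ (⟨y, s y⟩ : TotalSpace F E)) U ∧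
        ∀ y ∈ U, s y ∈ t y := by
    intro x₀
    by_cases h : x₀ = x
    · subst h
      obtain ⟨U, hU, hs⟩ := FiberBundle.exists_contMDiffOn_extend (k := ∞) 𝓘(ℝ, B) F v
      refine ⟨U, hU, FiberBundle.extend F v, hs, ?_⟩
      rintro y - rfl
      simp
    · refine ⟨{x}ᶜ, isOpen_compl_singleton.mem_nhds h, fun _ ↦ 0,
        (contMDiff_zeroSection ℝ E).contMDiffOn, ?_⟩
      intro y hy hyx
      exact absurd hyx hy
  obtain ⟨s, hs⟩ := exists_contMDiffSection_forall_mem_convex_of_local 𝓘(ℝ, B) (n := ⊤) E t ht hloc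
  exact ⟨s, hs x rfl⟩

/-- The anchor is compatible with brackets. -/
lemma dirDeriv_anchor_bracket (σ η : Sec B F E) (f : BaseFun B M) (x : M) :
    dirDeriv f x (L.anchor x (L.bracket σ η x)) =
      L.anchorDeriv σ (L.anchorDeriv η f) x - L.anchorDeriv η (L.anchorDeriv σ f) x := by
  by_cases hE : ∀ v : E x, v = 0
  · simp only [anchorDeriv_apply]
    rw [hE (L.bracket σ η x), hE (σ x), hE (η x)]
    simp [dirDeriv]
    exact (sub_zero _).symm
  push Not at hE
  obtain ⟨v, hv⟩ := hE
  obtain ⟨β, rfl⟩ := exists_section (B := B) (F := F) x v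
  have mulSec (g : BaseFun B M) (τ : Sec B F E) : ∃ ζ : Sec B F E, ∀ y, ζ y = g y • τ y :=
    ⟨⟨fun y ↦ g y • τ y, g.contMDiff.smul_section τ.contMDiff⟩, fun _ ↦ rfl⟩
  have key (τ η β : Sec B F E) (fβ : Sec B F E) (hfβ : ∀ y, fβ y = f y • β y) :
      L.bracket τ (L.bracket η fβ) x = f x • L.bracket τ (L.bracket η β) x
        + L.anchorDeriv τ f x • L.bracket η β x + L.anchorDeriv η f x • L.bracket τ β x
        + L.anchorDeriv τ (L.anchorDeriv η f) x • β x := by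
    obtain ⟨ζ₁, h₁⟩ := mulSec f (L.bracket η β)
    obtain ⟨ζ₂, h₂⟩ := mulSec (L.anchorDeriv η f) β
    have h : L.bracket η fβ = ζ₁ + ζ₂ := by
      ext y
      rw [L.leibniz η β fβ f hfβ y]
      simp [h₁, h₂, anchorDeriv_apply]
    rw [h, map_add, ContMDiffSection.coe_add, Pi.add_apply, L.leibniz _ _ _ _ h₁,
      L.leibniz _ _ _ _ h₂]
    simp only [anchorDeriv_apply]
    abel
  obtain ⟨fβ, hfβ⟩ := mulSec f β
  have J := congrArg (fun τ : Sec B F E ↦ τ x) (L.jacobi σ η fβ)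
  have J' := congrArg (fun τ : Sec B F E ↦ τ x) (L.jacobi σ η β)
  simp only [ContMDiffSection.coe_add, Pi.add_apply] at J J'
  rw [key σ η β fβ hfβ, key η σ β fβ hfβ, L.leibniz _ β fβ f hfβ, J'] at J
  have hz : (dirDeriv f x (L.anchor x (L.bracket σ η x)) -
      (L.anchorDeriv σ (L.anchorDeriv η f) x - L.anchorDeriv η (L.anchorDeriv σ f) x)) • β x
      = 0 := by
    rw [sub_smul, sub_smul, ← neg_eq_zero]
    have := sub_eq_zero.mpr J
    rw [smul_add] at this
    rw [← this]
    simp only [← anchorDeriv_apply]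
    abel
  rcases smul_eq_zero.mp hz with h | h
  · linarith
  · exact absurd h hv

/-- The value at `A` of the bracket of two projectable sections of `𝒯^E E^k`: if `Z` and `W` have
components `(σ ∘ τ_{k,0}, X)` and `(η ∘ τ_{k,0}, Y)`, then `[Z, W]` has components
`([σ, η] ∘ τ_{k,0}, [X, Y])`. -/
def projBracket {Z W : L.ESection k} {σ η : Sec B F E} (hZ : Z.ProjectsTo σ)
    (hW : W.ProjectsTo η) (A : L.EJet k) : ETangent A where
  val := (L.bracket σ η A.base,
    ⟨{ toFun φ := (vec (Z.toFun A)).1 (W.deriv φ) - (vec (W.toFun A)).1 (Z.deriv φ)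
       map_add' φ ψ := by
        have h1 : W.deriv (φ + ψ) = W.deriv φ + W.deriv ψ := by
          ext A; exact map_add _ _ _
        have h2 : Z.deriv (φ + ψ) = Z.deriv φ + Z.deriv ψ := by
          ext A; exact map_add _ _ _
        rw [h1, h2, map_add, map_add]; ring
       map_smul' r φ := by
        have h1 : W.deriv (r • φ) = r • W.deriv φ := by
          ext A; exact map_smul _ _ _
        have h2 : Z.deriv (r • φ) = r • Z.deriv φ := by
          ext A; exact map_smul _ _ _
        rw [h1, h2, map_smul, map_smul]
        simp only [smul_eq_mul, RingHom.id_apply]; ring },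
      fun φ ψ ↦ by
        have h1 : W.deriv (φ * ψ) = φ * W.deriv ψ + ψ * W.deriv φ := by
          ext A; exact (vec (W.toFun A)).2 φ ψ
        have h2 : Z.deriv (φ * ψ) = φ * Z.deriv ψ + ψ * Z.deriv φ := by
          ext A; exact (vec (Z.toFun A)).2 φ ψ
        simp only [LinearMap.coe_mk, AddHom.coe_mk]
        rw [h1, h2, map_add, map_add, (vec (Z.toFun A)).2, (vec (Z.toFun A)).2,
          (vec (W.toFun A)).2, (vec (W.toFun A)).2]
        simp only [ESection.deriv]
        ring⟩)
  property f := by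
    have hd {Z : L.ESection k} {σ : Sec B F E} (hZ : Z.ProjectsTo σ) (g : BaseFun B M) :
        Z.deriv (pullbackBase L k g) = pullbackBase L k (L.anchorDeriv σ g) := by
      ext A
      refine ((Z.toFun A).2 g).trans ?_
      exact congrArg (fun b ↦ dirDeriv g A.base (L.anchor A.base b)) (hZ A)
    have hv {Z : L.ESection k} {σ : Sec B F E} (hZ : Z.ProjectsTo σ) (g : BaseFun B M) :
        (vec (Z.toFun A)).1 (pullbackBase L k g) = L.anchorDeriv σ g A.base := by
      refine ((Z.toFun A).2 g).trans ?_
      exact congrArg (fun b ↦ dirDeriv g A.base (L.anchor A.base b)) (hZ A)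
    simp only [LinearMap.coe_mk, AddHom.coe_mk]
    rw [hd hW, hd hZ, hv hZ, hv hW, L.dirDeriv_anchor_bracket]

/-! ### Forms on `𝒯^E E^k` -/

variable (L) in
/-- A field of alternating `p`-forms on the fibres of `𝒯^E E^k`. -/
abbrev EForm (k p : ℕ) := ∀ A : L.EJet k, (ETangent A) [⋀^Fin p]→ₗ[ℝ] ℝ

/-- A `p`-form is smooth, that is, a section of `Λ^p (𝒯^E E^k)^*`, if its values on smooth
sections are smooth functions. -/
def EForm.IsSmooth {p : ℕ} (θ : L.EForm k p) : Prop :=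
  ∀ Z : Fin p → L.ESection k, (fun A ↦ θ A fun i ↦ (Z i).toFun A) ∈ L.smoothFun k

/-- `μ` is the exterior differential `dθ` of the `p`-form `θ` for the Lie algebroid `𝒯^E E^k`:
for all projectable sections `Z_0, …, Z_p` (they span every fibre),
`dθ(Z_0, …, Z_p) = ∑_j (-1)^j ρ(Z_j)(θ(Z_0, …, Ẑ_j, …, Z_p))
  + ∑_{i<j} (-1)^(i+j) θ([Z_i, Z_j], Z_0, …, Ẑ_i, …, Ẑ_j, …, Z_p)`.
In the second sum the bracket is moved to the position of `Z_i`, which turns the sign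
into `(-1)^j`. -/
def IsExtDeriv {p : ℕ} (θ : L.EForm k p) (μ : L.EForm k (p + 1)) : Prop :=
  ∀ (Z : Fin (p + 1) → L.ESection k) (σ : Fin (p + 1) → Sec B F E)
    (h : ∀ i, (Z i).ProjectsTo (σ i)) (A : L.EJet k),
    μ A (fun i ↦ (Z i).toFun A) =
      ∑ j : Fin (p + 1), (-1 : ℝ) ^ (j : ℕ) *
        tangentApp (vec ((Z j).toFun A)) (fun A' ↦ θ A' fun l ↦ (Z (j.succAbove l)).toFun A') +
      ∑ j : Fin (p + 1), ∑ i ∈ Finset.Iio j, (-1 : ℝ) ^ (j : ℕ) *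
        θ A (fun l ↦ Function.update (fun m ↦ (Z m).toFun A) i
          (projBracket (h i) (h j) A) (j.succAbove l))

/-- The exterior differential `d` of the Lie algebroid `𝒯^E E^k` (the zero form by convention
where it does not exist, which does not happen on smooth forms). -/
def extDeriv {p : ℕ} (θ : L.EForm k p) : L.EForm k (p + 1) :=
  open Classical in if h : ∃ μ, IsExtDeriv θ μ then h.choose else fun _ ↦ 0

/-- The contraction `i_Z θ` of a form with a section of `𝒯^E E^k`. -/
def contract {p : ℕ} (Z : ∀ A : L.EJet k, ETangent A) (θ : L.EForm k (p + 1)) : L.EForm k p :=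
  fun A ↦ (θ A).curryLeft (Z A)

/-- The contraction `i_T θ` of a form on `𝒯^E E^k` with the canonical section along `τ_{k+1,k}`,
as a form on `𝒯^E E^{k+1}`: `(i_T θ)(z_1, …, z_p) = θ(T, 𝒯τ z_1, …, 𝒯τ z_p)`. -/
def contractT {p : ℕ} (θ : L.EForm k (p + 1)) : L.EForm (k + 1) p :=
  fun A ↦ ((θ A.trunc).curryLeft (canonicalT A)).compLinearMap (ETangent.trunc A)

/-- The total derivative `d_T = i_T ∘ d + d ∘ i_T`, from `p`-forms on `𝒯^E E^k` to `p`-forms on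
`𝒯^E E^{k+1}` (on functions `i_T = 0`). -/
def totalDeriv : ∀ {p : ℕ}, L.EForm k p → L.EForm (k + 1) p
  | 0, θ => contractT (extDeriv θ)
  | _ + 1, θ => fun A ↦ contractT (extDeriv θ) A + extDeriv (contractT θ) A

/-! ### Flows and complete lifts -/

variable (L) in
/-- `(Φ_s, φ_s)` is the local flow of the section `η` of `E`, on `E|_U` and for `|s| < ε`: a
smooth local one-parameter group of vector bundle maps `Φ_s` over `φ_s` such that
`d/ds φ_s = ρ(η)` and `d/ds (Φ_{-s} ∘ β ∘ φ_s) = [η, β]` at `s = 0`, for every section `β`. -/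
structure IsLocalFlow (η : Sec B F E) (ε : ℝ) (U : Set M) (φ : ℝ → M → M)
    (Φ : ℝ → TotalSpace F E → TotalSpace F E) : Prop where
  pos : 0 < ε
  isOpen : IsOpen U
  smooth : ContMDiffOn (𝓘(ℝ, ℝ).prod (𝓘(ℝ, B).prod 𝓘(ℝ, F))) (𝓘(ℝ, B).prod 𝓘(ℝ, F)) ∞
    (fun q : ℝ × TotalSpace F E ↦ Φ q.1 q.2) (Ioo (-ε) ε ×ˢ (TotalSpace.proj ⁻¹' U))
  linear : ∀ s ∈ Ioo (-ε) ε, ∀ x ∈ U, ∃ ℓ : E x →ₗ[ℝ] E (φ s x), ∀ b : E x,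
    Φ s ⟨x, b⟩ = ⟨φ s x, ℓ b⟩
  zero : ∀ x ∈ U, ∀ b : E x, Φ 0 ⟨x, b⟩ = ⟨x, b⟩
  add : ∀ s ∈ Ioo (-ε) ε, ∀ s' ∈ Ioo (-ε) ε, s + s' ∈ Ioo (-ε) ε → ∀ x ∈ U, φ s' x ∈ U →
    ∀ b : E x, Φ (s + s') ⟨x, b⟩ = Φ s (Φ s' ⟨x, b⟩)
  base_deriv : ∀ x ∈ U, ∀ f : BaseFun B M,
    HasDerivAt (fun s ↦ f (φ s x)) (dirDeriv f x (L.anchor x (η x))) 0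
  deriv : ∀ x ∈ U, ∀ β : Sec B F E,
    HasDerivAt (fun s ↦ (trivializationAt F E x (Φ (-s) ⟨φ s x, β (φ s x)⟩)).2)
      (trivializationAt F E x ⟨x, L.bracket η β x⟩).2 0

/-- `z` is the value at `A = [a]^{k-1}` of the `k`-th order complete lift of `η`:
`z = (η(τ_{k,0}(A)), X)`, where `X` is the velocity at `s = 0` of the curve
`s ↦ Φ_s^k(A) = [Φ_s ∘ a]^{k-1}`, and `Φ` is the local flow of `η` near the base point of `A`. -/
def IsCompleteLiftAt (η : Sec B F E) (A : L.EJet k) (z : ETangent A) : Prop :=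
  fib z = η A.base ∧
  ∃ (ε : ℝ) (U : Set M) (φ : ℝ → M → M) (Φ : ℝ → TotalSpace F E → TotalSpace F E)
    (a : ℝ → TotalSpace F E) (c : ℝ → L.EJet k),
    L.IsLocalFlow η ε U φ Φ ∧ A.base ∈ U ∧ A.IsJetOf a ∧
    (∀ᶠ s in 𝓝 (0 : ℝ), (c s).IsJetOf (fun t ↦ Φ s (a t))) ∧
    IsVelocity c (vec z)

variable (L) in
/-- The `k`-th order complete lift `η^k` of the section `η` of `E` (zero by convention at points
where it does not exist). -/
def completeLift (η : Sec B F E) (k : ℕ) (A : L.EJet k) : ETangent A :=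
  open Classical in if h : ∃ z, IsCompleteLiftAt η A z then h.choose else 0

end LieAlgebroid

end

/-! ### The composition operator on continuous maps, and its consequences -/

/-! The identity says that the canonical section `T` commutes with complete lifts, read through
Cartan calculus. If sections `Z_j` of `𝒯^E E^{k+1}` lie over projectable sections `W_j` of `𝒯^E
E^k`, the Koszul formula for `d` gives `(d_T θ)(Z_1, …, Z_p) = T(θ(W_1, …, W_p)) - ∑_j θ(W_1, …, [T,
W_j], …, W_p)` (`totalDeriv_apply`). Here `[T, W_j]` is a section along `τ_{k+1,k}` whose vector
part is the commutator `φ ↦ T(W_j φ) - Z_j(T φ)`. Since `η^{k+1}` lies over `η^k`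
(`trunc_completeLift`), inserting it in the first slot proves the commutation law once `[T, η^k] =
0` (`lieT_liftSection`).

The commutator part of this vanishing is `tDeriv_liftSection`. A commutator of this kind is a
derivation along `τ_{k+1,k}`, so it is enough to test it on the coordinates `x` and `y_r`. In
coordinates `T` raises the jet order by one, and the complete lift replaces the fibre coordinate `y`
by its Lie derivative `lieY`, jet by jet (`comp_of_isCompleteLiftAt`). On `y_r` both compositions
therefore give the jet of order `r + 1` of `lieY`. On `x` the claim is the compatibility of the
anchor with brackets (`fderiv_R`). The `E`-component of `[T, η^k]` vanishes because `[e, η] + [η, e]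
= 0`.

Conversely, let `ζ` be the difference of two solutions over `η`. It has zero `E`-component and is
annihilated by every `d_T θ` with `θ` a `1`-form. For `θ = (b, v) ↦ y(b)` this kills the component
of `ζ` along `y_0`; for `θ = dy_r` it kills the one along `y_{r+1}` (`eq_zero_of_totalDeriv`).

Two existence statements lie below this. The flow of `η` is built in a chart from the flow of `ρ(η)`
and a linear equation along it (`exists_isLocalFlow`). Uniqueness for ordinary differential
equations shows that this flow preserves admissible curves, so that `[Φ_s ∘ a]` is a curve in `E^k`;
its velocity depends only on `η` and the jet, and smoothly so. The exterior differential is obtained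
by alternating the covariant derivative for which a local frame is parallel, with a torsion
correction (`exists_isExtDeriv`). Smooth dependence of flows on initial data is derived from the
implicit function theorem in the Banach space `C([-1, 1], V)`. -/

section CompOperator

set_option synthInstance.maxHeartbeats 200000

universe w
variable {K : Type*} [TopologicalSpace K] [CompactSpace K]

/-- Pointwise application of a bounded bilinear map to continuous maps. -/
noncomputable def pointwiseApply (K : Type*) [TopologicalSpace K] [CompactSpace K] {X V W : Type w}
    [NormedAddCommGroup X] [NormedSpace ℝ X] [NormedAddCommGroup V] [NormedSpace ℝ V]
    [NormedAddCommGroup W] [NormedSpace ℝ W] (b : X →L[ℝ] V →L[ℝ] W) :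
    C(K, X) →L[ℝ] C(K, V) →L[ℝ] C(K, W) :=
  LinearMap.mkContinuous₂
    (LinearMap.mk₂ ℝ
      (fun (A : C(K, X)) (h : C(K, V)) ↦ ContinuousMap.mk (fun t ↦ b (A t) (h t)) (by fun_prop))
      (fun A A' h ↦ by ext t; simp) (fun c A h ↦ by ext t; simp)
      (fun A h h' ↦ by ext t; simp) (fun c A h ↦ by ext t; simp)) ‖b‖ (fun A h ↦ by
    refine (ContinuousMap.norm_le _ (by positivity)).mpr fun t ↦ ?_
    refine (b.le_opNorm₂ (A t) (h t)).trans ?_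
    gcongr
    exacts [A.norm_coe_le_norm t, h.norm_coe_le_norm t])

/-- Uniformity in `t : K` comes from the continuity of `w ↦ f' ∘ w` in the sup norm, so mere
continuity of `f'` suffices. At each `t` the remainder is bounded by the mean value inequality on
the segment from `u t` to `u t + h t`, whose points are values of maps `u + s h` close to `u`. -/
lemma hasFDerivAt_continuousMap_comp {V W : Type w} [NormedAddCommGroup V] [NormedSpace ℝ V]
    [NormedAddCommGroup W] [NormedSpace ℝ W] {f : V → W} {f' : V → V →L[ℝ] W}
    (hf : ∀ x, HasFDerivAt f (f' x) x) (hc : Continuous f) (hc' : Continuous f') (u : C(K, V)) :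
    HasFDerivAt (fun u : C(K, V) ↦ (ContinuousMap.mk f hc).comp u)
      (pointwiseApply K (.id ℝ (V →L[ℝ] W)) ((ContinuousMap.mk f' hc').comp u)) u := by
  rw [hasFDerivAt_iff_isLittleO_nhds_zero, Asymptotics.isLittleO_iff]
  intro c hcpos
  have hcont : Continuous fun w : C(K, V) ↦ (ContinuousMap.mk f' hc').comp w :=
    ContinuousMap.continuous_postcomp _
  obtain ⟨δ, hδ, hball⟩ := (Metric.continuousAt_iff (α := C(K, V))
    (β := C(K, V →L[ℝ] W))).mp (hcont.continuousAt (x := u)) c hcpos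
  filter_upwards [Metric.ball_mem_nhds (0 : C(K, V)) hδ] with h hh
  rw [mem_ball_zero_iff] at hh
  refine (ContinuousMap.norm_le _ (by positivity)).mpr fun t ↦ ?_
  have key : ∀ x ∈ segment ℝ (u t) (u t + h t), ‖f' x - f' (u t)‖ ≤ c := by
    intro x hx
    rw [segment_eq_image'] at hx
    obtain ⟨s, hs, rfl⟩ := hx
    have h1 : dist (u + s • h) u < δ := by
      rw [dist_eq_norm, add_sub_cancel_left, norm_smul, Real.norm_of_nonneg hs.1]
      exact (mul_le_of_le_one_left (norm_nonneg _) hs.2).trans_lt hh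
    have h2 := ((ContinuousMap.dist_apply_le_dist t).trans (hball h1).le)
    rw [dist_eq_norm] at h2
    simpa using h2
  have := (convex_segment (u t) (u t + h t)).norm_image_sub_le_of_norm_hasFDerivWithin_le'
    (f := f) (φ := f' (u t)) (fun x _ ↦ (hf x).hasFDerivWithinAt) key
    (left_mem_segment ℝ _ _) (right_mem_segment ℝ _ _)
  rw [add_sub_cancel_left] at this
  exact this.trans (mul_le_mul_of_nonneg_left (h.norm_coe_le_norm t) hcpos.le)

/-- The derivative of the composition operator of `f` is the composition operator of `fderiv ℝ f`
followed by a bounded linear map, which drives the induction. `V`, `W` and `V →L[ℝ] W` lie in one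
universe, so the induction hypothesis can be quantified over the spaces. -/
lemma contDiff_continuousMap_comp_nat (n : ℕ) : ∀ {V W : Type w} [NormedAddCommGroup V]
    [NormedSpace ℝ V] [NormedAddCommGroup W] [NormedSpace ℝ W] {f : V → W}
    (hf : ContDiff ℝ n f),
    ContDiff ℝ n (fun u : C(K, V) ↦ (ContinuousMap.mk f hf.continuous).comp u) := by
  induction n with
  | zero =>
    intro V W _ _ _ _ f hf
    exact contDiff_zero.mpr (ContinuousMap.continuous_postcomp _)
  | succ n ih =>
    intro V W _ _ _ _ f hf
    have hf' : ContDiff ℝ n (fderiv ℝ f) := hf.fderiv_right (by norm_cast)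
    have hd : Differentiable ℝ f := hf.differentiable (by simp)
    refine (contDiff_succ_iff_hasFDerivAt (n := n)).mpr ⟨_, ?_, fun u ↦
      hasFDerivAt_continuousMap_comp (fun x ↦ (hd x).hasFDerivAt) hf.continuous hf'.continuous u⟩
    exact (pointwiseApply K (.id ℝ (V →L[ℝ] W))).contDiff.comp (ih hf')

/-- Composition with a smooth map is a smooth operator between spaces of continuous maps. -/
lemma contDiff_continuousMap_comp {V W : Type w} [NormedAddCommGroup V]
    [NormedSpace ℝ V] [NormedAddCommGroup W] [NormedSpace ℝ W] {f : V → W}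
    (hf : ContDiff ℝ ∞ f) :
    ContDiff ℝ ∞ (fun u : C(K, V) ↦ (ContinuousMap.mk f hf.continuous).comp u) :=
  contDiff_infty.mpr fun n ↦ contDiff_continuousMap_comp_nat n (contDiff_infty.mp hf n)

end CompOperator

/-! ### Primitives as a bounded operator, and Hadamard's lemma. -/

section Primitive

set_option synthInstance.maxHeartbeats 200000

universe w
variable (V : Type w) [NormedAddCommGroup V] [NormedSpace ℝ V]

/-- The primitive vanishing at `0`, as an operator on continuous maps on `[-1, 1]`. -/
noncomputable def primitiveCLM : C(Icc (-1 : ℝ) 1, V) →L[ℝ] C(Icc (-1 : ℝ) 1, V) :=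
  LinearMap.mkContinuous
    { toFun u := ⟨fun t ↦ ∫ τ in (0 : ℝ)..t, u (projIcc (-1) 1 (by norm_num) τ), by
        have h : Continuous fun τ : ℝ ↦ u (projIcc (-1) 1 (by norm_num) τ) :=
          u.continuous.comp continuous_projIcc
        exact (intervalIntegral.continuous_primitive
          (fun a b ↦ h.intervalIntegrable a b) 0).comp continuous_subtype_val⟩
      map_add' u v := by
        ext t
        have h (u : C(Icc (-1 : ℝ) 1, V)) :
            Continuous fun τ : ℝ ↦ u (projIcc (-1) 1 (by norm_num) τ) :=
          u.continuous.comp continuous_projIcc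
        exact intervalIntegral.integral_add ((h u).intervalIntegrable _ _)
          ((h v).intervalIntegrable _ _)
      map_smul' c u := by
        ext t
        exact intervalIntegral.integral_smul c _ } 1
    (fun u ↦ by
      rw [one_mul]
      refine (ContinuousMap.norm_le _ (by positivity)).mpr fun t ↦ ?_
      refine (intervalIntegral.norm_integral_le_of_norm_le_const
        (fun τ _ ↦ u.norm_coe_le_norm _)).trans ?_
      refine mul_le_of_le_one_right (norm_nonneg _) ?_
      rw [sub_zero]
      exact abs_le.mpr t.2)

variable {V}

/-- Hadamard's lemma. -/
lemma exists_hadamard {V : Type w} [NormedAddCommGroup V] [NormedSpace ℝ V]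
    {W : Type w} [NormedAddCommGroup W] [NormedSpace ℝ W] [CompleteSpace W] {G : V → W}
    (hG : ContDiff ℝ ∞ G) (x₀ : V) :
    ∃ H : V → V →L[ℝ] W, ContDiff ℝ ∞ H ∧ H x₀ = fderiv ℝ G x₀ ∧
      ∀ x, G x = G x₀ + H x (x - x₀) := by
  have hG' : ContDiff ℝ ∞ (fderiv ℝ G) := hG.fderiv_right (by simp)
  -- The factor is `H x = ∫₀¹ fderiv ℝ G (x₀ + τ (x - x₀)) dτ`. Written as the path `γ x`,
  -- composition with `fderiv ℝ G`, primitive and evaluation at `1`, it is a composite of smooth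
  -- operators, which gives smoothness in `x`.
  let γ : V → C(Icc (-1 : ℝ) 1, V) := fun x ↦
    ⟨fun t ↦ x₀ + (t : ℝ) • (x - x₀), by fun_prop⟩
  let P : V →L[ℝ] C(Icc (-1 : ℝ) 1, V) := LinearMap.mkContinuous
    { toFun x := ⟨fun t ↦ (t : ℝ) • x, by fun_prop⟩
      map_add' x y := by ext t; exact smul_add _ _ _
      map_smul' c x := by ext t; exact smul_comm _ _ _ } 1 (fun x ↦ by
        rw [one_mul]
        refine (ContinuousMap.norm_le _ (by positivity)).mpr fun t ↦ ?_
        simp only [LinearMap.coe_mk, AddHom.coe_mk, ContinuousMap.coe_mk, norm_smul]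
        exact mul_le_of_le_one_left (norm_nonneg _) (abs_le.mpr t.2))
  have hγ : ContDiff ℝ ∞ γ := by
    have : γ = fun x ↦ ContinuousMap.const _ x₀ + P (x - x₀) := by
      funext x; ext t; rfl
    rw [this]
    fun_prop
  let ev : C(Icc (-1 : ℝ) 1, V →L[ℝ] W) →L[ℝ] (V →L[ℝ] W) :=
    ContinuousMap.evalCLM ℝ (⟨1, by simp⟩ : Icc (-1 : ℝ) 1)
  have hval (x : V) : ev (primitiveCLM _ ((ContinuousMap.mk _ hG'.continuous).comp (γ x))) =
      ∫ τ in (0 : ℝ)..1, fderiv ℝ G (x₀ + τ • (x - x₀)) := by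
    refine intervalIntegral.integral_congr fun τ hτ ↦ ?_
    rw [uIcc_of_le zero_le_one] at hτ
    simp only [ContinuousMap.comp_apply, ContinuousMap.coe_mk, γ]
    rw [projIcc_of_mem _ (⟨by linarith [hτ.1], hτ.2⟩ : τ ∈ Icc (-1 : ℝ) 1)]
  refine ⟨fun x ↦ ev (primitiveCLM _ ((ContinuousMap.mk _ hG'.continuous).comp (γ x))), ?_, ?_, ?_⟩
  · exact ev.contDiff.comp ((primitiveCLM _).contDiff.comp
      ((contDiff_continuousMap_comp hG').comp hγ))
  · refine (hval x₀).trans ?_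
    simp
  · intro x
    change _ = _ + ev _ _
    rw [hval]
    have hd (τ : ℝ) : HasDerivAt (fun τ : ℝ ↦ G (x₀ + τ • (x - x₀)))
        (fderiv ℝ G (x₀ + τ • (x - x₀)) (x - x₀)) τ := by
      have h1 : HasDerivAt (fun τ : ℝ ↦ x₀ + τ • (x - x₀)) (x - x₀) τ := by
        simpa using ((hasDerivAt_id τ).smul_const (x - x₀)).const_add x₀
      exact ((hG.differentiable (by simp) _).hasFDerivAt).comp_hasDerivAt τ h1
    have hcont : Continuous fun τ : ℝ ↦ fderiv ℝ G (x₀ + τ • (x - x₀)) :=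
      hG'.continuous.comp (by fun_prop)
    have := intervalIntegral.integral_eq_sub_of_hasDerivAt (a := 0) (b := 1) (fun τ _ ↦ hd τ)
      ((hcont.clm_apply continuous_const).intervalIntegrable _ _)
    rw [ContinuousLinearMap.intervalIntegral_apply (hcont.intervalIntegrable _ _), this]
    simp

end Primitive


/-! ### The local flow of a smooth vector field -/

/-- A form of the implicit function theorem with a smooth solution on a whole neighbourhood and
uniqueness on a ball. -/
lemma exists_contDiffOn_implicit {P X : Type*} [NormedAddCommGroup P] [NormedSpace ℝ P]
    [CompleteSpace P] [NormedAddCommGroup X] [NormedSpace ℝ X] [CompleteSpace X]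
    {G : P × X → X} (hG : ContDiff ℝ ∞ G) {p₀ : P} {u₀ : X} (h0 : G (p₀, u₀) = 0) (A : P →L[ℝ] X)
    (hd : HasFDerivAt G (ContinuousLinearMap.snd ℝ P X + A.comp (ContinuousLinearMap.fst ℝ P X))
      (p₀, u₀)) :
    ∃ r > 0, ∃ T : Set P, IsOpen T ∧ p₀ ∈ T ∧ ∃ ψ : P → X, ContDiffOn ℝ ∞ ψ T ∧
      ∀ p ∈ T, ψ p ∈ Metric.ball u₀ r ∧ G (p, ψ p) = 0 ∧
        ∀ u ∈ Metric.ball u₀ r, G (p, u) = 0 → u = ψ p := by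
  -- The inverse function theorem is applied to `Φ`; the solution is the second component of the
  -- inverse at `(p, 0)`.
  set Φ : P × X → P × X := fun q ↦ (q.1, G q) with hΦdef
  have hΦ : ContDiff ℝ ∞ Φ := contDiff_fst.prodMk hG
  let Λ : (P × X) ≃L[ℝ] (P × X) :=
    (ContinuousLinearEquiv.refl ℝ P).skewProd (ContinuousLinearEquiv.refl ℝ X) A
  have hΛ : HasFDerivAt Φ (Λ : (P × X) →L[ℝ] (P × X)) (p₀, u₀) := by
    refine ((hasFDerivAt_fst (𝕜 := ℝ) (E := P) (F := X)).prodMk hd).congr_fderiv ?_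
    ext <;> simp [Λ]
  let e := hΦ.contDiffAt.toOpenPartialHomeomorph Φ hΛ (by simp)
  have he : ∀ q, e q = Φ q := fun q ↦ rfl
  have hsrc : (p₀, u₀) ∈ e.source := hΦ.contDiffAt.mem_toOpenPartialHomeomorph_source hΛ (by simp)
  have hΦ0 : Φ (p₀, u₀) = (p₀, 0) := by simp [hΦdef, h0]
  -- The derivative stays invertible near `(p₀, u₀)`, so the local inverse is smooth on a whole
  -- neighbourhood and not only at one point.
  have hinv : ∀ᶠ q in 𝓝 (p₀, u₀), q ∈ e.source ∧
      fderiv ℝ Φ q ∈ range ((↑) : ((P × X) ≃L[ℝ] (P × X)) → ((P × X) →L[ℝ] (P × X))) := by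
    refine Filter.Eventually.and (e.open_source.mem_nhds hsrc) ?_
    have hc : Continuous (fderiv ℝ Φ) := hΦ.continuous_fderiv (by simp)
    refine hc.continuousAt.eventually ?_
    rw [hΛ.fderiv]
    exact ContinuousLinearEquiv.nhds Λ
  obtain ⟨r, hr, hball⟩ := Metric.eventually_nhds_iff_ball.mp hinv
  have htgt : (p₀, (0 : X)) ∈ e.target := by
    rw [← hΦ0, ← he]; exact e.map_source hsrc
  have hsymm0 : e.symm (p₀, 0) = (p₀, u₀) := by
    rw [← hΦ0, ← he]; exact e.left_inv hsrc
  have hT : ∀ᶠ p in 𝓝 p₀, (p, (0 : X)) ∈ e.target ∧ e.symm (p, 0) ∈ Metric.ball (p₀, u₀) r ∧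
      p ∈ Metric.ball p₀ r := by
    have hc : ContinuousAt (fun p : P ↦ (p, (0 : X))) p₀ := by fun_prop
    refine (hc.eventually (e.open_target.mem_nhds htgt)).and
      (Filter.Eventually.and ?_ (Metric.ball_mem_nhds _ hr))
    have := ((e.continuousAt_symm htgt).comp (f := fun p : P ↦ (p, (0 : X))) hc)
    refine this.eventually ?_
    simp only [Function.comp_apply, hsymm0]
    exact Metric.ball_mem_nhds _ hr
  obtain ⟨T, hTs, hTo, hp₀⟩ := eventually_nhds_iff.mp hT
  have hfst (p : P) (hp : p ∈ T) : (e.symm (p, 0)).1 = p ∧ G (e.symm (p, 0)) = 0 := by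
    have := e.right_inv (hTs p hp).1
    rw [he] at this
    exact ⟨congrArg Prod.fst this, congrArg Prod.snd this⟩
  refine ⟨r, hr, T, hTo, hp₀, fun p ↦ (e.symm (p, 0)).2, fun p hp ↦ ?_, fun p hp ↦ ⟨?_, ?_, ?_⟩⟩
  · obtain ⟨Λ', hΛ'⟩ := (hball _ (hTs p hp).2.1).2
    have h1 : ContDiffAt ℝ ∞ e.symm (p, 0) := by
      refine e.contDiffAt_symm (hTs p hp).1 (f₀' := Λ') ?_ hΦ.contDiffAt
      rw [hΛ']
      exact (hΦ.differentiable (by simp) _).hasFDerivAt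
    exact (contDiffAt_snd.comp p (h1.comp p (contDiffAt_id.prodMk contDiffAt_const))).contDiffWithinAt
  · have := (hTs p hp).2.1
    rw [Metric.mem_ball, Prod.dist_eq] at this
    exact (le_max_right _ _).trans_lt this
  · have h := hfst p hp
    have : (p, (e.symm (p, 0)).2) = e.symm (p, 0) := Prod.ext h.1.symm rfl
    rw [this, h.2]
  · intro u hu h
    have hmem : (p, u) ∈ Metric.ball (p₀, u₀) r := by
      rw [Metric.mem_ball, Prod.dist_eq]
      exact max_lt (hTs p hp).2.2 hu
    have h1 := e.left_inv (hball _ hmem).1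
    rw [he] at h1
    simp only [hΦdef, h] at h1
    simp only [h1]

universe w

set_option synthInstance.maxHeartbeats 200000 in
/-- A smooth vector field on a Banach space has a local flow, smooth in all variables. -/
theorem exists_smooth_flow {V : Type w} [NormedAddCommGroup V] [NormedSpace ℝ V] [CompleteSpace V]
    {f : V → V} (hf : ContDiff ℝ ∞ f) (x₀ : V) :
    ∃ ε > 0, ∃ N : Set V, IsOpen N ∧ x₀ ∈ N ∧ ∃ φ : ℝ → V → V,
      ContDiffOn ℝ ∞ (fun q : ℝ × V ↦ φ q.1 q.2) (Ioo (-ε) ε ×ˢ N) ∧ (∀ x ∈ N, φ 0 x = x) ∧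
      ∀ x ∈ N, ∀ s ∈ Ioo (-ε) ε, HasDerivAt (fun s ↦ φ s x) (f (φ s x)) s := by
  -- With time rescaled to `[-1, 1]`, the integral curve `u t = φ (s t) x` is a zero of `G ((x, s),
  -- u) = u - x - s ∫₀ᵗ f ∘ u`. At `s = 0` the solution is constant and the partial derivative of
  -- `G` in `u` is the identity, so the implicit function theorem applies. The flow is the value of
  -- the solution at `t = 1`.
  let C : V →L[ℝ] C(Icc (-1 : ℝ) 1, V) := ContinuousLinearMap.const ℝ _
  let J := primitiveCLM V
  let Nf : C(Icc (-1 : ℝ) 1, V) → C(Icc (-1 : ℝ) 1, V) :=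
    fun u ↦ (ContinuousMap.mk f hf.continuous).comp u
  have hNf : ContDiff ℝ ∞ Nf := contDiff_continuousMap_comp hf
  have h1mem : (1 : ℝ) ∈ Icc (-1 : ℝ) 1 := by simp
  let G : (V × ℝ) × C(Icc (-1 : ℝ) 1, V) → C(Icc (-1 : ℝ) 1, V) :=
    fun q ↦ q.2 - C q.1.1 - q.1.2 • J (Nf q.2)
  have hJN : ContDiff ℝ ∞ (fun q : (V × ℝ) × C(Icc (-1 : ℝ) 1, V) ↦ J (Nf q.2)) :=
    J.contDiff.comp (hNf.comp contDiff_snd)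
  have hG : ContDiff ℝ ∞ G :=
    (contDiff_snd.sub (C.contDiff.comp (contDiff_fst.comp contDiff_fst))).sub
      ((contDiff_snd.comp contDiff_fst).smul hJN)
  have hGapp (x : V) (s : ℝ) (u : C(Icc (-1 : ℝ) 1, V)) (t : Icc (-1 : ℝ) 1) :
      G ((x, s), u) t = u t - x -
        s • ∫ τ in (0 : ℝ)..t, f (u (projIcc (-1) 1 (by norm_num) τ)) := rfl
  let A : (V × ℝ) →L[ℝ] C(Icc (-1 : ℝ) 1, V) :=
    -(C.comp (ContinuousLinearMap.fst ℝ V ℝ)) -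
      (ContinuousLinearMap.snd ℝ V ℝ).smulRight (J (Nf (C x₀)))
  have hd : HasFDerivAt G (ContinuousLinearMap.snd ℝ _ _ +
      A.comp (ContinuousLinearMap.fst ℝ _ _)) ((x₀, (0 : ℝ)), C x₀) := by
    have h2 := (hJN.differentiable (by simp) ((x₀, (0 : ℝ)), C x₀)).hasFDerivAt
    have h3 : HasFDerivAt (fun q : (V × ℝ) × C(Icc (-1 : ℝ) 1, V) ↦ q.1.2)
        ((ContinuousLinearMap.snd ℝ V ℝ).comp (ContinuousLinearMap.fst ℝ (V × ℝ) _))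
        ((x₀, (0 : ℝ)), C x₀) :=
      ((ContinuousLinearMap.snd ℝ V ℝ).comp (ContinuousLinearMap.fst ℝ (V × ℝ)
        C(Icc (-1 : ℝ) 1, V))).hasFDerivAt
    have h4 := h3.smul h2
    have h5 : HasFDerivAt (fun q : (V × ℝ) × C(Icc (-1 : ℝ) 1, V) ↦ q.2 - C q.1.1)
        (ContinuousLinearMap.snd ℝ _ _ - (C.comp (ContinuousLinearMap.fst ℝ V ℝ)).comp
          (ContinuousLinearMap.fst ℝ (V × ℝ) _)) ((x₀, (0 : ℝ)), C x₀) :=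
      (ContinuousLinearMap.snd ℝ _ _ - (C.comp (ContinuousLinearMap.fst ℝ V ℝ)).comp
          (ContinuousLinearMap.fst ℝ (V × ℝ) C(Icc (-1 : ℝ) 1, V))).hasFDerivAt
    refine (h5.sub h4).congr_fderiv ?_
    refine ContinuousLinearMap.ext fun q ↦ ?_
    simp [A]
    abel
  have hG0 : G ((x₀, (0 : ℝ)), C x₀) = 0 := by simp [G]
  obtain ⟨r, hr, T, hTo, hT0, ψ, hψ, hsol⟩ := exists_contDiffOn_implicit hG hG0 A hd
  obtain ⟨δ, hδ, hδT⟩ := Metric.isOpen_iff.mp hTo _ hT0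
  have hT' {x : V} {s : ℝ} (hx : x ∈ Metric.ball x₀ δ) (hs : s ∈ Ioo (-δ) δ) : (x, s) ∈ T := by
    refine hδT ?_
    rw [Metric.mem_ball, Prod.dist_eq]
    refine max_lt hx ?_
    simpa [abs_lt] using hs
  let φ : ℝ → V → V := fun s x ↦ ψ (x, s) ⟨1, h1mem⟩
  have hcont (u : C(Icc (-1 : ℝ) 1, V)) :
      Continuous fun τ : ℝ ↦ f (u (projIcc (-1) 1 (by norm_num) τ)) :=
    hf.continuous.comp (u.continuous.comp continuous_projIcc)
  have hint {x : V} {s : ℝ} (hx : x ∈ Metric.ball x₀ δ) (hs : s ∈ Ioo (-δ) δ)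
      (t : Icc (-1 : ℝ) 1) : ψ (x, s) t = x + s • ∫ τ in (0 : ℝ)..t,
        f (ψ (x, s) (projIcc (-1) 1 (by norm_num) τ)) := by
    have h := congrArg (fun u : C(Icc (-1 : ℝ) 1, V) ↦ u t) (hsol _ (hT' hx hs)).2.1
    simp only [hGapp] at h
    rw [ContinuousMap.zero_apply, sub_sub, sub_eq_zero] at h
    exact h
  -- The curve `τ ↦ ψ (x, s) (t τ)` solves the equation with parameter `s t` and stays in the ball
  -- of uniqueness, so it is `ψ (x, s t)`.
  have hrep {x : V} {s : ℝ} (hx : x ∈ Metric.ball x₀ δ) (hs : s ∈ Ioo (-δ) δ)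
      (t : Icc (-1 : ℝ) 1) : φ (s * t) x = ψ (x, s) t := by
    have hst : s * t ∈ Ioo (-δ) δ := by
      rw [mem_Ioo, ← abs_lt] at hs ⊢
      rw [abs_mul]
      exact (mul_le_of_le_one_right (abs_nonneg _) (abs_le.mpr t.2)).trans_lt hs
    have hmul (τ : Icc (-1 : ℝ) 1) : (t : ℝ) * τ ∈ Icc (-1 : ℝ) 1 := by
      rw [mem_Icc, ← abs_le, abs_mul]
      exact mul_le_one₀ (abs_le.mpr t.2) (abs_nonneg _) (abs_le.mpr τ.2)
    let v : C(Icc (-1 : ℝ) 1, V) := ⟨fun τ ↦ ψ (x, s) ⟨t * τ, hmul τ⟩, by fun_prop⟩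
    have hv : v ∈ Metric.ball (C x₀) r := by
      have := (hsol _ (hT' hx hs)).1
      rw [Metric.mem_ball, dist_eq_norm] at this ⊢
      refine lt_of_le_of_lt ((ContinuousMap.norm_le _ (norm_nonneg _)).mpr fun τ ↦ ?_) this
      exact (ψ (x, s) - C x₀).norm_coe_le_norm ⟨t * τ, hmul τ⟩
    have hv0 : G ((x, s * t), v) = 0 := by
      ext τ
      rw [hGapp, ContinuousMap.zero_apply, sub_sub, sub_eq_zero]
      change ψ (x, s) ⟨t * τ, hmul τ⟩ = _
      rw [hint hx hs, mul_smul]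
      congr 2
      have h1 : ∫ σ in (0 : ℝ)..τ, f (v (projIcc (-1) 1 (by norm_num) σ)) =
          ∫ σ in (0 : ℝ)..τ, f (ψ (x, s) (projIcc (-1) 1 (by norm_num) (t * σ))) := by
        refine intervalIntegral.integral_congr fun σ hσ ↦ ?_
        have hσ' : σ ∈ Icc (-1 : ℝ) 1 :=
          (uIcc_subset_Icc (by simp : (0 : ℝ) ∈ Icc (-1 : ℝ) 1) τ.2) hσ

        rw [projIcc_of_mem _ hσ', projIcc_of_mem _ (hmul ⟨σ, hσ'⟩)]
        rfl
      rw [h1, intervalIntegral.smul_integral_comp_mul_left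
        (fun σ ↦ f (ψ (x, s) (projIcc (-1) 1 (by norm_num) σ))), mul_zero]
    have := (hsol _ (hT' hx hst)).2.2 v hv hv0
    simp only [φ, ← this]
    change ψ (x, s) ⟨t * 1, _⟩ = _
    congr 1
    exact Subtype.ext (mul_one _)
  refine ⟨δ, hδ, Metric.ball x₀ δ, Metric.isOpen_ball, Metric.mem_ball_self hδ, φ, ?_, ?_, ?_⟩
  · have h1 : ContDiffOn ℝ ∞ (fun q : ℝ × V ↦ ψ (q.2, q.1)) (Ioo (-δ) δ ×ˢ Metric.ball x₀ δ) :=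
      hψ.comp (contDiff_snd.prodMk contDiff_fst).contDiffOn fun q hq ↦ hT' hq.2 hq.1
    exact (ContinuousMap.evalCLM ℝ (⟨1, h1mem⟩ : Icc (-1 : ℝ) 1)).contDiff.comp_contDiffOn h1
  · intro x hx
    have h0 : (0 : ℝ) ∈ Ioo (-δ) δ := by simp [hδ]
    simp only [φ]
    rw [hint hx h0, zero_smul, add_zero]
  · intro x hx s hs
    -- A single solution with parameter `s₁ > |s|` describes `φ σ x` for all `σ` near `s`, of either
    -- sign, as an integral with endpoint `σ / s₁`; it remains to differentiate in the endpoint.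
    obtain ⟨s₁, hs₁, hs₁δ⟩ := exists_between (abs_lt.mpr hs)
    have hs₁0 : 0 < s₁ := (abs_nonneg s).trans_lt hs₁
    have hs₁m : s₁ ∈ Ioo (-δ) δ := ⟨by linarith, hs₁δ⟩
    have hmem {σ : ℝ} (hσ : |σ| < s₁) : σ / s₁ ∈ Icc (-1 : ℝ) 1 := by
      rw [mem_Icc, ← abs_le, abs_div, abs_of_pos hs₁0]
      exact (div_le_one hs₁0).mpr hσ.le
    have hφ {σ : ℝ} (hσ : |σ| < s₁) : φ σ x = ψ (x, s₁) ⟨σ / s₁, hmem hσ⟩ := by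
      rw [← hrep hx hs₁m]
      simp only
      rw [mul_div_cancel₀ _ hs₁0.ne']
    have heq : (fun σ ↦ φ σ x) =ᶠ[𝓝 s] fun σ ↦ x + s₁ • ∫ τ in (0 : ℝ)..(σ / s₁),
        f (ψ (x, s₁) (projIcc (-1) 1 (by norm_num) τ)) := by
      filter_upwards [(continuous_abs.isOpen_preimage _ isOpen_Iio).mem_nhds hs₁] with σ hσ
      rw [hφ hσ, hint hx hs₁m]
    refine HasDerivAt.congr_of_eventuallyEq ?_ heq
    have h1 := ((hcont (ψ (x, s₁))).integral_hasStrictDerivAt 0 (s / s₁)).hasDerivAt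
    have h2 := h1.scomp s ((hasDerivAt_id s).div_const s₁)
    have h3 := (h2.const_smul s₁).const_add x
    refine h3.congr_deriv ?_
    rw [hφ hs₁, smul_smul, projIcc_of_mem _ (hmem hs₁)]
    simp [hs₁0.ne']


/-! ### Mixed derivatives and uniqueness of integral curves -/

/-- Symmetry of second derivatives, iterated: the induction hypothesis is applied to the partial
derivative of `H` in `t`. It serves to exchange the time `s` of a flow with the parameter `t` of a
curve. -/
lemma hasDerivAt_iteratedDeriv_swap {W : Type*} [NormedAddCommGroup W] [NormedSpace ℝ W] (r : ℕ) :
    ∀ {H : ℝ × ℝ → W}, (∀ᶠ q in 𝓝 ((0 : ℝ), (0 : ℝ)), ContDiffAt ℝ ∞ H q) →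
    HasDerivAt (fun s ↦ iteratedDeriv r (fun t ↦ H (s, t)) 0)
      (iteratedDeriv r (fun t ↦ deriv (fun s ↦ H (s, t)) 0) 0) 0 := by
  have hfst (H : ℝ × ℝ → W) (q : ℝ × ℝ) (h : DifferentiableAt ℝ H q) :
      HasDerivAt (fun s ↦ H (s, q.2)) (fderiv ℝ H q (1, 0)) q.1 := by
    have h1 : HasDerivAt (fun s : ℝ ↦ (s, q.2)) ((1 : ℝ), (0 : ℝ)) q.1 :=
      (hasDerivAt_id _).prodMk (hasDerivAt_const _ _)
    exact h.hasFDerivAt.comp_hasDerivAt q.1 h1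
  have hsnd (H : ℝ × ℝ → W) (q : ℝ × ℝ) (h : DifferentiableAt ℝ H q) :
      HasDerivAt (fun t ↦ H (q.1, t)) (fderiv ℝ H q (0, 1)) q.2 := by
    have h1 : HasDerivAt (fun t : ℝ ↦ (q.1, t)) ((0 : ℝ), (1 : ℝ)) q.2 :=
      (hasDerivAt_const _ _).prodMk (hasDerivAt_id _)
    exact h.hasFDerivAt.comp_hasDerivAt q.2 h1
  have hcs : Continuous fun s : ℝ ↦ (s, (0 : ℝ)) := by fun_prop
  have hct : Continuous fun t : ℝ ↦ ((0 : ℝ), t) := by fun_prop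
  induction r with
  | zero =>
    intro H hH
    simp only [iteratedDeriv_zero]
    exact (hfst H (0, 0) (hH.self_of_nhds.differentiableAt (by simp))).differentiableAt.hasDerivAt
  | succ r ih =>
    intro H hH
    have hH2 : ∀ᶠ q in 𝓝 ((0 : ℝ), (0 : ℝ)), ContDiffAt ℝ ∞ (fun q ↦ fderiv ℝ H q (0, 1)) q := by
      filter_upwards [hH] with q hq
      exact (hq.fderiv_right (by simp)).clm_apply contDiffAt_const
    have hd := ih hH2
    have h1 : (fun s ↦ iteratedDeriv (r + 1) (fun t ↦ H (s, t)) 0) =ᶠ[𝓝 0]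
        fun s ↦ iteratedDeriv r (fun t ↦ fderiv ℝ H (s, t) (0, 1)) 0 := by
      filter_upwards [(hcs.tendsto' 0 (0, 0) rfl).eventually hH.eventually_nhds] with s hs
      rw [iteratedDeriv_succ']
      refine Filter.EventuallyEq.iteratedDeriv_eq r ?_
      have hc : Continuous fun t : ℝ ↦ (s, t) := by fun_prop
      filter_upwards [(hc.tendsto' 0 (s, 0) rfl).eventually hs] with t ht
      exact (hsnd H (s, t) (ht.differentiableAt (by simp))).deriv
    have h2 : iteratedDeriv (r + 1) (fun t ↦ deriv (fun s ↦ H (s, t)) 0) 0 =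
        iteratedDeriv r (fun t ↦ deriv (fun s ↦ fderiv ℝ H (s, t) (0, 1)) 0) 0 := by
      rw [iteratedDeriv_succ']
      refine Filter.EventuallyEq.iteratedDeriv_eq r ?_
      filter_upwards [((hct.tendsto' 0 (0, 0) rfl).eventually hH).eventually_nhds] with t ht
      have hd' : DifferentiableAt ℝ (fderiv ℝ H) (0, t) :=
        (ht.self_of_nhds.fderiv_right (m := ∞) (by simp)).differentiableAt (by simp)
      have e1 : (fun t ↦ deriv (fun s ↦ H (s, t)) 0) =ᶠ[𝓝 t] fun t ↦ fderiv ℝ H (0, t) (1, 0) := by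
        filter_upwards [ht] with t' ht'
        exact (hfst H (0, t') (ht'.differentiableAt (by simp))).deriv
      have hap (v : ℝ × ℝ) (w : ℝ × ℝ) : fderiv ℝ (fun q ↦ fderiv ℝ H q v) (0, t) w =
          fderiv ℝ (fderiv ℝ H) (0, t) w v := by
        rw [fderiv_clm_apply hd' (differentiableAt_const v)]
        simp
      have hdv (v : ℝ × ℝ) : DifferentiableAt ℝ (fun q ↦ fderiv ℝ H q v) (0, t) :=
        hd'.clm_apply (differentiableAt_const v)
      rw [e1.deriv_eq, (hsnd _ (0, t) (hdv (1, 0))).deriv, hap,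
        (hfst _ (0, t) (hdv (0, 1))).deriv, hap]
      exact (ht.self_of_nhds.isSymmSndFDerivAt
        (by rw [minSmoothness_of_isRCLikeNormedField]; exact ENat.LEInfty.out)).eq _ _
    rw [h2]
    exact hd.congr_of_eventuallyEq h1

/-- Integral curves of a smooth vector field on an interval are determined by one value. -/
lemma integralCurve_eqOn {V : Type*} [NormedAddCommGroup V] [NormedSpace ℝ V]
    {f : V → V} (hf : ContDiff ℝ ∞ f) {a b t₀ : ℝ} (ht₀ : t₀ ∈ Ioo a b) {γ γ' : ℝ → V}
    (h : ∀ t ∈ Ioo a b, HasDerivAt γ (f (γ t)) t) (h' : ∀ t ∈ Ioo a b, HasDerivAt γ' (f (γ' t)) t)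
    (h0 : γ t₀ = γ' t₀) : EqOn γ γ' (Ioo a b) := by
  have hcl : IsPreconnected (Ioo a b) := isPreconnected_Ioo
  have hγ : ContinuousOn γ (Ioo a b) := fun t ht ↦ (h t ht).continuousAt.continuousWithinAt
  have hγ' : ContinuousOn γ' (Ioo a b) := fun t ht ↦ (h' t ht).continuousAt.continuousWithinAt
  -- Agreement at a point propagates to a neighbourhood. The points near which the curves agree thus
  -- form an open set, also relatively closed in the connected interval.
  have hloc : ∀ t ∈ Ioo a b, γ t = γ' t → γ =ᶠ[𝓝 t] γ' := by
    intro t ht heq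
    obtain ⟨K, s, hs, hK⟩ := (hf.contDiffAt (x := γ t)).of_le (show (1 : WithTop ℕ∞) ≤ ∞ by simp)
      |>.exists_lipschitzOnWith
    refine ODE_solution_unique_of_eventually (v := fun _ ↦ f) (s := fun _ ↦ s) (K := K)
      (Eventually.of_forall fun _ ↦ hK) ?_ ?_ heq
    · filter_upwards [isOpen_Ioo.mem_nhds ht, (h t ht).continuousAt.preimage_mem_nhds hs] with τ h1 h2
      exact ⟨h τ h1, h2⟩
    · rw [heq] at hs
      filter_upwards [isOpen_Ioo.mem_nhds ht, (h' t ht).continuousAt.preimage_mem_nhds hs]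
        with τ h1 h2
      exact ⟨h' τ h1, h2⟩
  intro t ht
  have hsub := hcl.subset_of_closure_inter_subset (u := {t | γ =ᶠ[𝓝 t] γ'})
    (isOpen_setOfPred_eventually_nhds) ⟨t₀, ht₀, hloc t₀ ht₀ h0⟩ (by
      rintro τ ⟨hτc, hτ⟩
      refine hloc τ hτ ?_
      obtain hfr := mem_closure_iff_frequently.mp hτc
      have hne : ∃ᶠ σ in 𝓝 τ, γ σ = γ' σ := hfr.mono fun σ hσ ↦ hσ.self_of_nhds
      exact tendsto_nhds_unique_of_frequently_eq (h τ hτ).continuousAt.tendsto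
        (h' τ hτ).continuousAt.tendsto hne)
  exact (hsub ht).self_of_nhds


/-! ### Flows of linear extensions of vector fields -/

/-- The variational equation: the case `r = 1` of `hasDerivAt_iteratedDeriv_swap` for the map `(σ,
t) ↦ φ (s + σ) (x + t w)`. -/
lemma hasDerivAt_fderiv_flow {V : Type*} [NormedAddCommGroup V] [NormedSpace ℝ V] {f : V → V}
    (hf : ContDiff ℝ ∞ f) {ε : ℝ} {N : Set V} (hN : IsOpen N) {φ : ℝ → V → V}
    (hφ : ContDiffOn ℝ ∞ (fun q : ℝ × V ↦ φ q.1 q.2) (Ioo (-ε) ε ×ˢ N))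
    (hd : ∀ x ∈ N, ∀ s ∈ Ioo (-ε) ε, HasDerivAt (fun s ↦ φ s x) (f (φ s x)) s) {x : V}
    (hx : x ∈ N) (w : V) {s : ℝ} (hs : s ∈ Ioo (-ε) ε) :
    HasDerivAt (fun s ↦ fderiv ℝ (φ s) x w) (fderiv ℝ f (φ s x) (fderiv ℝ (φ s) x w)) s := by
  have hφat {σ : ℝ} (hσ : σ ∈ Ioo (-ε) ε) {y : V} (hy : y ∈ N) :
      ContDiffAt ℝ ∞ (fun q : ℝ × V ↦ φ q.1 q.2) (σ, y) :=
    hφ.contDiffAt ((isOpen_Ioo.prod hN).mem_nhds ⟨hσ, hy⟩)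
  have hφx {σ : ℝ} (hσ : σ ∈ Ioo (-ε) ε) : HasFDerivAt (φ σ) (fderiv ℝ (φ σ) x) x :=
    (((hφat hσ hx).comp x (f := fun y ↦ (σ, y)) (by fun_prop)).differentiableAt (by simp)).hasFDerivAt
  have hline : HasDerivAt (fun t : ℝ ↦ x + t • w) w 0 := by
    simpa using ((hasDerivAt_id (0 : ℝ)).smul_const w).const_add x
  have hcomp {σ : ℝ} (hσ : σ ∈ Ioo (-ε) ε) :
      HasDerivAt (fun t : ℝ ↦ φ σ (x + t • w)) (fderiv ℝ (φ σ) x w) 0 := by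
    refine HasFDerivAt.comp_hasDerivAt (l := φ σ) (f := fun t : ℝ ↦ x + t • w) (0 : ℝ) ?_ hline
    simpa using hφx hσ
  have hev1 : ∀ᶠ q in 𝓝 ((0, 0) : ℝ × ℝ), s + q.1 ∈ Ioo (-ε) ε ∧ x + q.2 • w ∈ N := by
    have h1 : ContinuousAt (fun q : ℝ × ℝ ↦ (s + q.1, x + q.2 • w)) (0, 0) := by fun_prop
    exact h1.preimage_mem_nhds ((isOpen_Ioo.prod hN).mem_nhds (by simpa using ⟨hs, hx⟩))
  have hG : ∀ᶠ q in 𝓝 ((0, 0) : ℝ × ℝ),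
      ContDiffAt ℝ ∞ (fun q : ℝ × ℝ ↦ φ (s + q.1) (x + q.2 • w)) q := by
    filter_upwards [hev1] with q hq
    exact (hφat hq.1 hq.2).comp q (f := fun q : ℝ × ℝ ↦ (s + q.1, x + q.2 • w)) (by fun_prop)
  have key := hasDerivAt_iteratedDeriv_swap 1 hG
  simp only [iteratedDeriv_one] at key
  have hev2 : ∀ᶠ t in 𝓝 (0 : ℝ), x + t • w ∈ N :=
    hline.continuousAt.preimage_mem_nhds (hN.mem_nhds (by simpa using hx))
  have h2 : (fun t : ℝ ↦ deriv (fun σ ↦ φ (s + σ) (x + t • w)) 0) =ᶠ[𝓝 0]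
      fun t ↦ f (φ s (x + t • w)) := by
    filter_upwards [hev2] with t ht
    have h3 := hd _ ht s hs
    have h4 : HasDerivAt (fun σ ↦ φ (s + σ) (x + t • w)) (f (φ s (x + t • w))) 0 :=
      HasDerivAt.comp_const_add (f := fun σ ↦ φ σ (x + t • w)) s 0 (by simpa using h3)
    exact h4.deriv
  have h5 : HasDerivAt (fun t : ℝ ↦ f (φ s (x + t • w)))
      (fderiv ℝ f (φ s x) (fderiv ℝ (φ s) x w)) 0 := by
    refine HasFDerivAt.comp_hasDerivAt (l := f) (f := fun t : ℝ ↦ φ s (x + t • w)) (0 : ℝ) ?_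
      (hcomp hs)
    simpa using (hf.differentiable (by simp) (φ s x)).hasFDerivAt
  rw [h2.deriv_eq, h5.deriv] at key
  have key2 := HasDerivAt.comp_sub_const (x := s) (a := s)
    (f := fun σ ↦ deriv (fun t : ℝ ↦ φ (s + σ) (x + t • w)) 0) (by simpa using key)
  refine key2.congr_of_eventuallyEq ?_
  filter_upwards [isOpen_Ioo.mem_nhds hs] with σ hσ
  simp only [add_sub_cancel]
  exact (hcomp hσ).deriv.symm

/-- The flow of a vector field together with the solution of a linear equation along it. -/
lemma exists_linear_flow {V F : Type*} [NormedAddCommGroup V] [NormedSpace ℝ V] [CompleteSpace V]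
    [NormedAddCommGroup F] [NormedSpace ℝ F] [CompleteSpace F] {r : V → V} (hr : ContDiff ℝ ∞ r)
    {D : V → F →L[ℝ] F} (hD : ContDiff ℝ ∞ D) {z₀ : V} {O : Set V} (hO : O ∈ 𝓝 z₀) :
    ∃ ε > 0, ∃ N, IsOpen N ∧ z₀ ∈ N ∧ ∃ (ξ : ℝ → V → V) (Ψ : ℝ → V → F →L[ℝ] F),
      ContDiffOn ℝ ∞ (fun q : ℝ × V ↦ ξ q.1 q.2) (Ioo (-ε) ε ×ˢ N) ∧
      ContDiffOn ℝ ∞ (fun q : ℝ × V ↦ Ψ q.1 q.2) (Ioo (-ε) ε ×ˢ N) ∧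
      (∀ x ∈ N, ξ 0 x = x ∧ Ψ 0 x = ContinuousLinearMap.id ℝ F) ∧
      (∀ s ∈ Ioo (-ε) ε, ∀ x ∈ N, ξ s x ∈ O) ∧
      (∀ s ∈ Ioo (-ε) ε, ∀ x ∈ N, HasDerivAt (fun s ↦ ξ s x) (r (ξ s x)) s ∧
        HasDerivAt (fun s ↦ Ψ s x) (D (ξ s x) ∘L Ψ s x) s) ∧
      (∀ s ∈ Ioo (-ε) ε, ∀ s' ∈ Ioo (-ε) ε, s + s' ∈ Ioo (-ε) ε → ∀ x ∈ N, ξ s' x ∈ N →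
        ξ (s + s') x = ξ s (ξ s' x) ∧ Ψ (s + s') x = Ψ s (ξ s' x) ∘L Ψ s' x) ∧
      ∀ R : V × F → V, ContDiff ℝ ∞ R →
        (∀ z ∈ O, ∀ c, fderiv ℝ R (z, c) (r z, D z c) = fderiv ℝ r z (R (z, c))) →
        ∀ s ∈ Ioo (-ε) ε, ∀ x ∈ N, ∀ c, fderiv ℝ (ξ s) x (R (x, c)) = R (ξ s x, Ψ s x c) := by
  -- The base equation and the linear equation form one autonomous field; `ξ` and `Ψ` are the
  -- components of its flow started at `(x, id)`.
  let f : V × (F →L[ℝ] F) → V × (F →L[ℝ] F) := fun q ↦ (r q.1, D q.1 ∘L q.2)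
  have hf : ContDiff ℝ ∞ f := (hr.comp contDiff_fst).prodMk
    ((hD.comp contDiff_fst).clm_comp contDiff_snd)
  obtain ⟨ε₀, hε₀, N₀, hN₀, hzN₀, φ, hφs, hφ0, hφ⟩ :=
    exists_smooth_flow hf (z₀, ContinuousLinearMap.id ℝ F)
  have hI₀ : (0 : ℝ) ∈ Ioo (-ε₀) ε₀ := by simp [hε₀]
  have hemb : Continuous fun x : V ↦ (x, ContinuousLinearMap.id ℝ F) := by fun_prop
  have hQ : ContDiffAt ℝ ∞ (fun q : ℝ × V ↦ φ q.1 (q.2, ContinuousLinearMap.id ℝ F)) (0, z₀) :=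
    (hφs.contDiffAt ((isOpen_Ioo.prod hN₀).mem_nhds ⟨hI₀, hzN₀⟩)).comp (0, z₀)
      (f := fun q : ℝ × V ↦ (q.1, (q.2, ContinuousLinearMap.id ℝ F))) (by fun_prop)
  have hev : ∀ᶠ q : ℝ × V in 𝓝 (0, z₀), q.1 ∈ Ioo (-ε₀) ε₀ ∧
      (q.2, ContinuousLinearMap.id ℝ F) ∈ N₀ ∧ (φ q.1 (q.2, ContinuousLinearMap.id ℝ F)).1 ∈ O := by
    have h1 : ∀ᶠ q : ℝ × V in 𝓝 (0, z₀), q.1 ∈ Ioo (-ε₀) ε₀ :=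
      continuousAt_fst.preimage_mem_nhds (isOpen_Ioo.mem_nhds hI₀)
    have h2 : ∀ᶠ q : ℝ × V in 𝓝 (0, z₀), (q.2, ContinuousLinearMap.id ℝ F) ∈ N₀ :=
      (hemb.comp continuous_snd).continuousAt.preimage_mem_nhds (hN₀.mem_nhds hzN₀)
    have h3 : ∀ᶠ q : ℝ × V in 𝓝 (0, z₀), (φ q.1 (q.2, ContinuousLinearMap.id ℝ F)).1 ∈ O :=
      hQ.continuousAt.fst.preimage_mem_nhds (by simpa [hφ0 _ hzN₀] using hO)
    exact h1.and (h2.and h3)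
  obtain ⟨ε, hε, hball⟩ := Metric.mem_nhds_iff.mp hev
  have hmem {s : ℝ} (hs : s ∈ Ioo (-ε) ε) {x : V} (hx : x ∈ Metric.ball z₀ ε) :
      s ∈ Ioo (-ε₀) ε₀ ∧ (x, ContinuousLinearMap.id ℝ F) ∈ N₀ ∧
        (φ s (x, ContinuousLinearMap.id ℝ F)).1 ∈ O := by
    refine hball (a := (s, x)) ?_
    rw [← ball_prod_same]
    refine ⟨?_, hx⟩
    rw [Real.ball_eq_Ioo]
    simpa using hs
  have h0 : (0 : ℝ) ∈ Ioo (-ε) ε := by simp [hε]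
  have hsm : ContDiffOn ℝ ∞ (fun q : ℝ × V ↦ φ q.1 (q.2, ContinuousLinearMap.id ℝ F))
      (Ioo (-ε) ε ×ˢ Metric.ball z₀ ε) :=
    hφs.comp (f := fun q : ℝ × V ↦ (q.1, (q.2, ContinuousLinearMap.id ℝ F)))
      (ContDiff.contDiffOn (by fun_prop)) fun q hq ↦ ⟨(hmem hq.1 hq.2).1, (hmem hq.1 hq.2).2.1⟩
  have hder {s : ℝ} (hs : s ∈ Ioo (-ε) ε) {x : V} (hx : x ∈ Metric.ball z₀ ε) :
      HasDerivAt (fun s ↦ (φ s (x, ContinuousLinearMap.id ℝ F)).1)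
        (r (φ s (x, ContinuousLinearMap.id ℝ F)).1) s ∧
      HasDerivAt (fun s ↦ (φ s (x, ContinuousLinearMap.id ℝ F)).2)
        (D (φ s (x, ContinuousLinearMap.id ℝ F)).1 ∘L (φ s (x, ContinuousLinearMap.id ℝ F)).2) s :=
    ⟨(hφ _ (hmem hs hx).2.1 s (hmem hs hx).1).fst, (hφ _ (hmem hs hx).2.1 s (hmem hs hx).1).snd⟩
  refine ⟨ε, hε, Metric.ball z₀ ε, Metric.isOpen_ball, Metric.mem_ball_self hε,
    fun s x ↦ (φ s (x, ContinuousLinearMap.id ℝ F)).1,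
    fun s x ↦ (φ s (x, ContinuousLinearMap.id ℝ F)).2, hsm.fst, hsm.snd, fun x hx ↦ ?_,
    fun s hs x hx ↦ (hmem hs hx).2.2, fun s hs x hx ↦ hder hs hx, ?_, ?_⟩
  · beta_reduce
    rw [hφ0 _ (hmem h0 hx).2.1]; exact ⟨rfl, rfl⟩
  · intro s hs s' hs' hss x hx hx'
    beta_reduce at hx' ⊢
    set x' := (φ s' (x, ContinuousLinearMap.id ℝ F)).1 with hx'def
    -- Both are integral curves of `f` with the same value at `σ = 0`; the linear equation is
    -- preserved by composition on the right with a constant operator. The interval is the one on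
    -- which `σ` and `σ + s'` both lie in `(-ε, ε)`.
    have key : EqOn (fun σ ↦ φ (σ + s') (x, ContinuousLinearMap.id ℝ F))
        (fun σ ↦ ((φ σ (x', ContinuousLinearMap.id ℝ F)).1,
          (φ σ (x', ContinuousLinearMap.id ℝ F)).2 ∘L (φ s' (x, ContinuousLinearMap.id ℝ F)).2))
        (Ioo (max (-ε) (-ε - s')) (min ε (ε - s'))) := by
      refine integralCurve_eqOn hf (t₀ := 0) ?_ (fun σ hσ ↦ ?_) (fun σ hσ ↦ ?_) ?_
      · simp only [mem_Ioo, max_lt_iff, lt_min_iff]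
        exact ⟨⟨by linarith, by linarith [hs'.1]⟩, hε, by linarith [hs'.2]⟩
      · simp only [mem_Ioo, max_lt_iff, lt_min_iff] at hσ
        have hσ' : σ + s' ∈ Ioo (-ε) ε := ⟨by linarith, by linarith⟩
        exact HasDerivAt.comp_add_const (f := fun σ ↦ φ σ (x, ContinuousLinearMap.id ℝ F)) σ s'
          (hφ _ (hmem hσ' hx).2.1 _ (hmem hσ' hx).1)
      · simp only [mem_Ioo, max_lt_iff, lt_min_iff] at hσ
        have hσ' : σ ∈ Ioo (-ε) ε := ⟨by linarith, by linarith⟩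
        have h1 := hder hσ' hx'
        refine h1.1.prodMk ?_
        exact h1.2.clm_comp (hasDerivAt_const σ _) |>.congr_deriv (by
          rw [ContinuousLinearMap.comp_zero, add_zero]; rfl)
      · simp only [zero_add]
        rw [hφ0 _ (hmem h0 hx').2.1]
        exact Prod.ext rfl (ContinuousLinearMap.id_comp _).symm
    have hs'' : s ∈ Ioo (max (-ε) (-ε - s')) (min ε (ε - s')) := by
      simp only [mem_Ioo, max_lt_iff, lt_min_iff]
      exact ⟨⟨hs.1, by linarith [hss.1]⟩, hs.2, by linarith [hss.2]⟩
    exact ⟨(Prod.ext_iff.mp (key hs'')).1, (Prod.ext_iff.mp (key hs'')).2⟩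
  · intro R hR hRr s hs x hx c
    -- Paired with `ξ s x`, both sides are integral curves of the tangent lift `(z, v) ↦ (r z,
    -- fderiv ℝ r z v)`: the left one by the variational equation, the right one by the
    -- infinitesimal hypothesis on `R`.
    have hg : ContDiff ℝ ∞ (fun q : V × V ↦ (r q.1, fderiv ℝ r q.1 q.2)) :=
      (hr.comp contDiff_fst).prodMk
        (((hr.fderiv_right (m := ∞) (by simp)).comp contDiff_fst).clm_apply contDiff_snd)
    have key := integralCurve_eqOn hg (t₀ := 0) (a := -ε) (b := ε)
      (γ := fun s ↦ ((φ s (x, ContinuousLinearMap.id ℝ F)).1,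
        fderiv ℝ (fun x ↦ (φ s (x, ContinuousLinearMap.id ℝ F)).1) x (R (x, c))))
      (γ' := fun s ↦ ((φ s (x, ContinuousLinearMap.id ℝ F)).1,
        R ((φ s (x, ContinuousLinearMap.id ℝ F)).1, (φ s (x, ContinuousLinearMap.id ℝ F)).2 c)))
      h0 (fun σ hσ ↦ ?_) (fun σ hσ ↦ ?_) ?_
    · exact congrArg Prod.snd (key hs)
    · exact (hder hσ hx).1.prodMk (hasDerivAt_fderiv_flow hr Metric.isOpen_ball hsm.fst
        (fun y hy τ hτ ↦ (hder hτ hy).1) hx _ hσ)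
    · have h1 := hder hσ hx
      refine h1.1.prodMk ?_
      have h2 := (hR.differentiable (by simp) ((φ σ (x, ContinuousLinearMap.id ℝ F)).1,
        (φ σ (x, ContinuousLinearMap.id ℝ F)).2 c)).hasFDerivAt.comp_hasDerivAt σ
        (h1.1.prodMk (h1.2.clm_apply (hasDerivAt_const σ c)))
      refine h2.congr_deriv ?_
      rw [← hRr _ (hmem hσ hx).2.2]
      simp
    · have h1 : (fun y ↦ (φ 0 (y, ContinuousLinearMap.id ℝ F)).1) =ᶠ[𝓝 x] id := by
        filter_upwards [Metric.isOpen_ball.mem_nhds hx] with y hy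
        rw [hφ0 _ (hmem h0 hy).2.1]; rfl
      rw [h1.fderiv_eq, hφ0 _ (hmem h0 hx).2.1, fderiv_id]
      rfl


set_option linter.unusedSectionVars false

noncomputable section

namespace LieAlgebroid

variable {B : Type*} [NormedAddCommGroup B] [NormedSpace ℝ B] [FiniteDimensional ℝ B]
  {M : Type*} [TopologicalSpace M] [ChartedSpace B M] [IsManifold 𝓘(ℝ, B) ∞ M]
  [T2Space M] [SigmaCompactSpace M]
  {F : Type*} [NormedAddCommGroup F] [NormedSpace ℝ F] [FiniteDimensional ℝ F]
  {E : M → Type*} [∀ x, AddCommGroup (E x)] [∀ x, Module ℝ (E x)]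
  [∀ x, TopologicalSpace (E x)] [TopologicalSpace (TotalSpace F E)]
  [FiberBundle F E] [VectorBundle ℝ F E] [ContMDiffVectorBundle ∞ F E 𝓘(ℝ, B)]
  {L : LieAlgebroid B F E} {k : ℕ}

/-! ### Charts of the total space -/

variable (B F E) in
/-- The coordinates of a point of `E` in a preferred chart and a preferred trivialization. -/
def chartCoord (x₀ : M) (e : TotalSpace F E) : B × F :=
  (extChartAt 𝓘(ℝ, B) x₀ e.proj, (trivializationAt F E x₀ e).2)

variable (B F E) in
/-- The inverse of `chartCoord`. -/
def chartSymm (x₀ : M) (z : B × F) : TotalSpace F E :=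
  (trivializationAt F E x₀).toPartialEquiv.symm ((extChartAt 𝓘(ℝ, B) x₀).symm z.1, z.2)

variable (B F E) in
/-- The image of the chart domain in the model space. -/
def chartImage (x₀ : M) : Set B := extChartAt 𝓘(ℝ, B) x₀ '' chartDomain B F E x₀

lemma isOpen_chartDomain (x₀ : M) : IsOpen (chartDomain B F E x₀) :=
  (isOpen_extChartAt_source x₀).inter (trivializationAt F E x₀).open_baseSet

lemma mem_chartDomain_self (x₀ : M) : x₀ ∈ chartDomain B F E x₀ :=
  ⟨mem_extChartAt_source x₀, FiberBundle.mem_baseSet_trivializationAt' x₀⟩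

lemma chartDomain_mem_nhds (x₀ : M) : chartDomain B F E x₀ ∈ 𝓝 x₀ :=
  (isOpen_chartDomain x₀).mem_nhds (mem_chartDomain_self x₀)

lemma isOpen_chartImage (x₀ : M) : IsOpen (chartImage B F E x₀) :=
  isOpen_image_chartDomain x₀

lemma mem_chartImage {x₀ x : M} (hx : x ∈ chartDomain B F E x₀) :
    extChartAt 𝓘(ℝ, B) x₀ x ∈ chartImage B F E x₀ := mem_image_of_mem _ hx

lemma symm_mem_chartDomain {x₀ : M} {z : B} (hz : z ∈ chartImage B F E x₀) :
    (extChartAt 𝓘(ℝ, B) x₀).symm z ∈ chartDomain B F E x₀ := by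
  obtain ⟨x, hx, rfl⟩ := hz
  rwa [(extChartAt 𝓘(ℝ, B) x₀).left_inv hx.1]

lemma mem_target_of_mem_chartImage {x₀ : M} {z : B} (hz : z ∈ chartImage B F E x₀) :
    z ∈ (extChartAt 𝓘(ℝ, B) x₀).target := by
  obtain ⟨x, hx, rfl⟩ := hz
  exact (extChartAt 𝓘(ℝ, B) x₀).map_source hx.1

lemma chartSymm_proj {x₀ : M} {z : B × F} (hz : z.1 ∈ chartImage B F E x₀) :
    (chartSymm B F E x₀ z).proj = (extChartAt 𝓘(ℝ, B) x₀).symm z.1 :=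
  (trivializationAt F E x₀).proj_symm_apply' (symm_mem_chartDomain hz).2

lemma chartSymm_proj_mem {x₀ : M} {z : B × F} (hz : z.1 ∈ chartImage B F E x₀) :
    (chartSymm B F E x₀ z).proj ∈ chartDomain B F E x₀ := by
  rw [chartSymm_proj hz]; exact symm_mem_chartDomain hz

lemma chartCoord_chartSymm {x₀ : M} {z : B × F} (hz : z.1 ∈ chartImage B F E x₀) :
    chartCoord B F E x₀ (chartSymm B F E x₀ z) = z := by
  refine Prod.ext ?_ ?_
  · simp only [chartCoord, chartSymm_proj hz]
    exact (extChartAt 𝓘(ℝ, B) x₀).right_inv (mem_target_of_mem_chartImage hz)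
  · simp only [chartCoord, chartSymm]
    exact congrArg Prod.snd
      ((trivializationAt F E x₀).apply_symm_apply' (symm_mem_chartDomain hz).2)

lemma chartSymm_chartCoord {x₀ : M} {e : TotalSpace F E} (he : e.proj ∈ chartDomain B F E x₀) :
    chartSymm B F E x₀ (chartCoord B F E x₀ e) = e := by
  have hs : e ∈ (trivializationAt F E x₀).source := (trivializationAt F E x₀).mem_source.mpr he.2
  simp only [chartSymm, chartCoord]
  rw [(extChartAt 𝓘(ℝ, B) x₀).left_inv he.1]
  have : (e.proj, (trivializationAt F E x₀ e).2) = trivializationAt F E x₀ e :=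
    (trivializationAt F E x₀).mk_proj_snd hs
  rw [this]
  exact (trivializationAt F E x₀).toPartialEquiv.left_inv hs

lemma contMDiffOn_chartCoord (x₀ : M) :
    ContMDiffOn (𝓘(ℝ, B).prod 𝓘(ℝ, F)) 𝓘(ℝ, B × F) ∞ (chartCoord B F E x₀)
      (TotalSpace.proj ⁻¹' chartDomain B F E x₀) := by
  refine ContMDiffOn.prodMk_space ?_ ?_
  · refine (contMDiffOn_extChartAt (n := ∞) (x := x₀)).comp
      (Bundle.contMDiff_proj E).contMDiffOn fun e he ↦ ?_
    simpa using he.1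
  · have h := (contMDiff_snd (I := 𝓘(ℝ, B)) (J := 𝓘(ℝ, F)) (n := ∞)).comp_contMDiffOn
      ((trivializationAt F E x₀).contMDiffOn (IB := 𝓘(ℝ, B)) (n := ∞))
    exact h.mono fun e he ↦ (trivializationAt F E x₀).mem_source.mpr he.2

lemma contMDiffOn_chartSymm (x₀ : M) :
    ContMDiffOn 𝓘(ℝ, B × F) (𝓘(ℝ, B).prod 𝓘(ℝ, F)) ∞ (chartSymm B F E x₀)
      (chartImage B F E x₀ ×ˢ univ) := by
  have h1 : ContMDiffOn 𝓘(ℝ, B × F) 𝓘(ℝ, B) ∞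
      (fun z : B × F ↦ (extChartAt 𝓘(ℝ, B) x₀).symm z.1) (chartImage B F E x₀ ×ˢ univ) :=
    (contMDiffOn_extChartAt_symm (n := ∞) x₀).comp contDiff_fst.contMDiff.contMDiffOn
      fun z hz ↦ mem_target_of_mem_chartImage hz.1
  have h2 : ContMDiffOn 𝓘(ℝ, B × F) 𝓘(ℝ, F) ∞ (fun z : B × F ↦ z.2)
      (chartImage B F E x₀ ×ˢ univ) := contDiff_snd.contMDiff.contMDiffOn
  refine ((trivializationAt F E x₀).contMDiffOn_symm (IB := 𝓘(ℝ, B)) (n := ∞)).comp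
    (h1.prodMk h2) fun z hz ↦ ?_
  exact (trivializationAt F E x₀).mem_target.mpr (symm_mem_chartDomain hz.1).2

/-- A smooth curve in the chart is a smooth curve in `E`. -/
lemma contMDiffAt_chartSymm_comp {P : Type*} [NormedAddCommGroup P] [NormedSpace ℝ P] {x₀ : M}
    {γ : P → B × F} {t : P} (hγ : ContDiffAt ℝ ∞ γ t) (ht : (γ t).1 ∈ chartImage B F E x₀) :
    ContMDiffAt 𝓘(ℝ, P) (𝓘(ℝ, B).prod 𝓘(ℝ, F)) ∞ (fun s ↦ chartSymm B F E x₀ (γ s)) t :=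
  ((contMDiffOn_chartSymm x₀).contMDiffAt (((isOpen_chartImage x₀).prod isOpen_univ).mem_nhds
    ⟨ht, trivial⟩)).comp t hγ.contMDiffAt

lemma contDiffAt_chartCoord_comp {P : Type*} [NormedAddCommGroup P] [NormedSpace ℝ P] {x₀ : M}
    {a : P → TotalSpace F E} {t : P} (ha : ContMDiffAt 𝓘(ℝ, P) (𝓘(ℝ, B).prod 𝓘(ℝ, F)) ∞ a t)
    (ht : (a t).proj ∈ chartDomain B F E x₀) :
    ContDiffAt ℝ ∞ (fun s ↦ chartCoord B F E x₀ (a s)) t :=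
  (((contMDiffOn_chartCoord x₀).contMDiffAt (((isOpen_chartDomain x₀).preimage
    (FiberBundle.continuous_proj F E)).mem_nhds ht)).comp t ha).contDiffAt

/-! ### The anchor in a chart -/

variable (L) in
/-- The anchor in the coordinates of a chart. -/
def anchorCoord (x₀ : M) (z : B × F) : B :=
  mfderiv 𝓘(ℝ, B) 𝓘(ℝ, B) (extChartAt 𝓘(ℝ, B) x₀) (chartSymm B F E x₀ z).proj
    (L.anchor (chartSymm B F E x₀ z).proj (chartSymm B F E x₀ z).2)

/-- On the chart domain the derivative of the chart is the trivialization of `TM` at `x₀`, so this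
is smoothness of the anchor read in two trivializations. -/
lemma contDiffOn_anchorCoord (x₀ : M) :
    ContDiffOn ℝ ∞ (L.anchorCoord x₀) (chartImage B F E x₀ ×ˢ univ) := by
  rw [← contMDiffOn_iff_contDiffOn]
  have h1 : ContMDiffOn 𝓘(ℝ, B × F) 𝓘(ℝ, B).tangent ∞
      (fun z ↦ (⟨(chartSymm B F E x₀ z).proj, L.anchor _ (chartSymm B F E x₀ z).2⟩ :
        TangentBundle 𝓘(ℝ, B) M)) (chartImage B F E x₀ ×ˢ univ) :=
    L.contMDiff_anchor.comp_contMDiffOn (contMDiffOn_chartSymm x₀)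
  have h2 := (contMDiff_snd (I := 𝓘(ℝ, B)) (J := 𝓘(ℝ, B)) (n := ∞)).comp_contMDiffOn
    ((trivializationAt B (TangentSpace 𝓘(ℝ, B)) x₀).contMDiffOn (IB := 𝓘(ℝ, B)) (n := ∞))
  refine (h2.comp h1 fun z hz ↦ ?_).congr fun z hz ↦ ?_
  · have h := (chartSymm_proj_mem (z := z) hz.1).1
    rw [extChartAt_source] at h
    rw [mem_preimage, Trivialization.mem_source]
    simpa using h
  · have h := (chartSymm_proj_mem (z := z) hz.1).1
    rw [extChartAt_source] at h
    have e1 (v : TangentSpace 𝓘(ℝ, B) (chartSymm B F E x₀ z).proj) :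
        (trivializationAt B (TangentSpace 𝓘(ℝ, B)) x₀).continuousLinearMapAt ℝ
          (chartSymm B F E x₀ z).proj v =
        (trivializationAt B (TangentSpace 𝓘(ℝ, B)) x₀ ⟨(chartSymm B F E x₀ z).proj, v⟩).2 := by
      rw [Bundle.Trivialization.continuousLinearMapAt_apply,
        Bundle.Trivialization.linearMapAt_apply, if_pos (by simpa using h)]
    refine Eq.trans ?_ (e1 _)
    rw [TangentBundle.continuousLinearMapAt_trivializationAt h]
    rfl

lemma anchorCoord_chartCoord {x₀ : M} {e : TotalSpace F E}
    (he : e.proj ∈ chartDomain B F E x₀) :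
    L.anchorCoord x₀ (chartCoord B F E x₀ e) =
      mfderiv 𝓘(ℝ, B) 𝓘(ℝ, B) (extChartAt 𝓘(ℝ, B) x₀) e.proj (L.anchor e.proj e.2) := by
  unfold anchorCoord
  rw [chartSymm_chartCoord he]

/-- Admissibility of a curve at a point, in coordinates. -/
lemma mfderiv_proj_eq_anchor_iff {x₀ : M} {a : ℝ → TotalSpace F E} {t : ℝ}
    (ha : ContMDiffAt 𝓘(ℝ, ℝ) (𝓘(ℝ, B).prod 𝓘(ℝ, F)) ∞ a t)
    (ht : (a t).proj ∈ chartDomain B F E x₀) :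
    mfderiv 𝓘(ℝ, ℝ) 𝓘(ℝ, B) (fun s ↦ (a s).proj) t (1 : ℝ) = L.anchor (a t).proj (a t).2 ↔
      HasDerivAt (fun s ↦ extChartAt 𝓘(ℝ, B) x₀ (a s).proj)
        (L.anchorCoord x₀ (chartCoord B F E x₀ (a t))) t := by
  have hproj : ContMDiffAt 𝓘(ℝ, ℝ) 𝓘(ℝ, B) ∞ (fun r ↦ (a r).proj) t :=
    (Bundle.contMDiff_proj E).contMDiffAt.comp _ ha
  have hmd := hproj.mdifferentiableAt (n := ∞) (by simp)
  have hsrc : (a t).proj ∈ (chartAt B x₀).source := by simpa using ht.1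
  have hκ : MDifferentiableAt 𝓘(ℝ, B) 𝓘(ℝ, B) (extChartAt 𝓘(ℝ, B) x₀) (a t).proj :=
    mdifferentiableAt_extChartAt hsrc
  have h1 : HasDerivAt (fun s ↦ extChartAt 𝓘(ℝ, B) x₀ (a s).proj)
      (mfderiv 𝓘(ℝ, B) 𝓘(ℝ, B) (extChartAt 𝓘(ℝ, B) x₀) (a t).proj
        (mfderiv 𝓘(ℝ, ℝ) 𝓘(ℝ, B) (fun s ↦ (a s).proj) t (1 : ℝ))) t :=
    hasDerivAt_iff_hasFDerivAt.mpr (by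
      have h := (hκ.hasMFDerivAt.comp t hmd.hasMFDerivAt).hasFDerivAt
      refine h.congr_fderiv ?_
      ext
      exact (one_smul ℝ _).symm)
  rw [anchorCoord_chartCoord ht]
  constructor
  · intro h
    rw [h] at h1
    exact h1
  · intro h
    exact (isInvertible_mfderiv_extChartAt ht.1).injective (h1.unique h)

/-! ### Cut-off functions -/

lemma exists_bump {p : M} {U : Set M} (hU : U ∈ 𝓝 p) :
    ∃ χ : BaseFun B M, tsupport χ ⊆ U ∧ ∀ᶠ x in 𝓝 p, χ x = 1 := by
  obtain ⟨f, hf, -⟩ := (SmoothBumpFunction.nhds_basis_support (I := 𝓘(ℝ, B)) hU).mem_iff.mp hU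
  exact ⟨⟨f, f.contMDiff⟩, hf, f.eventuallyEq_one⟩

/-- Off the support of `χ` the product vanishes locally, so the values of `q` outside `U` do not
matter. -/
lemma contMDiff_cut {H N EN G : Type*} [NormedAddCommGroup EN] [NormedSpace ℝ EN]
    [TopologicalSpace H] {I : ModelWithCorners ℝ EN H} [TopologicalSpace N] [ChartedSpace H N]
    [NormedAddCommGroup G] [NormedSpace ℝ G] {U : Set N} (hU : IsOpen U) {χ : N → ℝ}
    (hχ : ContMDiff I 𝓘(ℝ, ℝ) ∞ χ) (hs : tsupport χ ⊆ U) {q : N → G}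
    (hq : ContMDiffOn I 𝓘(ℝ, G) ∞ q U) : ContMDiff I 𝓘(ℝ, G) ∞ (fun x ↦ χ x • q x) := by
  intro x
  by_cases hx : x ∈ tsupport χ
  · exact hχ.contMDiffAt.smul (hq.contMDiffAt (hU.mem_nhds (hs hx)))
  · refine contMDiffAt_const (c := (0 : G)) |>.congr_of_eventuallyEq ?_
    filter_upwards [(isClosed_tsupport χ).isOpen_compl.mem_nhds hx] with y hy
    rw [image_eq_zero_of_notMem_tsupport hy, zero_smul]

lemma exists_totFun_cut {x₀ : M} {χ : BaseFun B M} (hχ : tsupport χ ⊆ chartDomain B F E x₀)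
    {q : B × F → ℝ} (hq : ContDiffOn ℝ ∞ q (chartImage B F E x₀ ×ˢ univ)) :
    ∃ h : TotFun B F E, ∀ e, h e = χ e.proj * q (chartCoord B F E x₀ e) := by
  have h1 : ContMDiff (𝓘(ℝ, B).prod 𝓘(ℝ, F)) 𝓘(ℝ, ℝ) ∞ (fun e : TotalSpace F E ↦ χ e.proj) :=
    χ.contMDiff.comp (Bundle.contMDiff_proj E)
  refine ⟨⟨_, contMDiff_cut ((isOpen_chartDomain (B := B) (F := F) (E := E) x₀).preimage
    (FiberBundle.continuous_proj F E)) h1 ?_ (q := fun e ↦ q (chartCoord B F E x₀ e)) ?_⟩,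
    fun e ↦ rfl⟩
  · refine Subset.trans ?_ (preimage_mono hχ)
    exact closure_minimal (fun e he ↦ subset_closure he)
      ((isClosed_tsupport χ).preimage (FiberBundle.continuous_proj F E))
  · exact hq.contMDiffOn.comp (contMDiffOn_chartCoord x₀) fun e he ↦ ⟨mem_chartImage he, trivial⟩

/-! ### Coordinates of jets -/

lemma iteratedDeriv_clm_comp {W W' : Type*} [NormedAddCommGroup W] [NormedSpace ℝ W]
    [NormedAddCommGroup W'] [NormedSpace ℝ W'] (ℓ : W →L[ℝ] W') {f : ℝ → W} {t : ℝ}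
    (hf : ContDiffAt ℝ ∞ f t) (r : ℕ) :
    iteratedDeriv r (fun s ↦ ℓ (f s)) t = ℓ (iteratedDeriv r f t) := by
  have h := ℓ.iteratedFDeriv_comp_left (hf.of_le (show (r : WithTop ℕ∞) ≤ ∞ by
    exact_mod_cast le_top)) (i := r) le_rfl
  simp only [iteratedDeriv]
  exact congrArg (fun m ↦ m fun _ ↦ (1 : ℝ)) h

lemma contDiffAt_iteratedDeriv {W : Type*} [NormedAddCommGroup W] [NormedSpace ℝ W] {f : ℝ → W}
    {t : ℝ} (hf : ContDiffAt ℝ ∞ f t) (r : ℕ) : ContDiffAt ℝ ∞ (iteratedDeriv r f) t := by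
  induction r with
  | zero => simpa using hf
  | succ r ih =>
    rw [iteratedDeriv_succ]
    exact (ih.fderiv_right (m := ∞) (by simp)).clm_apply contDiffAt_const

lemma IsAdmissible.contMDiffAt {a : ℝ → TotalSpace F E} (ha : L.IsAdmissible a) :
    ContMDiffAt 𝓘(ℝ, ℝ) (𝓘(ℝ, B).prod 𝓘(ℝ, F)) ∞ a 0 := by
  obtain ⟨U, hU, h0, hs, -⟩ := ha
  exact hs.contMDiffAt (hU.mem_nhds h0)

lemma IsAdmissible.contDiffAt_chartCoord {a : ℝ → TotalSpace F E} (ha : L.IsAdmissible a) {x₀ : M}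
    (h : (a 0).proj ∈ chartDomain B F E x₀) :
    ContDiffAt ℝ ∞ (fun t ↦ chartCoord B F E x₀ (a t)) 0 :=
  contDiffAt_chartCoord_comp ha.contMDiffAt h

lemma IsAdmissible.eventually_mem {a : ℝ → TotalSpace F E} (ha : L.IsAdmissible a) {U : Set M}
    (h : U ∈ 𝓝 (a 0).proj) : ∀ᶠ t in 𝓝 (0 : ℝ), (a t).proj ∈ U :=
  ((FiberBundle.continuous_proj F E).continuousAt.comp
    ha.contMDiffAt.continuousAt).preimage_mem_nhds h

/-- A jet records the derivatives of all smooth functions on `E`. Linear functionals of the fibre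
coordinates, cut off by a function equal to `1` near the base point, are among them and determine
the coordinates. -/
lemma jetCoord_eq {A : L.EJet k} {a a' : ℝ → TotalSpace F E} (h : A.IsJetOf a) (h' : A.IsJetOf a')
    {x₀ : M} (hA : A.base ∈ chartDomain B F E x₀) :
    jetCoord B F E k x₀ a = jetCoord B F E k x₀ a' := by
  refine Prod.ext ?_ ?_
  · simp only [jetCoord, h.2.1, h'.2.1]
  funext r
  obtain ⟨χ, hχ, hχ1⟩ := exists_bump (B := B) ((isOpen_chartDomain (B := B) (F := F) (E := E) x₀).mem_nhds hA)
  refine (Module.finBasis ℝ F).ext_elem fun α ↦ ?_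
  let ℓ : F →L[ℝ] ℝ := LinearMap.toContinuousLinearMap ((Module.finBasis ℝ F).coord α)
  obtain ⟨f, hf⟩ := exists_totFun_cut hχ (q := fun z ↦ ℓ z.2)
    (ℓ.contDiff.comp contDiff_snd).contDiffOn
  have key {a : ℝ → TotalSpace F E} (h : A.IsJetOf a) :
      A.jet f r = ℓ ((jetCoord B F E k x₀ a).2 r) := by
    have ha0 : (a 0).proj ∈ chartDomain B F E x₀ := h.2.1 ▸ hA
    have hsm : ContDiffAt ℝ ∞ (fun t ↦ (trivializationAt F E x₀ (a t)).2) 0 :=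
      (h.1.contDiffAt_chartCoord ha0).snd
    rw [h.2.2]
    refine Eq.trans ?_ (iteratedDeriv_clm_comp ℓ hsm r)
    refine Filter.EventuallyEq.iteratedDeriv_eq _ ?_
    have hev : ∀ᶠ t in 𝓝 (0 : ℝ), χ (a t).proj = 1 := h.1.eventually_mem (h.2.1 ▸ hχ1)
    filter_upwards [hev] with t ht
    rw [hf, ht, one_mul]
    rfl
  exact (key h).symm.trans (key h')

/-- The coordinates `(x^i, y^α_r)` of a point of `E^k`. -/
def EJet.coord (A : L.EJet k) (x₀ : M) : B × (Fin k → F) :=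
  jetCoord B F E k x₀ A.exists_curve.choose

lemma EJet.isJetOf_choose (A : L.EJet k) : A.IsJetOf A.exists_curve.choose :=
  A.exists_curve.choose_spec

lemma EJet.IsJetOf.coord_eq {A : L.EJet k} {a : ℝ → TotalSpace F E} (h : A.IsJetOf a)
    {x₀ : M} (hA : A.base ∈ chartDomain B F E x₀) : A.coord x₀ = jetCoord B F E k x₀ a :=
  jetCoord_eq A.isJetOf_choose h hA

lemma EJet.coord_fst (A : L.EJet k) (x₀ : M) : (A.coord x₀).1 = extChartAt 𝓘(ℝ, B) x₀ A.base := by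
  simp only [EJet.coord, jetCoord, A.isJetOf_choose.2.1]

lemma EJet.coord_mem {A : L.EJet k} {x₀ : M} (hA : A.base ∈ chartDomain B F E x₀) :
    A.coord x₀ ∈ chartImage B F E x₀ ×ˢ (univ : Set (Fin k → F)) :=
  ⟨by rw [A.coord_fst]; exact mem_chartImage hA, trivial⟩

lemma isOpen_coordSet (k : ℕ) (x₀ : M) :
    IsOpen (chartImage B F E x₀ ×ˢ (univ : Set (Fin k → F))) :=
  (isOpen_chartImage x₀).prod isOpen_univ

lemma EJet.IsJetOf.trunc {A : L.EJet (k + 1)} {a : ℝ → TotalSpace F E} (h : A.IsJetOf a) :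
    A.trunc.IsJetOf a := ⟨h.1, h.2.1, fun f j ↦ h.2.2 f j.castSucc⟩

lemma EJet.coord_trunc (A : L.EJet (k + 1)) {x₀ : M} (hA : A.base ∈ chartDomain B F E x₀) :
    A.trunc.coord x₀ = ((A.coord x₀).1, fun r ↦ (A.coord x₀).2 r.castSucc) := by
  rw [(A.isJetOf_choose.trunc).coord_eq (x₀ := x₀) hA]
  rfl

/-- `g` represents the function `φ` on `E^k` in the chart at `x₀`. -/
def IsRep (φ : L.EJet k → ℝ) (x₀ : M) (g : B × (Fin k → F) → ℝ) : Prop :=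
  ContDiffOn ℝ ∞ g (chartImage B F E x₀ ×ˢ univ) ∧
    ∀ A : L.EJet k, A.base ∈ chartDomain B F E x₀ → φ A = g (A.coord x₀)

/-- By `jetCoord_eq` the quantifier over representing curves collapses to the chosen one. -/
lemma isSmooth_iff {φ : L.EJet k → ℝ} : IsSmooth φ ↔ ∀ x₀, ∃ g, IsRep φ x₀ g := by
  refine forall_congr' fun x₀ ↦ exists_congr fun g ↦ and_congr Iff.rfl ⟨fun h A hA ↦ ?_,
    fun h A a ha hA ↦ ?_⟩
  · exact h A _ A.isJetOf_choose hA
  · rw [h A hA, ha.coord_eq hA]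

lemma exists_isRep (φ : L.smoothFun k) (x₀ : M) : ∃ g, IsRep φ.1 x₀ g := isSmooth_iff.mp φ.2 x₀

/-! ### The operator `T` on functions -/

/-- The velocity of a prolonged admissible curve, in coordinates. -/
def tDir (L : LieAlgebroid B F E) (k : ℕ) (x₀ : M) (z : B × (Fin (k + 1) → F)) :
    B × (Fin k → F) :=
  (L.anchorCoord x₀ (z.1, z.2 0), fun r ↦ z.2 r.succ)

lemma contDiffOn_tDir (k : ℕ) (x₀ : M) :
    ContDiffOn ℝ ∞ (tDir L k x₀) (chartImage B F E x₀ ×ˢ univ) := by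
  refine ContDiffOn.prodMk ?_ (ContDiff.contDiffOn (by fun_prop))
  exact (contDiffOn_anchorCoord x₀).comp (ContDiff.contDiffOn (by fun_prop))
    fun z hz ↦ ⟨hz.1, trivial⟩

/-- In coordinates the prolonged curve is `t ↦ (x(t), y^(r)(t))`. Admissibility makes the velocity
of `x` the anchor, and differentiation moves each `y^(r)` up by one order: this is `tDir`. -/
lemma hasDerivAt_jet {a : ℝ → TotalSpace F E} (ha : L.IsAdmissible a) {c : ℝ → L.EJet k}
    (hc : ∀ᶠ t in 𝓝 (0 : ℝ), (c t).IsJetOf (fun s ↦ a (t + s))) {x₀ : M}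
    (h0 : (a 0).proj ∈ chartDomain B F E x₀) {φ : L.EJet k → ℝ} {g : B × (Fin k → F) → ℝ}
    (hg : IsRep φ x₀ g) :
    HasDerivAt (fun t ↦ φ (c t))
      (fderiv ℝ g (jetCoord B F E k x₀ a) (tDir L k x₀ (jetCoord B F E (k + 1) x₀ a))) 0 := by
  have hz := ha.contDiffAt_chartCoord h0
  have hy : ContDiffAt ℝ ∞ (fun t ↦ (trivializationAt F E x₀ (a t)).2) 0 :=
    hz.snd
  obtain ⟨U, hU, hU0, hs, had⟩ := ha
  have hx := (mfderiv_proj_eq_anchor_iff (hs.contMDiffAt (hU.mem_nhds hU0)) h0).mp (had 0 hU0)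
  have heq : (fun t ↦ φ (c t)) =ᶠ[𝓝 0] fun t ↦ g (extChartAt 𝓘(ℝ, B) x₀ (a t).proj,
      fun r : Fin k ↦ iteratedDeriv (r : ℕ) (fun t ↦ (trivializationAt F E x₀ (a t)).2) t) := by
    filter_upwards [hc, IsAdmissible.eventually_mem (L := L) ⟨U, hU, hU0, hs, had⟩
      ((isOpen_chartDomain x₀).mem_nhds h0)] with t ht htd
    have hb : (a t).proj = (c t).base := by simpa using ht.2.1
    rw [hg.2 (c t) (hb ▸ htd), ht.coord_eq (hb ▸ htd)]
    simp only [jetCoord, add_zero]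
    congr 2
    funext r
    have := congrFun (iteratedDeriv_comp_const_add (r : ℕ)
      (fun t ↦ (trivializationAt F E x₀ (a t)).2) t) 0
    simpa using this
  refine HasDerivAt.congr_of_eventuallyEq ?_ heq
  have hgd := ((hg.1.contDiffAt ((isOpen_coordSet k x₀).mem_nhds
    (show jetCoord B F E k x₀ a ∈ chartImage B F E x₀ ×ˢ univ from ⟨mem_chartImage h0, trivial⟩))).differentiableAt
    (by simp)).hasFDerivAt
  refine hgd.comp_hasDerivAt (0 : ℝ) ?_
  refine hx.prodMk (hasDerivAt_pi.mpr fun r ↦ ?_)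
  have := ((contDiffAt_iteratedDeriv hy r).differentiableAt (by simp)).hasDerivAt
  rw [← iteratedDeriv_succ] at this
  exact this

lemma canonicalT_spec (A : L.EJet (k + 1)) : IsCanonicalAt A (canonicalT A) :=
  (exists_isCanonicalAt A).choose_spec

lemma IsCanonicalAt.vec_apply {A : L.EJet (k + 1)} {z : ETangent A.trunc} (hz : IsCanonicalAt A z)
    {x₀ : M} (hA : A.base ∈ chartDomain B F E x₀) {φ : L.smoothFun k} {g : B × (Fin k → F) → ℝ}
    (hg : IsRep φ.1 x₀ g) :
    (vec (A := A.trunc) z).1 φ = fderiv ℝ g (A.trunc.coord x₀) (tDir L k x₀ (A.coord x₀)) := by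
  obtain ⟨a, c, ha, hab, hc, hv⟩ := hz
  rw [ha.coord_eq hA, ha.trunc.coord_eq (x₀ := x₀) hA]
  exact (hv φ).unique (hasDerivAt_jet ha.1 hc (ha.2.1 ▸ hA) hg)

/-- The derivation `φ ↦ T φ` along `τ_{k+1,k}`. -/
def tDeriv : L.smoothFun k →ₗ[ℝ] L.smoothFun (k + 1) where
  toFun φ := ⟨fun A ↦ (vec (A := A.trunc) (canonicalT A)).1 φ, isSmooth_iff.mpr fun x₀ ↦ by
    obtain ⟨g, hg⟩ := exists_isRep φ x₀
    refine ⟨fun z ↦ fderiv ℝ g (z.1, fun r ↦ z.2 r.castSucc) (tDir L k x₀ z), ?_, fun A hA ↦ ?_⟩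
    · refine ContDiffOn.clm_apply ?_ (contDiffOn_tDir k x₀)
      exact (hg.1.fderiv_of_isOpen (isOpen_coordSet k x₀) (m := ∞) (by simp)).comp
        (ContDiff.contDiffOn (by fun_prop)) fun z hz ↦ ⟨hz.1, trivial⟩
    · refine ((canonicalT_spec A).vec_apply hA hg).trans ?_
      rw [A.coord_trunc hA]⟩
  map_add' φ ψ := by ext A; exact map_add _ _ _
  map_smul' c φ := by ext A; exact map_smul _ _ _

lemma tDeriv_apply (φ : L.smoothFun k) (A : L.EJet (k + 1)) :
    (tDeriv φ).1 A = (vec (A := A.trunc) (canonicalT A)).1 φ := rfl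

lemma jet_zero_isSmooth (h : TotFun B F E) (hk : 0 < k) :
    IsSmooth (fun A : L.EJet k ↦ A.jet h ⟨0, hk⟩) := by
  refine isSmooth_iff.mpr fun x₀ ↦ ⟨fun z ↦ h (chartSymm B F E x₀ (z.1, z.2 ⟨0, hk⟩)), ?_,
    fun A hA ↦ ?_⟩
  · have h1 := h.contMDiff.comp_contMDiffOn (contMDiffOn_chartSymm (F := F) (E := E) x₀)
    exact h1.contDiffOn.comp (t := chartImage B F E x₀ ×ˢ univ)
      (ContDiff.contDiffOn (by fun_prop)) fun z hz ↦ ⟨hz.1, trivial⟩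
  · have hA' := A.isJetOf_choose
    refine (hA'.2.2 h ⟨0, hk⟩).trans ?_
    simp only [EJet.coord, iteratedDeriv_zero, jetCoord]
    exact congrArg h (chartSymm_chartCoord (hA'.2.1.symm ▸ hA)).symm

/-- `T` maps the `j`-th jet component of a function to the next one. -/
lemma vec_canonicalT_jet {h : TotFun B F E} {j : ℕ} (hj : j < k)
    (hs : IsSmooth (fun A : L.EJet k ↦ A.jet h ⟨j, hj⟩)) (A : L.EJet (k + 1)) :
    (vec (A := A.trunc) (canonicalT A)).1 ⟨_, hs⟩ = A.jet h ⟨j + 1, Nat.succ_lt_succ hj⟩ := by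
  obtain ⟨a, c, ha, hab, hc, hv⟩ := canonicalT_spec A
  refine (hv ⟨_, hs⟩).unique ?_
  have hsm : ContDiffAt ℝ ∞ (fun t ↦ h (a t)) 0 :=
    (h.contMDiff.contMDiffAt.comp (0 : ℝ) ha.1.contMDiffAt).contDiffAt
  have h1 := ((contDiffAt_iteratedDeriv hsm j).differentiableAt (by simp)).hasDerivAt
  rw [← iteratedDeriv_succ] at h1
  rw [ha.2.2]
  refine h1.congr_of_eventuallyEq ?_
  filter_upwards [hc] with t ht
  rw [ht.2.2]
  have := congrFun (iteratedDeriv_comp_const_add j (fun t ↦ h (a t)) t) 0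
  simpa using this

/-- No coordinate formula for higher jets is needed: `T` preserves smoothness and maps the jet
component of order `j` to that of order `j + 1`. -/
lemma jet_isSmooth (h : TotFun B F E) (j : ℕ) : ∀ {k : ℕ} (hj : j < k),
    IsSmooth (fun A : L.EJet k ↦ A.jet h ⟨j, hj⟩) := by
  induction j with
  | zero => intro k hj; exact jet_zero_isSmooth h hj
  | succ j ih =>
    intro k hj
    obtain ⟨k, rfl⟩ := Nat.exists_eq_succ_of_ne_zero (Nat.ne_zero_of_lt hj)
    have := (tDeriv (⟨_, ih (Nat.lt_of_succ_lt_succ hj)⟩ : L.smoothFun k)).2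
    refine (congrArg IsSmooth ?_).mp this
    funext A
    exact vec_canonicalT_jet (Nat.lt_of_succ_lt_succ hj) _ A

variable (L) in
/-- The function `[a]^{k-1} ↦ (h ∘ a)^{(r)}(0)` on `E^k`. -/
def jetFun (h : TotFun B F E) (r : Fin k) : L.smoothFun k :=
  ⟨fun A ↦ A.jet h r, jet_isSmooth h r r.2⟩

lemma tDeriv_jetFun (h : TotFun B F E) (r : Fin k) :
    tDeriv (jetFun L h r) = jetFun L h r.succ := by
  ext A
  exact vec_canonicalT_jet r.2 _ A

/-! ### Existence of admissible curves with a given jet -/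

/-- Used to extend coordinate expressions to the whole model space, where the flow theorem and the
chain rule apply without domains. -/
lemma contDiff_cut_fst {P G : Type*} [NormedAddCommGroup P] [NormedSpace ℝ P]
    [NormedAddCommGroup G] [NormedSpace ℝ G] {U : Set B} (hU : IsOpen U) {b : B → ℝ}
    (hb : ContDiff ℝ ∞ b) (hs : tsupport b ⊆ U) {q : B × P → G}
    (hq : ContDiffOn ℝ ∞ q (U ×ˢ univ)) : ContDiff ℝ ∞ (fun z : B × P ↦ b z.1 • q z) := by
  refine (contMDiff_cut (I := 𝓘(ℝ, B × P)) (χ := fun z : B × P ↦ b z.1) (hU.prod isOpen_univ)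
    (hb.comp contDiff_fst).contMDiff ?_ hq.contMDiffOn).contDiff
  have h1 : Prod.fst ⁻¹' tsupport b ⊆ U ×ˢ (univ : Set P) := fun z hz ↦ ⟨hs hz, trivial⟩
  refine Subset.trans ?_ h1
  exact closure_minimal (fun e he ↦ subset_closure he) ((isClosed_tsupport b).preimage continuous_fst)

lemma exists_bump_space {x : B} {U : Set B} (hU : U ∈ 𝓝 x) :
    ∃ b : B → ℝ, ContDiff ℝ ∞ b ∧ tsupport b ⊆ U ∧ ∀ᶠ y in 𝓝 x, b y = 1 := by
  obtain ⟨r, hr, hrU⟩ := Metric.nhds_basis_closedBall.mem_iff.mp hU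
  let f : ContDiffBump x := ⟨r / 2, r, by positivity, by linarith⟩
  exact ⟨f, f.contDiff, by rw [f.tsupport_eq]; exact hrU, f.eventuallyEq_one⟩

/-- By repeated integration: `p` is the primitive, with value `y 0` at `0`, of a function with the
remaining derivatives. -/
lemma exists_iteratedDeriv_eq : ∀ (k : ℕ) (y : Fin k → F), ∃ p : ℝ → F, ContDiff ℝ ∞ p ∧
    ∀ r : Fin k, iteratedDeriv (r : ℕ) p 0 = y r
  | 0, _ => ⟨fun _ ↦ 0, contDiff_const, fun r ↦ r.elim0⟩
  | k + 1, y => by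
    obtain ⟨q, hq, hqy⟩ := exists_iteratedDeriv_eq k fun r ↦ y r.succ
    have hd (t : ℝ) : HasDerivAt (fun t ↦ y 0 + ∫ s in (0 : ℝ)..t, q s) (q t) t :=
      (intervalIntegral.integral_hasDerivAt_right (hq.continuous.intervalIntegrable _ _)
        (hq.continuous.stronglyMeasurableAtFilter _ _) hq.continuous.continuousAt).const_add _
    have hd' : deriv (fun t ↦ y 0 + ∫ s in (0 : ℝ)..t, q s) = q := funext fun t ↦ (hd t).deriv
    refine ⟨fun t ↦ y 0 + ∫ s in (0 : ℝ)..t, q s, ?_, fun r ↦ ?_⟩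
    · exact contDiff_infty_iff_deriv.mpr ⟨fun t ↦ (hd t).differentiableAt, by rwa [hd']⟩
    · refine Fin.cases ?_ (fun r ↦ ?_) r
      · simp
      · rw [Fin.val_succ, iteratedDeriv_succ', hd', hqy]

lemma isAdmissible_of_eventually {a : ℝ → TotalSpace F E} {x₀ : M}
    (h : ∀ᶠ t in 𝓝 (0 : ℝ), ContMDiffAt 𝓘(ℝ, ℝ) (𝓘(ℝ, B).prod 𝓘(ℝ, F)) ∞ a t ∧
      (a t).proj ∈ chartDomain B F E x₀ ∧
      HasDerivAt (fun s ↦ extChartAt 𝓘(ℝ, B) x₀ (a s).proj)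
        (L.anchorCoord x₀ (chartCoord B F E x₀ (a t))) t) : L.IsAdmissible a := by
  obtain ⟨U, hUs, hU, h0⟩ := mem_nhds_iff.mp h
  exact ⟨U, hU, h0, fun t ht ↦ (hUs ht).1.contMDiffWithinAt,
    fun t ht ↦ (mfderiv_proj_eq_anchor_iff (hUs ht).1 (hUs ht).2.1).mpr (hUs ht).2.2⟩

/-- Admissibility of a curve given in a chart. -/
lemma isAdmissible_chartSymm {x₀ : M} {γ : ℝ → B × F}
    (h : ∀ᶠ t in 𝓝 (0 : ℝ), ContDiffAt ℝ ∞ γ t ∧ (γ t).1 ∈ chartImage B F E x₀ ∧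
      HasDerivAt (fun s ↦ (γ s).1) (L.anchorCoord x₀ (γ t)) t) :
    L.IsAdmissible (fun t ↦ chartSymm B F E x₀ (γ t)) := by
  refine isAdmissible_of_eventually (x₀ := x₀) ?_
  filter_upwards [h, h.eventually_nhds] with t ht ht'
  refine ⟨contMDiffAt_chartSymm_comp ht.1 ht.2.1, chartSymm_proj_mem ht.2.1, ?_⟩
  rw [chartCoord_chartSymm ht.2.1]
  refine ht.2.2.congr_of_eventuallyEq ?_
  filter_upwards [ht'] with s hs
  exact congrArg Prod.fst (chartCoord_chartSymm hs.2.1)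

/-- The jet of an admissible curve. -/
def jetOf (k : ℕ) {a : ℝ → TotalSpace F E} (ha : L.IsAdmissible a) : L.EJet k :=
  ⟨(a 0).proj, fun f j ↦ iteratedDeriv (j : ℕ) (fun t ↦ f (a t)) 0, a, ha, rfl, fun _ _ ↦ rfl⟩

lemma isJetOf_jetOf {a : ℝ → TotalSpace F E} (ha : L.IsAdmissible a) :
    (jetOf k ha).IsJetOf a := ⟨ha, rfl, fun _ _ ↦ rfl⟩

-- The fibre part of an admissible curve can be prescribed freely as some `p(t)`. The base part then
-- solves `x' = ρ(x, p(t))`, made autonomous by adjoining the time. Hence coordinates of jets fill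
-- the whole chart, and representatives of functions are determined there.
variable (L) in
lemma exists_coord {x₀ : M} {z : B × (Fin k → F)}
    (hz : z ∈ chartImage B F E x₀ ×ˢ (univ : Set (Fin k → F))) :
    ∃ A : L.EJet k, A.base ∈ chartDomain B F E x₀ ∧ A.coord x₀ = z := by
  obtain ⟨p, hp, hpy⟩ := exists_iteratedDeriv_eq k z.2
  obtain ⟨b, hb, hbs, hb1⟩ := exists_bump_space ((isOpen_chartImage x₀).mem_nhds hz.1)
  have hf : ContDiff ℝ ∞ (fun q : B × ℝ ↦ (b q.1 • L.anchorCoord x₀ (q.1, p q.2), (1 : ℝ))) := by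
    refine ContDiff.prodMk ?_ contDiff_const
    refine contDiff_cut_fst (isOpen_chartImage x₀) hb hbs ?_
    have h1 : ContDiff ℝ ∞ (fun q : B × ℝ ↦ (q.1, p q.2)) :=
      contDiff_fst.prodMk (hp.comp contDiff_snd)
    exact (contDiffOn_anchorCoord x₀).comp h1.contDiffOn fun q hq ↦ ⟨hq.1, trivial⟩
  obtain ⟨ε, hε, N, hN, hzN, φ, hφs, hφ0, hφ⟩ := exists_smooth_flow hf (z.1, (0 : ℝ))
  have h0 : (0 : ℝ) ∈ Ioo (-ε) ε := by simp [hε]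
  have hτ : EqOn (fun s ↦ (φ s (z.1, 0)).2) (fun s ↦ s) (Ioo (-ε) ε) := by
    refine integralCurve_eqOn (f := fun _ : ℝ ↦ (1 : ℝ)) contDiff_const h0
      (fun s hs ↦ (hφ _ hzN s hs).snd) (fun s hs ↦ hasDerivAt_id s) ?_
    simp [hφ0 _ hzN]
  set ξ : ℝ → B := fun s ↦ (φ s (z.1, 0)).1 with hξ
  have hξ0 : ξ 0 = z.1 := by simp [hξ, hφ0 _ hzN]
  have hIoo : ∀ᶠ s in 𝓝 (0 : ℝ), s ∈ Ioo (-ε) ε := isOpen_Ioo.mem_nhds h0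
  have hsm : ∀ s ∈ Ioo (-ε) ε, ContDiffAt ℝ ∞ ξ s := by
    intro s hs
    have h1 := hφs.contDiffAt ((isOpen_Ioo.prod hN).mem_nhds (show (s, (z.1, (0 : ℝ))) ∈ _ from ⟨hs, hzN⟩))
    exact (h1.comp s (f := fun s : ℝ ↦ (s, (z.1, (0 : ℝ)))) (by fun_prop)).fst
  have hcont : ContinuousAt ξ 0 := (hsm 0 h0).continuousAt
  have hO : ∀ᶠ s in 𝓝 (0 : ℝ), ξ s ∈ chartImage B F E x₀ :=
    hcont.preimage_mem_nhds (by rw [hξ0]; exact (isOpen_chartImage x₀).mem_nhds hz.1)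
  have hb1' : ∀ᶠ s in 𝓝 (0 : ℝ), b (ξ s) = 1 := hcont.eventually (by rw [hξ0]; exact hb1)
  have hadm : L.IsAdmissible (fun t ↦ chartSymm B F E x₀ (ξ t, p t)) := by
    refine isAdmissible_chartSymm ?_
    filter_upwards [hIoo, hO, hb1'] with s hs hsO hsb
    refine ⟨(hsm s hs).prodMk hp.contDiffAt, hsO, ?_⟩
    have h1 := (hφ _ hzN s hs).fst
    have h2 : (φ s (z.1, 0)).2 = s := hτ hs
    rw [h2] at h1
    change HasDerivAt ξ (b (ξ s) • L.anchorCoord x₀ (ξ s, p s)) s at h1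
    rwa [hsb, one_smul] at h1
  have hbase : (jetOf k hadm).base ∈ chartDomain B F E x₀ := chartSymm_proj_mem (hO.self_of_nhds)
  refine ⟨jetOf k hadm, hbase, ?_⟩
  rw [(isJetOf_jetOf hadm).coord_eq hbase]
  have hev : ∀ᶠ t in 𝓝 (0 : ℝ), chartCoord B F E x₀ (chartSymm B F E x₀ (ξ t, p t)) = (ξ t, p t) := by
    filter_upwards [hO] with t ht
    exact chartCoord_chartSymm ht
  refine Prod.ext ?_ (funext fun r ↦ ?_)
  · exact (congrArg Prod.fst hev.self_of_nhds).trans hξ0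
  · refine Eq.trans ?_ (hpy r)
    refine Filter.EventuallyEq.iteratedDeriv_eq _ ?_
    filter_upwards [hev] with t ht
    exact congrArg Prod.snd ht

lemma EJet.base_eq {A : L.EJet k} {x₀ : M} (hA : A.base ∈ chartDomain B F E x₀) :
    A.base = (extChartAt 𝓘(ℝ, B) x₀).symm (A.coord x₀).1 := by
  rw [A.coord_fst, (extChartAt 𝓘(ℝ, B) x₀).left_inv hA.1]

lemma continuousOn_symm_coord (x₀ : M) : ContinuousOn
    (fun z : B × (Fin k → F) ↦ (extChartAt 𝓘(ℝ, B) x₀).symm z.1) (chartImage B F E x₀ ×ˢ univ) :=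
  (continuousOn_extChartAt_symm x₀).comp continuousOn_fst
    fun _ hz ↦ mem_target_of_mem_chartImage hz.1

/-- The representative over a whole chart takes at `z` the value of `ψ` at some jet with coordinates
`z`; near each point it coincides with a representative of a smooth function. -/
lemma isSmooth_of_locally {ψ : L.EJet k → ℝ} (h : ∀ x₀ : M, ∃ φ : L.smoothFun k, ∃ W ∈ 𝓝 x₀,
    ∀ A : L.EJet k, A.base ∈ W → ψ A = φ.1 A) : IsSmooth ψ := by
  classical
  refine isSmooth_iff.mpr fun x₀ ↦ ?_
  have hloc : ∀ x ∈ chartDomain B F E x₀, ∃ g φ, IsRep (L := L) (k := k) φ x₀ g ∧ ∃ W ∈ 𝓝 x,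
      ∀ A : L.EJet k, A.base ∈ W → ψ A = φ A := by
    intro x hx
    obtain ⟨φ, W, hW, hφ⟩ := h x
    obtain ⟨g, hg⟩ := exists_isRep φ x₀
    exact ⟨g, φ.1, hg, W, hW, hφ⟩
  -- Independence of the chosen jet: `ψ` factors through the coordinates because each local model
  -- `φ` does.
  have hval : ∀ A A' : L.EJet k, A.base ∈ chartDomain B F E x₀ → A'.base ∈ chartDomain B F E x₀ →
      A.coord x₀ = A'.coord x₀ → ψ A = ψ A' := by
    intro A A' hA hA' hc
    have hbb : A.base = A'.base := by rw [EJet.base_eq hA, EJet.base_eq hA', hc]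
    obtain ⟨g, φ, hg, W, hW, hφ⟩ := hloc A.base hA
    rw [hφ A (mem_of_mem_nhds hW), hφ A' (hbb ▸ mem_of_mem_nhds hW), hg.2 A hA, hg.2 A' hA', hc]
  refine ⟨fun z ↦ if hz : z ∈ chartImage B F E x₀ ×ˢ (univ : Set (Fin k → F)) then
    ψ (exists_coord L hz).choose else 0, ?_, fun A hA ↦ ?_⟩
  · intro z hz
    have hx := symm_mem_chartDomain hz.1
    obtain ⟨g, φ, hg, W, hW, hφ⟩ := hloc _ hx
    refine (hg.1 z hz).congr_of_eventuallyEq ?_ ?_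
    · filter_upwards [self_mem_nhdsWithin, (continuousOn_symm_coord x₀ z hz).preimage_mem_nhdsWithin hW]
        with z' hz' hzW
      have hs := (exists_coord L hz').choose_spec
      rw [dif_pos hz', hφ _ (by rw [EJet.base_eq hs.1, hs.2]; exact hzW), hg.2 _ hs.1, hs.2]
    · have hs := (exists_coord L hz).choose_spec
      rw [dif_pos hz, hφ _ (by rw [EJet.base_eq hs.1, hs.2]; exact mem_of_mem_nhds hW), hg.2 _ hs.1, hs.2]
  · have hs := (exists_coord L (EJet.coord_mem hA)).choose_spec
    refine Eq.trans ?_ (dif_pos (EJet.coord_mem hA)).symm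
    exact hval _ _ hA hs.1 hs.2.symm

/-! ### Vector-valued smooth functions on `E^k` -/

section SmoothMap

variable {R : Type*} [NormedAddCommGroup R] [NormedSpace ℝ R] [FiniteDimensional ℝ R]
  {R' : Type*} [NormedAddCommGroup R'] [NormedSpace ℝ R'] [FiniteDimensional ℝ R']

variable (L k R) in
/-- The smooth functions on `E^k` with values in a finite-dimensional vector space. -/
def smoothMap : Submodule ℝ (L.EJet k → R) where
  carrier := {h | ∀ ℓ : R →ₗ[ℝ] ℝ, (fun A ↦ ℓ (h A)) ∈ L.smoothFun k}
  add_mem' {h h'} hh hh' ℓ := by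
    have := (L.smoothFun k).add_mem (hh ℓ) (hh' ℓ)
    refine (congrArg (· ∈ L.smoothFun k) ?_).mp this
    funext A
    exact (map_add ℓ _ _).symm
  zero_mem' ℓ := by
    refine (congrArg (· ∈ L.smoothFun k) ?_).mp (L.smoothFun k).zero_mem
    funext A
    exact (map_zero ℓ).symm
  smul_mem' c h hh ℓ := by
    have := (L.smoothFun k).smul_mem (hh ℓ) c
    refine (congrArg (· ∈ L.smoothFun k) ?_).mp this
    funext A
    exact (map_smul ℓ _ _).symm

/-- The composition of a vector-valued smooth function with a linear functional. -/
def smoothMap.comp (ℓ : R →ₗ[ℝ] ℝ) : smoothMap L k R →ₗ[ℝ] L.smoothFun k where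
  toFun h := ⟨fun A ↦ ℓ (h.1 A), h.2 ℓ⟩
  map_add' h h' := by ext A; exact map_add ℓ _ _
  map_smul' c h := by ext A; exact map_smul ℓ _ _

/-- The derivative of a vector-valued smooth function along a derivation. -/
def vderiv (v : L.smoothFun k →ₗ[ℝ] ℝ) : smoothMap L k R →ₗ[ℝ] R :=
  ∑ i, (v ∘ₗ smoothMap.comp ((Module.finBasis ℝ R).coord i)).smulRight (Module.finBasis ℝ R i)

/-- Frees `vderiv` from the basis used to define it; vector identities are afterwards tested against
linear functionals. -/
lemma map_vderiv (v : L.smoothFun k →ₗ[ℝ] ℝ) (h : smoothMap L k R) (ℓ : R →ₗ[ℝ] ℝ) :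
    ℓ (vderiv v h) = v (smoothMap.comp ℓ h) := by
  have h1 : smoothMap.comp ℓ h = ∑ i, ℓ (Module.finBasis ℝ R i) •
      smoothMap.comp ((Module.finBasis ℝ R).coord i) h := by
    ext A
    have : ℓ (h.1 A) = ∑ i, ℓ (Module.finBasis ℝ R i) * (Module.finBasis ℝ R).coord i (h.1 A) := by
      conv_lhs => rw [← (Module.finBasis ℝ R).sum_repr (h.1 A), map_sum]
      exact Finset.sum_congr rfl fun i _ ↦ (map_smul ℓ _ _).trans (mul_comm _ _)
    refine this.trans ?_
    simp only [AddSubmonoidClass.coe_finsetSum, Finset.sum_apply]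
    rfl
  rw [h1]
  simp only [vderiv, LinearMap.sum_apply, map_sum, map_smul, smul_eq_mul, LinearMap.smulRight_apply,
    LinearMap.comp_apply]
  exact Finset.sum_congr rfl fun i _ ↦ mul_comm _ _

lemma eq_of_forall_dual {x y : R} (h : ∀ ℓ : R →ₗ[ℝ] ℝ, ℓ x = ℓ y) : x = y :=
  (Module.finBasis ℝ R).ext_elem fun i ↦ h ((Module.finBasis ℝ R).coord i)

lemma vderiv_eq_iff (v : L.smoothFun k →ₗ[ℝ] ℝ) (h : smoothMap L k R) (x : R) :
    vderiv v h = x ↔ ∀ ℓ : R →ₗ[ℝ] ℝ, v (smoothMap.comp ℓ h) = ℓ x :=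
  ⟨fun hx ℓ ↦ by rw [← hx, map_vderiv], fun hx ↦ eq_of_forall_dual fun ℓ ↦ by rw [map_vderiv, hx]⟩

lemma vderiv_add (v w : L.smoothFun k →ₗ[ℝ] ℝ) (h : smoothMap L k R) :
    vderiv (v + w) h = vderiv v h + vderiv w h :=
  (vderiv_eq_iff _ _ _).mpr fun ℓ ↦ by rw [map_add, map_vderiv, map_vderiv]; rfl

lemma vderiv_smul (c : ℝ) (v : L.smoothFun k →ₗ[ℝ] ℝ) (h : smoothMap L k R) :
    vderiv (c • v) h = c • vderiv v h :=
  (vderiv_eq_iff _ _ _).mpr fun ℓ ↦ by rw [map_smul, map_vderiv]; rfl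

lemma smoothMap_contDiff_comp (h : smoothMap L k R) {G : R → R'} (hG : ContDiff ℝ ∞ G) :
    (fun A ↦ G (h.1 A)) ∈ smoothMap L k R' := by
  intro ℓ
  refine isSmooth_iff.mpr fun x₀ ↦ ?_
  choose g hg using fun i ↦
    exists_isRep (smoothMap.comp ((Module.finBasis ℝ R).coord i) h) x₀
  refine ⟨fun z ↦ ℓ (G (∑ i, g i z • Module.finBasis ℝ R i)), ?_, fun A hA ↦ ?_⟩
  · refine ((LinearMap.toContinuousLinearMap ℓ).contDiff.comp hG).comp_contDiffOn ?_
    exact ContDiffOn.sum fun i _ ↦ (hg i).1.smul contDiffOn_const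
  · refine congrArg (fun x ↦ ℓ (G x)) ?_
    conv_lhs => rw [← (Module.finBasis ℝ R).sum_repr (h.1 A)]
    exact Finset.sum_congr rfl fun i _ ↦ congrArg (· • _) ((hg i).2 A hA)

lemma mem_smoothFun_of_mem_smoothMap {φ : L.EJet k → ℝ} (h : φ ∈ smoothMap L k ℝ) :
    φ ∈ L.smoothFun k := h LinearMap.id

/-- The composition of a vector-valued smooth function with a smooth function. -/
def smoothMap.fn (h : smoothMap L k R) {G : R → ℝ} (hG : ContDiff ℝ ∞ G) : L.smoothFun k :=
  ⟨fun A ↦ G (h.1 A), mem_smoothFun_of_mem_smoothMap (smoothMap_contDiff_comp h hG)⟩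

lemma tangent_algebraMap {A : L.EJet k} (v : tangentAt A) (c : ℝ) :
    v.1 (algebraMap ℝ (L.smoothFun k) c) = 0 := by
  have h1 := v.2 1 1
  have h2 : v.1 1 = 0 := by
    rw [mul_one] at h1
    have h3 : ((1 : L.smoothFun k) : L.EJet k → ℝ) A = 1 := rfl
    rw [h3] at h1
    linarith
  rw [Algebra.algebraMap_eq_smul_one, map_smul, h2, smul_zero]

/-- The chain rule for derivations. -/
lemma tangent_fn {A : L.EJet k} (v : tangentAt A) (h : smoothMap L k R) {G : R → ℝ}
    (hG : ContDiff ℝ ∞ G) :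
    v.1 (smoothMap.fn h hG) = fderiv ℝ G (h.1 A) (vderiv v.1 h) := by
  -- The dummy component puts the target in the universe of `R`, since `exists_hadamard` takes
  -- source and target in one universe.
  have hG' : ContDiff ℝ ∞ (fun x ↦ (G x, (0 : R))) := hG.prodMk contDiff_const
  obtain ⟨H, hH, hH0, hHG⟩ := exists_hadamard hG' (h.1 A)
  set b := Module.finBasis ℝ R with hb
  have hHi (i) : ContDiff ℝ ∞ (fun x ↦ (H x (b i)).1) :=
    contDiff_fst.comp (hH.clm_apply contDiff_const)
  have hd (w : R) : (H (h.1 A) w).1 = fderiv ℝ G (h.1 A) w := by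
    rw [hH0, ((hG.differentiable (by simp) _).hasFDerivAt.prodMk (hasFDerivAt_const (0 : R) _)).fderiv]
    rfl
  -- Hadamard's expansion around `h A`. The second factor of each product vanishes at `A`, so a
  -- derivation sees only the derivative of that factor times the value of the first.
  have key : smoothMap.fn h hG = algebraMap ℝ _ (G (h.1 A)) + ∑ i, smoothMap.fn h (hHi i) *
      (smoothMap.comp (b.coord i) h - algebraMap ℝ _ (b.coord i (h.1 A))) := by
    ext A'
    have h1 := congrArg Prod.fst (hHG (h.1 A'))
    have h2 : (H (h.1 A') (h.1 A' - h.1 A)).1 =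
        ∑ i, (H (h.1 A') (b i)).1 * (b.coord i (h.1 A') - b.coord i (h.1 A)) := by
      conv_lhs => rw [← b.sum_repr (h.1 A' - h.1 A)]
      simp only [map_sum, map_smul, Prod.fst_sum, Prod.smul_fst, smul_eq_mul, map_sub,
        Finsupp.coe_sub, Pi.sub_apply, Module.Basis.coord_apply]
      exact Finset.sum_congr rfl fun i _ ↦ mul_comm _ _
    simp only [Prod.fst_add] at h1
    rw [h2] at h1
    refine h1.trans ?_
    simp only [AddMemClass.coe_add, Pi.add_apply, AddSubmonoidClass.coe_finsetSum, Finset.sum_apply]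
    rfl
  rw [key, map_add, tangent_algebraMap, zero_add, map_sum, ← hd]
  conv_rhs => rw [← b.sum_repr (vderiv v.1 h)]
  simp only [map_sum, map_smul, Prod.fst_sum, Prod.smul_fst, smul_eq_mul]
  refine Finset.sum_congr rfl fun i _ ↦ ?_
  rw [v.2, map_sub, tangent_algebraMap, sub_zero, ← Module.Basis.coord_apply, map_vderiv]
  have h0 : (smoothMap.comp (b.coord i) h - algebraMap ℝ (L.smoothFun k) (b.coord i (h.1 A))).1 A = 0 :=
    sub_self _
  rw [h0]
  have h3 : (smoothMap.fn h (hHi i)).1 A = (H (h.1 A) (b i)).1 := rfl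
  rw [h3]
  ring

/-- A derivation at a point depends only on the values near the base point. -/
lemma tangent_congr {A : L.EJet k} (v : tangentAt A) {φ ψ : L.smoothFun k} {W : Set M}
    (hW : W ∈ 𝓝 A.base) (h : ∀ A' : L.EJet k, A'.base ∈ W → φ.1 A' = ψ.1 A') : v.1 φ = v.1 ψ := by
  obtain ⟨χ, hχ, hχ1⟩ := exists_bump (B := B) hW
  -- The Leibniz rule applied to this zero product, with `χ = 1` and `φ - ψ = 0` at `A`, leaves `v
  -- (φ - ψ) = 0`.
  have h0 : pullbackBase L k χ * (φ - ψ) = 0 := by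
    ext A'
    by_cases hA' : A'.base ∈ W
    · have h1 : (φ - ψ).1 A' = 0 := sub_eq_zero.mpr (h A' hA')
      exact (congrArg (χ A'.base * ·) h1).trans (mul_zero _)
    · have h1 : χ A'.base = 0 := image_eq_zero_of_notMem_tsupport fun hh ↦ hA' (hχ hh)
      exact (congrArg (· * (φ - ψ).1 A') h1).trans (zero_mul _)
  have h1 := v.2 (pullbackBase L k χ) (φ - ψ)
  have h2 : (pullbackBase L k χ).1 A = 1 := hχ1.self_of_nhds
  have h3 : (φ - ψ).1 A = 0 := sub_eq_zero.mpr (h A (mem_of_mem_nhds hW))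
  rw [h0, map_zero, h2, h3, zero_mul, one_mul, add_zero, map_sub] at h1
  exact (sub_eq_zero.mp h1.symm)

end SmoothMap

section SmoothMapConstructions

variable {R : Type*} [NormedAddCommGroup R] [NormedSpace ℝ R] [FiniteDimensional ℝ R]
  {R' : Type*} [NormedAddCommGroup R'] [NormedSpace ℝ R'] [FiniteDimensional ℝ R']

/-- The composition of a vector-valued smooth function with a linear map. -/
def smoothMap.lin (T : R →ₗ[ℝ] R') : smoothMap L k R →ₗ[ℝ] smoothMap L k R' where
  toFun h := ⟨fun A ↦ T (h.1 A), fun ℓ ↦ h.2 (ℓ ∘ₗ T)⟩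
  map_add' h h' := by ext A; exact map_add T _ _
  map_smul' c h := by ext A; exact map_smul T _ _

lemma lin_vderiv (v : L.smoothFun k →ₗ[ℝ] ℝ) (h : smoothMap L k R) (T : R →ₗ[ℝ] R') :
    vderiv v (smoothMap.lin T h) = T (vderiv v h) :=
  (vderiv_eq_iff _ _ _).mpr fun ℓ ↦ (map_vderiv v h (ℓ ∘ₗ T)).symm

variable (L k) in
/-- The pullback to `E^k` of a vector-valued smooth function on `M`. -/
def baseMap {f : M → R} (hf : ContMDiff 𝓘(ℝ, B) 𝓘(ℝ, R) ∞ f) : smoothMap L k R :=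
  ⟨fun A ↦ f A.base, fun ℓ ↦ (pullbackBase L k
    ⟨fun x ↦ ℓ (f x), ((LinearMap.toContinuousLinearMap ℓ).contDiff.contMDiff.comp hf)⟩).2⟩

/-- The `r`-th derivative at `0` of a vector-valued function on `E` along a jet. -/
def EJet.vjet (A : L.EJet k) (h : TotalSpace F E → R) (r : ℕ) : R :=
  iteratedDeriv r (fun t ↦ h (A.exists_curve.choose t)) 0

/-- The composition of a vector-valued smooth function on `E` with a linear functional. -/
def dualTotFun {h : TotalSpace F E → R} (hh : ContMDiff (𝓘(ℝ, B).prod 𝓘(ℝ, F)) 𝓘(ℝ, R) ∞ h)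
    (ℓ : R →ₗ[ℝ] ℝ) : TotFun B F E :=
  ⟨fun e ↦ ℓ (h e), (LinearMap.toContinuousLinearMap ℓ).contDiff.contMDiff.comp hh⟩

lemma map_vjet {h : TotalSpace F E → R} (hh : ContMDiff (𝓘(ℝ, B).prod 𝓘(ℝ, F)) 𝓘(ℝ, R) ∞ h)
    (ℓ : R →ₗ[ℝ] ℝ) (r : Fin k) (A : L.EJet k) : ℓ (A.vjet h r) = A.jet (dualTotFun hh ℓ) r := by
  have hA := A.isJetOf_choose
  rw [hA.2.2]
  have hs : ContDiffAt ℝ ∞ (fun t ↦ h (A.exists_curve.choose t)) 0 :=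
    (hh.contMDiffAt.comp (0 : ℝ) hA.1.contMDiffAt).contDiffAt
  exact (iteratedDeriv_clm_comp (LinearMap.toContinuousLinearMap ℓ) hs r).symm

lemma EJet.IsJetOf.vjet_eq {A : L.EJet k} {a : ℝ → TotalSpace F E} (ha : A.IsJetOf a)
    {h : TotalSpace F E → R} (hh : ContMDiff (𝓘(ℝ, B).prod 𝓘(ℝ, F)) 𝓘(ℝ, R) ∞ h) (r : Fin k) :
    A.vjet h r = iteratedDeriv (r : ℕ) (fun t ↦ h (a t)) 0 := by
  refine eq_of_forall_dual fun ℓ ↦ ?_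
  rw [map_vjet hh, ha.2.2]
  have hs : ContDiffAt ℝ ∞ (fun t ↦ h (a t)) 0 :=
    (hh.contMDiffAt.comp (0 : ℝ) ha.1.contMDiffAt).contDiffAt
  exact iteratedDeriv_clm_comp (LinearMap.toContinuousLinearMap ℓ) hs r

variable (L k) in
/-- The jets of a vector-valued smooth function on `E`, as a smooth function on `E^k`. -/
def jetMap {h : TotalSpace F E → R} (hh : ContMDiff (𝓘(ℝ, B).prod 𝓘(ℝ, F)) 𝓘(ℝ, R) ∞ h) :
    smoothMap L k (Fin k → R) :=
  ⟨fun A r ↦ A.vjet h r, fun ℓ ↦ by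
    have h1 : (fun A : L.EJet k ↦ ℓ fun r ↦ A.vjet h r) =
        ∑ r : Fin k, (jetFun L (dualTotFun hh (ℓ ∘ₗ LinearMap.single ℝ (fun _ ↦ R) r)) r).1 := by
      funext A
      rw [Finset.sum_apply]
      conv_lhs => rw [← Finset.univ_sum_single (fun r : Fin k ↦ A.vjet h r), map_sum]
      exact Finset.sum_congr rfl fun r _ ↦ map_vjet hh (ℓ ∘ₗ LinearMap.single ℝ (fun _ ↦ R) r) r A
    rw [h1]
    exact (L.smoothFun k).sum_mem fun r _ ↦ (jetFun L _ r).2⟩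

/-- Pairing of vector-valued smooth functions. -/
def smoothMap.pair (h : smoothMap L k R) (h' : smoothMap L k R') : smoothMap L k (R × R') :=
  smoothMap.lin (LinearMap.inl ℝ R R') h + smoothMap.lin (LinearMap.inr ℝ R R') h'

lemma smoothMap.pair_apply (h : smoothMap L k R) (h' : smoothMap L k R') (A : L.EJet k) :
    (smoothMap.pair h h').1 A = (h.1 A, h'.1 A) := by
  refine (Prod.ext ?_ ?_ : ((h.1 A, (0 : R')) + ((0 : R), h'.1 A) : R × R') = _) <;> simp

lemma vderiv_pair (v : L.smoothFun k →ₗ[ℝ] ℝ) (h : smoothMap L k R) (h' : smoothMap L k R') :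
    vderiv v (smoothMap.pair h h') = (vderiv v h, vderiv v h') := by
  rw [smoothMap.pair, map_add, lin_vderiv, lin_vderiv]
  simp

lemma vderiv_jetMap (v : L.smoothFun k →ₗ[ℝ] ℝ) {h : TotalSpace F E → R}
    (hh : ContMDiff (𝓘(ℝ, B).prod 𝓘(ℝ, F)) 𝓘(ℝ, R) ∞ h) (ℓ : R →ₗ[ℝ] ℝ) (r : Fin k) :
    ℓ (vderiv v (jetMap L k hh) r) = v (jetFun L (dualTotFun hh ℓ) r) := by
  refine (map_vderiv v (jetMap L k hh) (ℓ ∘ₗ LinearMap.proj r)).trans (congrArg v ?_)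
  ext A
  exact map_vjet hh ℓ r A

lemma vderiv_baseMap (v : L.smoothFun k →ₗ[ℝ] ℝ) {f : M → R}
    (hf : ContMDiff 𝓘(ℝ, B) 𝓘(ℝ, R) ∞ f) (ℓ : R →ₗ[ℝ] ℝ) :
    ℓ (vderiv v (baseMap L k hf)) = v (pullbackBase L k
      ⟨fun x ↦ ℓ (f x), ((LinearMap.toContinuousLinearMap ℓ).contDiff.contMDiff.comp hf)⟩) :=
  map_vderiv _ _ _

end SmoothMapConstructions

/-! ### Local frames -/

variable (B F E) in
/-- Globally defined objects that agree with coordinates and a local frame near the point `x₀`. -/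
structure LocalData (x₀ : M) where
  W : Set M
  isOpen : IsOpen W
  mem : x₀ ∈ W
  subset : W ⊆ chartDomain B F E x₀
  X : M → B
  contMDiff_X : ContMDiff 𝓘(ℝ, B) 𝓘(ℝ, B) ∞ X
  X_eq : ∀ x ∈ W, X x = extChartAt 𝓘(ℝ, B) x₀ x
  Y : ∀ x, E x →ₗ[ℝ] F
  contMDiff_Y : ContMDiff (𝓘(ℝ, B).prod 𝓘(ℝ, F)) 𝓘(ℝ, F) ∞ (fun e : TotalSpace F E ↦ Y e.proj e.2)
  Y_eq : ∀ e : TotalSpace F E, e.proj ∈ W → Y e.proj e.2 = (trivializationAt F E x₀ e).2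
  sec : F →ₗ[ℝ] Sec B F E
  Y_sec : ∀ x ∈ W, ∀ c, Y x (sec c x) = c
  sec_Y : ∀ x ∈ W, ∀ v : E x, sec (Y x v) x = v
  bump : B → ℝ
  contDiff_bump : ContDiff ℝ ∞ bump
  tsupport_bump : tsupport bump ⊆ chartImage B F E x₀
  bump_eq : ∀ x ∈ W, bump (extChartAt 𝓘(ℝ, B) x₀ x) = 1
  cut : BaseFun B M
  tsupport_cut : tsupport cut ⊆ W
  cut_eq : ∀ᶠ x in 𝓝 x₀, cut x = 1

-- Each global object is a coordinate object multiplied by a cut-off function, and `W` is a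
-- neighbourhood on which `χ` and `b` equal `1`. A last cut-off is supported in `W`.
variable (B F E) in
lemma exists_localData (x₀ : M) : Nonempty (LocalData B F E x₀) := by
  set tr := trivializationAt F E x₀ with htr
  have hD := isOpen_chartDomain (B := B) (F := F) (E := E) x₀
  obtain ⟨χ, hχ, hχ1⟩ := exists_bump (B := B) (chartDomain_mem_nhds (B := B) (F := F) (E := E) x₀)
  obtain ⟨b, hb, hbs, hb1⟩ := exists_bump_space ((isOpen_chartImage (B := B) (F := F) (E := E) x₀).mem_nhds
    (mem_chartImage (mem_chartDomain_self x₀)))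
  have hχ0 (x : M) (hx : x ∉ chartDomain B F E x₀) : χ x = 0 :=
    image_eq_zero_of_notMem_tsupport fun h ↦ hx (hχ h)
  have hev : ∀ᶠ x in 𝓝 x₀, x ∈ chartDomain B F E x₀ ∧ χ x = 1 ∧ b (extChartAt 𝓘(ℝ, B) x₀ x) = 1 :=
    Filter.Eventually.and (chartDomain_mem_nhds (B := B) (F := F) (E := E) x₀) (hχ1.and ((continuousAt_extChartAt x₀).eventually hb1))
  obtain ⟨W, hWs, hW, hxW⟩ := mem_nhds_iff.mp hev
  obtain ⟨cut, hcut, hcut1⟩ := exists_bump (B := B) (hW.mem_nhds hxW)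
  have hκ : ContMDiffOn 𝓘(ℝ, B) 𝓘(ℝ, B) ∞ (extChartAt 𝓘(ℝ, B) x₀) (chartDomain B F E x₀) :=
    (contMDiffOn_extChartAt (n := ∞) (x := x₀)).mono fun x hx ↦ by simpa using hx.1
  have hY (x : M) (v : E x) : χ x • tr.linearMapAt ℝ x v = χ x • (chartCoord B F E x₀ ⟨x, v⟩).2 := by
    by_cases hx : x ∈ chartDomain B F E x₀
    · rw [Trivialization.linearMapAt_apply, if_pos hx.2]
      rfl
    · rw [hχ0 x hx, zero_smul, zero_smul]
  have hs (c : F) : ContMDiffOn 𝓘(ℝ, B) (𝓘(ℝ, B).prod 𝓘(ℝ, F)) ∞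
      (fun x ↦ (⟨x, tr.symmₗ ℝ x c⟩ : TotalSpace F E)) tr.baseSet := by
    have h1 : ContMDiffOn 𝓘(ℝ, B) (𝓘(ℝ, B).prod 𝓘(ℝ, F)) ∞ (fun x : M ↦ (x, c)) tr.baseSet :=
      contMDiffOn_id.prodMk contMDiffOn_const
    refine ((tr.contMDiffOn_symm (IB := 𝓘(ℝ, B)) (n := ∞)).comp h1 fun x hx ↦ ?_).congr fun x hx ↦ ?_
    · exact tr.mem_target.mpr hx
    · rw [Trivialization.symmₗ_apply _ hx]
      exact tr.mk_symm hx c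
  have hsm (c : F) : ContMDiff 𝓘(ℝ, B) (𝓘(ℝ, B).prod 𝓘(ℝ, F)) ∞
      (fun x ↦ (⟨x, χ x • tr.symmₗ ℝ x c⟩ : TotalSpace F E)) :=
    ContMDiffOn.smul_section_of_tsupport (u := chartDomain B F E x₀)
      (s := fun x ↦ tr.symmₗ ℝ x c) χ.contMDiff.contMDiffOn hD hχ ((hs c).mono fun x hx ↦ hx.2)
  refine ⟨{
    W := W
    isOpen := hW
    mem := hxW
    subset := fun x hx ↦ (hWs hx).1
    X := fun x ↦ χ x • extChartAt 𝓘(ℝ, B) x₀ x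
    contMDiff_X := contMDiff_cut hD χ.contMDiff hχ hκ
    X_eq := fun x hx ↦ by rw [(hWs hx).2.1, one_smul]
    Y := fun x ↦ χ x • tr.linearMapAt ℝ x
    contMDiff_Y := ?_
    Y_eq := fun e he ↦ by
      have := hY e.proj e.2
      rw [(hWs he).2.1, one_smul, one_smul] at this
      rw [LinearMap.smul_apply, (hWs he).2.1, one_smul, this]
      rfl
    sec := { toFun c := ⟨fun x ↦ χ x • tr.symmₗ ℝ x c, hsm c⟩
             map_add' c c' := by ext x; simp
             map_smul' r c := by ext x; simp [smul_comm (χ x) r] }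
    Y_sec := fun x hx c ↦ ?_
    sec_Y := fun x hx v ↦ ?_
    bump := b
    contDiff_bump := hb
    tsupport_bump := hbs
    bump_eq := fun x hx ↦ (hWs hx).2.2
    cut := cut
    tsupport_cut := hcut
    cut_eq := hcut1 }⟩
  · have h1 : ContMDiff (𝓘(ℝ, B).prod 𝓘(ℝ, F)) 𝓘(ℝ, ℝ) ∞ (fun e : TotalSpace F E ↦ χ e.proj) :=
      χ.contMDiff.comp (Bundle.contMDiff_proj E)
    have h2 := contMDiff_cut (hD.preimage (FiberBundle.continuous_proj F E)) h1 ?_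
      (q := fun e ↦ (chartCoord B F E x₀ e).2)
      (contDiff_snd.contMDiff.comp_contMDiffOn (contMDiffOn_chartCoord x₀))
    · exact h2.congr fun e ↦ hY e.proj e.2
    · refine Subset.trans ?_ (preimage_mono hχ)
      exact closure_minimal (fun e he ↦ subset_closure he)
        ((isClosed_tsupport χ).preimage (FiberBundle.continuous_proj F E))
  · have hx' := (hWs hx)
    change χ x • tr.linearMapAt ℝ x (χ x • tr.symmₗ ℝ x c) = c
    rw [hx'.2.1, one_smul, one_smul, tr.linearMapAt_symmₗ hx'.1.2]
  · have hx' := (hWs hx)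
    change χ x • tr.symmₗ ℝ x (χ x • tr.linearMapAt ℝ x v) = v
    rw [hx'.2.1, one_smul, one_smul, tr.symmₗ_linearMapAt hx'.1.2]


/-- The derivative of a function given in a chart. -/
lemma dirDeriv_eq_fderiv {x₀ x : M} (hx : x ∈ (chartAt B x₀).source) {f : M → ℝ} {g : B → ℝ}
    (hg : DifferentiableAt ℝ g (extChartAt 𝓘(ℝ, B) x₀ x))
    (h : ∀ᶠ y in 𝓝 x, f y = g (extChartAt 𝓘(ℝ, B) x₀ y)) (w : TangentSpace 𝓘(ℝ, B) x) :
    dirDeriv f x w = fderiv ℝ g (extChartAt 𝓘(ℝ, B) x₀ x)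
      (mfderiv 𝓘(ℝ, B) 𝓘(ℝ, B) (extChartAt 𝓘(ℝ, B) x₀) x w) := by
  have h1 := ((hg.hasFDerivAt.hasMFDerivAt).comp x
    (mdifferentiableAt_extChartAt (I := 𝓘(ℝ, B)) hx).hasMFDerivAt).congr_of_eventuallyEq h
  unfold dirDeriv
  rw [h1.mfderiv]
  rfl

/-! ### Coordinates on `E^k` and components on the fibres of `𝒯^E E^k`. -/

namespace LocalData

variable {x₀ : M} (d : LocalData B F E x₀)

lemma isOpen_image : IsOpen (extChartAt 𝓘(ℝ, B) x₀ '' d.W) := by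
  have h : d.W ⊆ (chartAt B x₀).source := by
    intro x hx; simpa using (d.subset hx).1
  have := (chartAt B x₀).isOpen_image_of_subset_source d.isOpen h
  simpa [extChartAt] using this

lemma mem_chart {x : M} (hx : x ∈ d.W) : x ∈ (chartAt B x₀).source := by
  simpa using (d.subset hx).1

lemma cut_eq_zero {x : M} (hx : x ∉ d.W) : d.cut x = 0 :=
  image_eq_zero_of_notMem_tsupport fun h ↦ hx (d.tsupport_cut h)

/-- The open set on which the cut-off function is `1`. -/
def core : Set M := {x | ∀ᶠ y in 𝓝 x, d.cut y = 1}

lemma core_mem_nhds : d.core ∈ 𝓝 x₀ := d.cut_eq.eventually_nhds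

lemma cut_core {x : M} (hx : x ∈ d.core) : d.cut x = 1 := Filter.Eventually.self_of_nhds (p := fun y ↦ d.cut y = 1) hx

lemma core_subset : d.core ⊆ d.W := fun x hx ↦ by
  by_contra h
  have h1 := d.cut_core hx
  rw [d.cut_eq_zero h] at h1
  exact zero_ne_one h1

lemma core_mem_nhds_of_mem {x : M} (hx : x ∈ d.core) : d.core ∈ 𝓝 x :=
  Filter.Eventually.eventually_nhds hx

lemma Y_injective {x : M} (hx : x ∈ d.W) : Function.Injective (d.Y x) := fun v w h ↦ by
  rw [← d.sec_Y x hx v, ← d.sec_Y x hx w, h]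

variable (L k) in
/-- The coordinates on `E^k` near `x₀`, extended to globally defined functions. -/
def u : smoothMap L k (B × (Fin k → F)) :=
  smoothMap.pair (baseMap L k d.contMDiff_X) (jetMap L k d.contMDiff_Y)

lemma u_apply (A : L.EJet k) :
    (d.u L k).1 A = (d.X A.base, fun r : Fin k ↦ A.vjet (fun e ↦ d.Y e.proj e.2) r) :=
  smoothMap.pair_apply _ _ _

lemma u_eq {A : L.EJet k} (hA : A.base ∈ d.W) : (d.u L k).1 A = A.coord x₀ := by
  rw [d.u_apply]
  refine Prod.ext ?_ (funext fun r ↦ ?_)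
  · exact (d.X_eq _ hA).trans (A.coord_fst x₀).symm
  · have h := A.isJetOf_choose
    refine Filter.EventuallyEq.iteratedDeriv_eq _ ?_
    have h2 : d.W ∈ 𝓝 (A.exists_curve.choose 0).proj := by
      rw [h.2.1]; exact d.isOpen.mem_nhds hA
    filter_upwards [h.1.eventually_mem h2] with t ht
    exact d.Y_eq _ ht

variable (L k) in
/-- The function `g` represents `φ` in the global coordinates. -/
def Rep (φ : L.smoothFun k) (g : B × (Fin k → F) → ℝ) : Prop :=
  ContDiff ℝ ∞ g ∧ ∀ A : L.EJet k, A.base ∈ d.W → φ.1 A = g ((d.u L k).1 A)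

lemma exists_rep (φ : L.smoothFun k) : ∃ g, d.Rep L k φ g := by
  obtain ⟨g, hg⟩ := exists_isRep φ x₀
  refine ⟨fun z ↦ d.bump z.1 • g z,
    contDiff_cut_fst (isOpen_chartImage x₀) d.contDiff_bump d.tsupport_bump hg.1, fun A hA ↦ ?_⟩
  rw [d.u_eq hA]
  beta_reduce
  rw [A.coord_fst, d.bump_eq _ hA, one_smul]
  exact hg.2 A (d.subset hA)

variable {d}

/-- The chain rule for `g ∘ u` and the locality of derivations: a tangent vector is determined by
its action on the coordinates. -/
lemma Rep.vec_apply {φ : L.smoothFun k} {g : B × (Fin k → F) → ℝ} (h : d.Rep L k φ g)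
    {A : L.EJet k} (hA : A.base ∈ d.W) (v : tangentAt A) :
    v.1 φ = fderiv ℝ g ((d.u L k).1 A) (vderiv v.1 (d.u L k)) := by
  rw [← tangent_fn v (d.u L k) h.1]
  exact tangent_congr v (d.isOpen.mem_nhds hA) h.2

/-- Since coordinates of jets fill the chart, `u` covers a neighbourhood of each of its values over
`W`. This makes the derivative of a representative depend only on the represented function. -/
lemma exists_u_eq {A : L.EJet k} (hA : A.base ∈ d.W) :
    ∀ᶠ z in 𝓝 ((d.u L k).1 A), ∃ A' : L.EJet k, A'.base ∈ d.W ∧ (d.u L k).1 A' = z := by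
  have h1 : (extChartAt 𝓘(ℝ, B) x₀ '' d.W) ×ˢ (univ : Set (Fin k → F)) ∈ 𝓝 ((d.u L k).1 A) := by
    refine (d.isOpen_image.prod isOpen_univ).mem_nhds ⟨?_, trivial⟩
    rw [d.u_eq hA, A.coord_fst]
    exact mem_image_of_mem _ hA
  filter_upwards [h1] with z hz
  obtain ⟨⟨x, hx, hxz⟩, -⟩ := hz
  obtain ⟨A', hA', hc⟩ := exists_coord L (x₀ := x₀) (z := z)
    ⟨hxz ▸ mem_image_of_mem _ (d.subset hx), trivial⟩
  have hb : A'.base = x := by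
    rw [EJet.base_eq hA', hc, ← hxz, (extChartAt 𝓘(ℝ, B) x₀).left_inv (d.subset hx).1]
  exact ⟨A', hb ▸ hx, by rw [d.u_eq (hb ▸ hx), hc]⟩

lemma Rep.fderiv_eq {φ : L.smoothFun k} {g g' : B × (Fin k → F) → ℝ} (h : d.Rep L k φ g)
    (h' : d.Rep L k φ g') {A : L.EJet k} (hA : A.base ∈ d.W) :
    fderiv ℝ g ((d.u L k).1 A) = fderiv ℝ g' ((d.u L k).1 A) := by
  refine Filter.EventuallyEq.fderiv_eq ?_
  filter_upwards [exists_u_eq hA] with z hz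
  obtain ⟨A', hA', rfl⟩ := hz
  rw [← h.2 A' hA', h'.2 A' hA']

lemma dirDeriv_lin_X {x : M} (hx : x ∈ d.W) (ℓ : B →ₗ[ℝ] ℝ) (b : E x) :
    dirDeriv (fun y ↦ ℓ (d.X y)) x (L.anchor x b) =
      ℓ (L.anchorCoord x₀ (d.X x, d.Y x b)) := by
  have h1 := anchorCoord_chartCoord (L := L) (e := (⟨x, b⟩ : TotalSpace F E)) (d.subset hx)
  have h2 : chartCoord B F E x₀ (⟨x, b⟩ : TotalSpace F E) = (d.X x, d.Y x b) :=
    Prod.ext (d.X_eq x hx).symm (d.Y_eq ⟨x, b⟩ hx).symm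
  rw [← h2, h1]
  refine (dirDeriv_eq_fderiv (d.mem_chart hx) (g := LinearMap.toContinuousLinearMap ℓ)
    (LinearMap.toContinuousLinearMap ℓ).differentiableAt ?_ _).trans ?_
  · filter_upwards [d.isOpen.mem_nhds hx] with y hy
    rw [d.X_eq y hy]; rfl
  · rw [ContinuousLinearMap.fderiv]; rfl

variable (d) in
/-- The components of an element of `𝒯^E E^k` in the local frame. -/
def comp (A : L.EJet k) : ETangent A →ₗ[ℝ] F × (Fin k → F) where
  toFun z := (d.Y A.base (fib z), (vderiv (vec z).1 (d.u L k)).2)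
  map_add' z w := by
    refine Prod.ext (map_add _ _ _) ?_
    exact (Prod.ext_iff.mp (vderiv_add (vec z).1 (vec w).1 (d.u L k))).2
  map_smul' c z := by
    refine Prod.ext (map_smul _ _ _) ?_
    exact (Prod.ext_iff.mp (vderiv_smul c (vec z).1 (d.u L k))).2

/-- The condition `ρ(b) = Tτ_{k,0}(v)` fixes the base component of `v` in terms of `b`; this is why
the components of an element of `𝒯^E E^k` lie in `F × (Fin k → F)`, without a factor `B`. -/
lemma vderiv_u {A : L.EJet k} (hA : A.base ∈ d.W) (z : ETangent A) :
    vderiv (vec z).1 (d.u L k) =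
      (L.anchorCoord x₀ (d.X A.base, (d.comp A z).1), (d.comp A z).2) := by
  refine Prod.ext ?_ rfl
  rw [u, vderiv_pair]
  refine eq_of_forall_dual fun ℓ ↦ ?_
  rw [vderiv_baseMap]
  exact (z.2 _).trans (dirDeriv_lin_X hA ℓ _)

lemma Rep.vec_eq {φ : L.smoothFun k} {g : B × (Fin k → F) → ℝ} (h : d.Rep L k φ g)
    {A : L.EJet k} (hA : A.base ∈ d.W) (z : ETangent A) :
    (vec z).1 φ = fderiv ℝ g ((d.u L k).1 A)
      (L.anchorCoord x₀ (d.X A.base, (d.comp A z).1), (d.comp A z).2) := by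
  rw [h.vec_apply hA, vderiv_u hA]

lemma comp_injective {A : L.EJet k} (hA : A.base ∈ d.W) : Function.Injective (d.comp A) := by
  intro z w hzw
  refine Subtype.ext (Prod.ext (d.Y_injective hA (congrArg Prod.fst hzw)) (Subtype.ext ?_))
  ext φ
  obtain ⟨g, hg⟩ := d.exists_rep φ
  exact (hg.vec_eq hA z).trans (by rw [hzw]; exact (hg.vec_eq hA w).symm)

/-- The vector part is the directional derivative of representatives along `w`, well defined by
`Rep.fderiv_eq`. The base component of `w` is the anchor of the prescribed fibre component, so the
compatibility condition holds. -/
lemma comp_surjective {A : L.EJet k} (hA : A.base ∈ d.W) : Function.Surjective (d.comp A) := by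
  intro c
  choose g hg using fun φ ↦ d.exists_rep (L := L) (k := k) φ
  set w : B × (Fin k → F) := (L.anchorCoord x₀ (d.X A.base, c.1), c.2) with hw
  have key {φ : L.smoothFun k} {g' : B × (Fin k → F) → ℝ} (h : d.Rep L k φ g') :
      fderiv ℝ (g φ) ((d.u L k).1 A) w = fderiv ℝ g' ((d.u L k).1 A) w := by
    rw [(hg φ).fderiv_eq h hA]
  have hdiff (φ : L.smoothFun k) : DifferentiableAt ℝ (g φ) ((d.u L k).1 A) :=
    (hg φ).1.differentiable (by simp) _
  let v : L.smoothFun k →ₗ[ℝ] ℝ :=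
    { toFun φ := fderiv ℝ (g φ) ((d.u L k).1 A) w
      map_add' φ ψ := by
        refine (key (g' := g φ + g ψ) ⟨(hg φ).1.add (hg ψ).1, fun A' hA' ↦ ?_⟩).trans ?_
        · exact congrArg₂ (· + ·) ((hg φ).2 A' hA') ((hg ψ).2 A' hA')
        · rw [fderiv_add (hdiff φ) (hdiff ψ)]; rfl
      map_smul' r φ := by
        refine (key (g' := r • g φ) ⟨contDiff_const.smul (hg φ).1, fun A' hA' ↦ ?_⟩).trans ?_
        · exact congrArg (r • ·) ((hg φ).2 A' hA')
        · rw [fderiv_const_smul (hdiff φ)]; rfl }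
  have hv : v ∈ tangentAt A := by
    intro φ ψ
    refine (key (g' := g φ * g ψ) ⟨(hg φ).1.mul (hg ψ).1, fun A' hA' ↦ ?_⟩).trans ?_
    · exact congrArg₂ (· * ·) ((hg φ).2 A' hA') ((hg ψ).2 A' hA')
    · rw [fderiv_mul (hdiff φ) (hdiff ψ), (hg φ).2 A hA, (hg ψ).2 A hA]; rfl
  have hz : ((d.sec c.1 A.base, ⟨v, hv⟩) : E A.base × tangentAt A) ∈ ETangent A := by
    intro f
    have hxt := d.subset hA
    have hf : ContDiffOn ℝ ∞ (fun x ↦ f ((extChartAt 𝓘(ℝ, B) x₀).symm x)) (chartImage B F E x₀) := by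
      have h1 : ContMDiffOn 𝓘(ℝ, B) 𝓘(ℝ, ℝ) ∞ (fun z ↦ f ((extChartAt 𝓘(ℝ, B) x₀).symm z))
          (extChartAt 𝓘(ℝ, B) x₀).target :=
        f.contMDiff.comp_contMDiffOn (contMDiffOn_extChartAt_symm x₀)
      exact h1.contDiffOn.mono fun z hz ↦ mem_target_of_mem_chartImage hz
    have hg1 : ContDiff ℝ ∞ (fun x ↦ d.bump x • f ((extChartAt 𝓘(ℝ, B) x₀).symm x)) :=
      (contMDiff_cut (isOpen_chartImage x₀) d.contDiff_bump.contMDiff d.tsupport_bump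
        hf.contMDiffOn).contDiff
    have hfx (y : M) (hy : y ∈ d.W) : f y = d.bump (extChartAt 𝓘(ℝ, B) x₀ y) •
        f ((extChartAt 𝓘(ℝ, B) x₀).symm (extChartAt 𝓘(ℝ, B) x₀ y)) := by
      rw [d.bump_eq y hy, one_smul, (extChartAt 𝓘(ℝ, B) x₀).left_inv (d.subset hy).1]
    refine (key (φ := pullbackBase L k f)
      (g' := fun z ↦ d.bump z.1 • f ((extChartAt 𝓘(ℝ, B) x₀).symm z.1))
      ⟨hg1.comp contDiff_fst, fun A' hA' ↦ ?_⟩).trans ?_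
    · rw [d.u_eq hA']
      beta_reduce
      rw [A'.coord_fst]
      exact hfx _ hA'
    · have h1 := ((hg1.differentiable (by simp) ((d.u L k).1 A).1).hasFDerivAt.comp
        ((d.u L k).1 A) hasFDerivAt_fst).fderiv
      have h2 : ((d.u L k).1 A).1 = extChartAt 𝓘(ℝ, B) x₀ A.base := by
        rw [d.u_eq hA, A.coord_fst]
      have h3 := dirDeriv_eq_fderiv (d.mem_chart hA) (hg1.differentiable (by simp) _)
        (f := f) (by filter_upwards [d.isOpen.mem_nhds hA] with y hy using hfx y hy)
        (L.anchor A.base (d.sec c.1 A.base))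
      rw [h3]
      refine (congrArg (fun T : (B × (Fin k → F)) →L[ℝ] ℝ ↦ T w) h1).trans ?_
      rw [h2]
      have h4 := anchorCoord_chartCoord (L := L)
        (e := (⟨A.base, d.sec c.1 A.base⟩ : TotalSpace F E)) (d.subset hA)
      have h5 : chartCoord B F E x₀ (⟨A.base, d.sec c.1 A.base⟩ : TotalSpace F E) =
          (d.X A.base, c.1) :=
        Prod.ext (d.X_eq _ hA).symm ((d.Y_eq ⟨A.base, _⟩ hA).symm.trans (d.Y_sec _ hA _))
      rw [← h4, h5]
      rfl
  refine ⟨⟨_, hz⟩, Prod.ext (d.Y_sec _ hA _) ?_⟩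
  have h6 : vderiv v (d.u L k) = w := by
    refine (vderiv_eq_iff _ _ _).mpr fun ℓ ↦ ?_
    have h7 : d.Rep L k (smoothMap.comp ℓ (d.u L k)) (LinearMap.toContinuousLinearMap ℓ) :=
      ⟨(LinearMap.toContinuousLinearMap ℓ).contDiff, fun _ _ ↦ rfl⟩
    refine (key h7).trans ?_
    rw [ContinuousLinearMap.fderiv]
    rfl
  exact (Prod.ext_iff.mp h6).2

open Classical in
variable (d) in
/-- The element of `𝒯^E E^k` with given components in the local frame. -/
def ofComp (A : L.EJet k) : (F × (Fin k → F)) →ₗ[ℝ] ETangent A :=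
  if h : A.base ∈ d.W then
    (LinearEquiv.ofBijective (d.comp A) ⟨comp_injective h, comp_surjective h⟩).symm.toLinearMap
  else 0

lemma comp_ofComp {A : L.EJet k} (hA : A.base ∈ d.W) (c : F × (Fin k → F)) :
    d.comp A (d.ofComp A c) = c := by
  rw [ofComp, dif_pos hA]
  exact (LinearEquiv.ofBijective (d.comp A) ⟨comp_injective hA, comp_surjective hA⟩).apply_symm_apply c

lemma ofComp_comp {A : L.EJet k} (hA : A.base ∈ d.W) (z : ETangent A) :
    d.ofComp A (d.comp A z) = z := comp_injective hA (comp_ofComp hA _)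

lemma fib_ofComp {A : L.EJet k} (hA : A.base ∈ d.W) (c : F × (Fin k → F)) :
    fib (d.ofComp A c) = d.sec c.1 A.base := by
  refine d.Y_injective hA ?_
  rw [d.Y_sec _ hA]
  exact congrArg Prod.fst (comp_ofComp hA c)

end LocalData

/-! ### Leibniz rules for families of multilinear forms. -/

section Multilinear

variable {R : Type*} [NormedAddCommGroup R] [NormedSpace ℝ R] [FiniteDimensional ℝ R]

variable (L k) in
/-- A constant vector-valued function. -/
def constMap (c : R) : smoothMap L k R := ⟨fun _ ↦ c, fun ℓ ↦ (L.smoothFun k).algebraMap_mem (ℓ c)⟩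

lemma vderiv_constMap {A : L.EJet k} (v : tangentAt A) (c : R) : vderiv v.1 (constMap L k c) = 0 :=
  (vderiv_eq_iff _ _ _).mpr fun ℓ ↦ by
    rw [map_zero]
    exact tangent_algebraMap v (ℓ c)

lemma linearFamily_eq {N : L.EJet k → R →ₗ[ℝ] ℝ} (h : smoothMap L k R) :
    (fun A ↦ N A (h.1 A)) = ∑ j, (smoothMap.comp ((Module.finBasis ℝ R).coord j) h).1 *
      fun A ↦ N A (Module.finBasis ℝ R j) := by
  funext A
  rw [Finset.sum_apply]
  conv_lhs => rw [← (Module.finBasis ℝ R).sum_repr (h.1 A), map_sum]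
  exact Finset.sum_congr rfl fun j _ ↦ map_smul _ _ _

lemma linearFamily_mem {N : L.EJet k → R →ₗ[ℝ] ℝ}
    (hN : ∀ c, (fun A ↦ N A c) ∈ L.smoothFun k) (h : smoothMap L k R) :
    (fun A ↦ N A (h.1 A)) ∈ L.smoothFun k := by
  rw [linearFamily_eq h]
  exact (L.smoothFun k).sum_mem fun j _ ↦ (L.smoothFun k).mul_mem (Subtype.property _) (hN _)

/-- After expansion of `h` in a basis this is the product rule. The terms that differentiate the
family recombine into one, as the case of the constant map with value `h A` shows. -/
lemma linearFamily_leibniz {N : L.EJet k → R →ₗ[ℝ] ℝ}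
    (hN : ∀ c, (fun A ↦ N A c) ∈ L.smoothFun k) (h : smoothMap L k R) {A : L.EJet k}
    (v : tangentAt A) :
    v.1 ⟨_, linearFamily_mem hN h⟩ = v.1 ⟨_, hN (h.1 A)⟩ + N A (vderiv v.1 h) := by
  set b := Module.finBasis ℝ R
  have key (h : smoothMap L k R) : v.1 ⟨_, linearFamily_mem hN h⟩ =
      ∑ j, ((b.coord j (h.1 A)) * v.1 ⟨_, hN (b j)⟩ + N A (b j) * b.coord j (vderiv v.1 h)) := by
    have h1 : (⟨_, linearFamily_mem hN h⟩ : L.smoothFun k) =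
        ∑ j, smoothMap.comp (b.coord j) h * ⟨_, hN (b j)⟩ := by
      refine Subtype.ext ((linearFamily_eq h).trans ?_)
      rw [AddSubmonoidClass.coe_finsetSum]
      rfl
    rw [h1, map_sum]
    refine Finset.sum_congr rfl fun j _ ↦ ?_
    rw [v.2, map_vderiv]
    rfl
  have h2 := key (constMap L k (h.1 A))
  rw [vderiv_constMap] at h2
  simp only [map_zero, mul_zero, add_zero] at h2
  have h3 : v.1 ⟨_, hN (h.1 A)⟩ = _ := h2
  rw [h3, key h, Finset.sum_add_distrib]
  congr 1
  conv_rhs => rw [← b.sum_repr (vderiv v.1 h), map_sum]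
  exact Finset.sum_congr rfl fun j _ ↦ (mul_comm _ _).trans (map_smul (N A) _ _).symm

variable {p : ℕ}

/-- Constant arguments are replaced by smooth functions one at a time, each replacement being an
instance of the linear case. -/
lemma multilinearFamily_mem_aux {M : L.EJet k → MultilinearMap ℝ (fun _ : Fin p ↦ R) ℝ}
    (hM : ∀ c, (fun A ↦ M A c) ∈ L.smoothFun k) (h : Fin p → smoothMap L k R) (s : Finset (Fin p))
    (c : Fin p → R) : (fun A ↦ M A fun i ↦ if i ∈ s then (h i).1 A else c i) ∈ L.smoothFun k := by
  induction s using Finset.induction_on generalizing c with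
  | empty => simpa using hM c
  | insert l s hl ih =>
    have h1 := linearFamily_mem (N := fun A ↦ (M A).toLinearMap
      (fun i ↦ if i ∈ s then (h i).1 A else c i) l) (fun x ↦ ?_) (h l)
    · refine (congrArg (· ∈ L.smoothFun k) (funext fun A ↦ congrArg (M A) (funext fun i ↦ ?_))).mp h1
      by_cases hi : i = l
      · subst hi; simp
      · simp [hi]
    · refine (congrArg (· ∈ L.smoothFun k) (funext fun A ↦ congrArg (M A) (funext fun i ↦ ?_))).mp
        (ih (Function.update c l x))
      by_cases hi : i = l
      · subst hi; simp [hl]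
      · simp [hi]

lemma multilinearFamily_mem {M : L.EJet k → MultilinearMap ℝ (fun _ : Fin p ↦ R) ℝ}
    (hM : ∀ c, (fun A ↦ M A c) ∈ L.smoothFun k) (h : Fin p → smoothMap L k R) :
    (fun A ↦ M A fun i ↦ (h i).1 A) ∈ L.smoothFun k := by
  simpa using multilinearFamily_mem_aux hM h Finset.univ 0

/-- The Leibniz rule for a multilinear expression. -/
lemma multilinearFamily_leibniz {M : L.EJet k → MultilinearMap ℝ (fun _ : Fin p ↦ R) ℝ}
    (hM : ∀ c, (fun A ↦ M A c) ∈ L.smoothFun k) (h : Fin p → smoothMap L k R) {A : L.EJet k}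
    (v : tangentAt A) : v.1 ⟨_, multilinearFamily_mem hM h⟩ =
      v.1 ⟨_, hM fun i ↦ (h i).1 A⟩ +
        ∑ l, M A (Function.update (fun i ↦ (h i).1 A) l (vderiv v.1 (h l))) := by
  have key (s : Finset (Fin p)) :
      v.1 ⟨_, multilinearFamily_mem_aux hM h s fun i ↦ (h i).1 A⟩ = v.1 ⟨_, hM fun i ↦ (h i).1 A⟩ +
        ∑ l ∈ s, M A (Function.update (fun i ↦ (h i).1 A) l (vderiv v.1 (h l))) := by
    induction s using Finset.induction_on with
    | empty => simp
    | insert l s hl ih =>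
      rw [Finset.sum_insert hl, add_left_comm, ← ih, add_comm]
      have hN (x : R) : (fun A' ↦ (M A').toLinearMap
          (fun i ↦ if i ∈ s then (h i).1 A' else (h i).1 A) l x) ∈ L.smoothFun k := by
        refine (congrArg (· ∈ L.smoothFun k) (funext fun A' ↦ congrArg (M A')
          (funext fun i ↦ ?_))).mp
          (multilinearFamily_mem_aux hM h s (Function.update (fun i ↦ (h i).1 A) l x))
        by_cases hi : i = l
        · subst hi; simp [hl]
        · simp [hi]
      refine Eq.trans (congrArg v.1 (Subtype.ext (funext fun A' ↦ congrArg (M A')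
        (funext fun i ↦ ?_)))) ((linearFamily_leibniz hN (h l) v).trans (congrArg₂ (· + ·)
          (congrArg v.1 (Subtype.ext (funext fun A' ↦ congrArg (M A') (funext fun i ↦ ?_))))
          (congrArg (M A) (funext fun i ↦ ?_))))
      · by_cases hi : i = l
        · subst hi; simp
        · simp [hi]
      · by_cases hi : i = l
        · subst hi; simp [hl]
        · simp [hi]
      · by_cases hi : i = l
        · subst hi; simp
        · simp [hi]
  refine Eq.trans (congrArg v.1 (Subtype.ext (funext fun A' ↦ ?_))) (key Finset.univ)
  simp

end Multilinear

/-! ### The local frame of `𝒯^E E^k`. -/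

namespace LocalData

variable {x₀ : M} (d : LocalData B F E x₀)

lemma contDiff_dir (c : F × (Fin k → F)) : ContDiff ℝ ∞ (fun z : B × (Fin k → F) ↦
    (d.bump z.1 • L.anchorCoord x₀ (z.1, c.1), c.2)) := by
  refine ContDiff.prodMk ?_ contDiff_const
  refine contDiff_cut_fst (isOpen_chartImage x₀) d.contDiff_bump d.tsupport_bump ?_
  exact (contDiffOn_anchorCoord x₀).comp (ContDiff.contDiffOn (by fun_prop)) fun z hz ↦ ⟨hz.1, trivial⟩

variable (L k) in
/-- The local frame of `𝒯^E E^k`, cut off outside a neighbourhood of `x₀`. -/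
def frame (c : F × (Fin k → F)) : L.ESection k where
  toFun A := d.cut A.base • d.ofComp A c
  smooth_vec φ := by
    obtain ⟨g, hg⟩ := d.exists_rep φ
    have hG : ContDiff ℝ ∞ (fun z ↦ fderiv ℝ g z
        (d.bump z.1 • L.anchorCoord x₀ (z.1, c.1), c.2)) :=
      (hg.1.fderiv_right (m := ∞) (by simp)).clm_apply (d.contDiff_dir c)
    -- Over `W` the function is the cut-off times a smooth function of `u`; off the support of the
    -- cut-off it is zero.
    refine isSmooth_of_locally fun x ↦ ?_
    by_cases hx : x ∈ d.W
    · refine ⟨pullbackBase L k d.cut * smoothMap.fn (d.u L k) hG, d.W, d.isOpen.mem_nhds hx,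
        fun A hA ↦ ?_⟩
      refine congrArg (d.cut A.base * ·) ((hg.vec_eq hA _).trans ?_)
      rw [comp_ofComp hA]
      change _ = fderiv ℝ g ((d.u L k).1 A)
        (d.bump ((d.u L k).1 A).1 • L.anchorCoord x₀ (((d.u L k).1 A).1, c.1), c.2)
      have h1 : ((d.u L k).1 A).1 = d.X A.base := by rw [d.u_apply]
      rw [h1, d.X_eq _ hA, d.bump_eq _ hA, one_smul]
    · refine ⟨0, (tsupport d.cut)ᶜ, (isClosed_tsupport _).isOpen_compl.mem_nhds fun h ↦
        hx (d.tsupport_cut h), fun A hA ↦ ?_⟩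
      have h0 : d.cut A.base = 0 := image_eq_zero_of_notMem_tsupport hA
      exact (congrArg (· * (vec (d.ofComp A c)).1 φ) h0).trans (zero_mul _)
  smooth_fib f := by
    have hs : ContMDiff 𝓘(ℝ, B) (𝓘(ℝ, B).prod 𝓘(ℝ, F)) ∞
        (fun x ↦ (⟨x, d.cut x • d.sec c.1 x⟩ : TotalSpace F E)) :=
      d.cut.contMDiff.smul_section (d.sec c.1).contMDiff
    refine (congrArg (· ∈ L.smoothFun k) (funext fun A ↦ ?_)).mp
      (pullbackBase L k ⟨fun x ↦ f ⟨x, d.cut x • d.sec c.1 x⟩, f.contMDiff.comp hs⟩).2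
    refine congrArg f (congrArg (TotalSpace.mk A.base) ?_)
    by_cases hA : A.base ∈ d.W
    · exact congrArg (d.cut A.base • ·) (fib_ofComp hA c).symm
    · have h0 := d.cut_eq_zero hA
      have e1 : d.cut A.base • d.sec c.1 A.base = 0 := by rw [h0, zero_smul]
      have e2 : d.cut A.base • fib (d.ofComp A c) = 0 := by rw [h0, zero_smul]
      exact e1.trans e2.symm

/-- The section of `E` below an element of the local frame. -/
def cutSec (c : F) : Sec B F E := ⟨fun x ↦ d.cut x • d.sec c x,
  d.cut.contMDiff.smul_section (d.sec c).contMDiff⟩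

lemma frame_projectsTo (c : F × (Fin k → F)) : (d.frame L k c).ProjectsTo (d.cutSec c.1) := by
  intro A
  by_cases hA : A.base ∈ d.W
  · exact congrArg (d.cut A.base • ·) (fib_ofComp hA c)
  · have h0 := d.cut_eq_zero hA
    have e1 : d.cut A.base • d.sec c.1 A.base = 0 := by rw [h0, zero_smul]
    have e2 : d.cut A.base • fib (d.ofComp A c) = 0 := by rw [h0, zero_smul]
    exact e2.trans e1.symm

/-- The value of the local frame as a linear map. -/
def frameAt (A : L.EJet k) : (F × (Fin k → F)) →ₗ[ℝ] ETangent A := d.cut A.base • d.ofComp A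

lemma frameAt_eq {A : L.EJet k} (hA : A.base ∈ d.core) : d.frameAt A = d.ofComp A := by
  rw [frameAt, d.cut_core hA, one_smul]

lemma frameAt_comp {A : L.EJet k} (hA : A.base ∈ d.core) (z : ETangent A) :
    d.frameAt A (d.comp A z) = z := by
  rw [d.frameAt_eq hA, ofComp_comp (d.core_subset hA)]

lemma comp_frameAt {A : L.EJet k} (hA : A.base ∈ d.core) (c : F × (Fin k → F)) :
    d.comp A (d.frameAt A c) = c := by
  rw [d.frameAt_eq hA, comp_ofComp (d.core_subset hA)]

/-- The components of a smooth section in the local frame. -/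
def compMap (Z : L.ESection k) : smoothMap L k (F × (Fin k → F)) :=
  ⟨fun A ↦ d.comp A (Z.toFun A), fun ℓ ↦ by
    have h1 := Z.smooth_fib (dualTotFun d.contMDiff_Y (ℓ ∘ₗ LinearMap.inl ℝ F (Fin k → F)))
    have h2 := Z.smooth_vec (smoothMap.comp
      (ℓ ∘ₗ LinearMap.inr ℝ F (Fin k → F) ∘ₗ LinearMap.snd ℝ B (Fin k → F)) (d.u L k))
    refine (congrArg (· ∈ L.smoothFun k) (funext fun A ↦ ?_)).mp ((L.smoothFun k).add_mem h1 h2)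
    have h3 := map_vderiv (vec (Z.toFun A)).1 (d.u L k)
      (ℓ ∘ₗ LinearMap.inr ℝ F (Fin k → F) ∘ₗ LinearMap.snd ℝ B (Fin k → F))
    refine (congrArg (_ + ·) h3.symm).trans ?_
    refine (map_add ℓ _ _).symm.trans (congrArg ℓ ?_)
    refine Prod.ext (add_zero _) (zero_add _)⟩

lemma frameAt_compMap (Z : L.ESection k) {A : L.EJet k} (hA : A.base ∈ d.core) :
    d.frameAt A ((d.compMap Z).1 A) = Z.toFun A := d.frameAt_comp hA _

end LocalData

/-! ### Locality of the bracket -/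

lemma sec_sum_apply {ι : Type*} (s : Finset ι) (ζ : ι → Sec B F E) (x : M) :
    (∑ j ∈ s, ζ j) x = ∑ j ∈ s, ζ j x := by
  classical
  induction s using Finset.induction_on with
  | empty => rfl
  | insert j s hj ih =>
    rw [Finset.sum_insert hj, Finset.sum_insert hj, ContMDiffSection.coe_add, Pi.add_apply, ih]

lemma bracket_skew (σ τ : Sec B F E) : L.bracket σ τ = -L.bracket τ σ := by
  have h := L.bracket_self (σ + τ)
  simp only [map_add, LinearMap.add_apply, L.bracket_self, zero_add, add_zero] at h
  exact eq_neg_of_add_eq_zero_right h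

/-- If `χ` is supported in `W` and equals `1` near `x`, then `χ τ = 0` everywhere. The Leibniz rule
at `x`, where also `τ x = 0`, reduces this to `[σ, τ] x = 0`. -/
lemma bracket_eq_zero {σ τ : Sec B F E} {x : M} {W : Set M} (hW : W ∈ 𝓝 x)
    (h : ∀ y ∈ W, τ y = 0) : L.bracket σ τ x = 0 := by
  obtain ⟨χ, hχ, hχ1⟩ := exists_bump (B := B) hW
  have h0 : ∀ y, (0 : Sec B F E) y = χ y • τ y := by
    intro y
    by_cases hy : y ∈ W
    · rw [h y hy, smul_zero]; rfl
    · rw [image_eq_zero_of_notMem_tsupport fun hh ↦ hy (hχ hh), zero_smul]; rfl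
  have h1 := L.leibniz σ τ 0 χ h0 x
  rw [hχ1.self_of_nhds, h x (mem_of_mem_nhds hW), smul_zero, add_zero, one_smul, map_zero] at h1
  exact h1.symm

lemma bracket_congr {σ τ τ' : Sec B F E} {x : M} {W : Set M} (hW : W ∈ 𝓝 x)
    (h : ∀ y ∈ W, τ y = τ' y) : L.bracket σ τ x = L.bracket σ τ' x := by
  have h1 := bracket_eq_zero (L := L) (σ := σ) (τ := τ - τ') hW
    fun y hy ↦ by rw [ContMDiffSection.coe_sub, Pi.sub_apply, h y hy, sub_self]
  rw [map_sub, ContMDiffSection.coe_sub, Pi.sub_apply] at h1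
  exact sub_eq_zero.mp h1

lemma bracket_congr_left {σ σ' τ : Sec B F E} {x : M} {W : Set M} (hW : W ∈ 𝓝 x)
    (h : ∀ y ∈ W, σ y = σ' y) : L.bracket σ τ x = L.bracket σ' τ x := by
  rw [bracket_skew σ τ, bracket_skew σ' τ, ContMDiffSection.coe_neg, ContMDiffSection.coe_neg,
    Pi.neg_apply, Pi.neg_apply, bracket_congr hW h]

/-! ### The Lie derivative along `η` in a local frame. -/

namespace LocalData

variable {x₀ : M} (d : LocalData B F E x₀)

lemma contMDiff_Y_sec (σ : Sec B F E) : ContMDiff 𝓘(ℝ, B) 𝓘(ℝ, F) ∞ (fun x ↦ d.Y x (σ x)) :=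
  d.contMDiff_Y.comp σ.contMDiff

/-- A component of a section of `E` in the local frame. -/
def secComp (σ : Sec B F E) (ℓ : F →ₗ[ℝ] ℝ) : BaseFun B M :=
  ⟨fun x ↦ ℓ (d.Y x (σ x)),
    (LinearMap.toContinuousLinearMap ℓ).contDiff.contMDiff.comp (d.contMDiff_Y_sec σ)⟩

/-- The bracket with a section, in terms of the components of the section. -/
lemma Y_bracket {x : M} (hx : x ∈ d.W) (σ τ : Sec B F E) (ℓ : F →ₗ[ℝ] ℝ) :
    ℓ (d.Y x (L.bracket σ τ x)) = ℓ (d.Y x (L.bracket σ (d.sec (d.Y x (τ x))) x)) +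
      dirDeriv (d.secComp τ ℓ) x (L.anchor x (σ x)) := by
  set b := Module.finBasis ℝ F with hb
  have hm (j) : ∃ ζ : Sec B F E, ∀ y, ζ y = d.secComp τ (b.coord j) y • d.sec (b j) y :=
    ⟨⟨fun y ↦ d.secComp τ (b.coord j) y • d.sec (b j) y,
      (d.secComp τ (b.coord j)).contMDiff.smul_section (d.sec (b j)).contMDiff⟩, fun _ ↦ rfl⟩
  choose ζ hζ using hm
  -- Near `x` the section `τ` is the combination of frame sections with its components as
  -- coefficients, so locality and the Leibniz rule apply.
  have h1 : L.bracket σ τ x = L.bracket σ (∑ j, ζ j) x := by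
    refine bracket_congr (d.isOpen.mem_nhds hx) fun y hy ↦ ?_
    conv_lhs => rw [← d.sec_Y y hy (τ y), ← b.sum_repr (d.Y y (τ y)), map_sum]
    rw [sec_sum_apply, sec_sum_apply]
    refine Finset.sum_congr rfl fun j _ ↦ ?_
    rw [hζ, map_smul]
    rfl
  have h2 : d.sec (d.Y x (τ x)) = ∑ j, d.secComp τ (b.coord j) x • d.sec (b j) := by
    conv_lhs => rw [← b.sum_repr (d.Y x (τ x)), map_sum]
    exact Finset.sum_congr rfl fun j _ ↦ map_smul _ _ _
  have h3 : (dirDeriv (d.secComp τ ℓ) x (L.anchor x (σ x)) : ℝ) =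
      ∑ j, dirDeriv (d.secComp τ (b.coord j)) x (L.anchor x (σ x)) * ℓ (b j) := by
    have e1 : (d.secComp τ ℓ : M → ℝ) = fun y ↦ ∑ j, ℓ (b j) * d.secComp τ (b.coord j) y := by
      funext y
      change ℓ (d.Y y (τ y)) = _
      conv_lhs => rw [← b.sum_repr (d.Y y (τ y)), map_sum]
      exact Finset.sum_congr rfl fun j _ ↦ (map_smul ℓ _ _).trans (mul_comm _ _)
    have e2 : HasMFDerivAt 𝓘(ℝ, B) 𝓘(ℝ, ℝ) (fun y ↦ ∑ j, ℓ (b j) * d.secComp τ (b.coord j) y) x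
        (∑ j, ℓ (b j) • (mfderiv 𝓘(ℝ, B) 𝓘(ℝ, ℝ) (d.secComp τ (b.coord j)) x :
          TangentSpace 𝓘(ℝ, B) x →L[ℝ] ℝ)) := by
      have e3 := HasMFDerivAt.sum (I := 𝓘(ℝ, B)) (z := x) (t := Finset.univ)
        (f := fun j y ↦ ℓ (b j) * d.secComp τ (b.coord j) y)
        (f' := fun j ↦ ℓ (b j) • (mfderiv 𝓘(ℝ, B) 𝓘(ℝ, ℝ) (d.secComp τ (b.coord j)) x :
          TangentSpace 𝓘(ℝ, B) x →L[ℝ] ℝ)) fun j _ ↦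
          (((d.secComp τ (b.coord j)).contMDiff.mdifferentiable (by simp) x).hasMFDerivAt).const_smul
            (ℓ (b j))
      refine e3.congr_of_eventuallyEq (Filter.Eventually.of_forall fun y ↦ ?_)
      simp
    unfold dirDeriv
    rw [e1, e2.mfderiv]
    refine (_root_.sum_apply _ _ _).trans ?_
    exact Finset.sum_congr rfl fun j _ ↦ mul_comm _ _
  rw [h1, h2, h3, map_sum, map_sum, sec_sum_apply, sec_sum_apply, map_sum, map_sum, map_sum, map_sum, ← Finset.sum_add_distrib]
  refine Finset.sum_congr rfl fun j _ ↦ ?_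
  rw [L.leibniz σ _ _ _ (hζ j) x, map_smul, map_add, map_add, map_smul, map_smul, map_smul, map_smul,
    d.Y_sec x hx, ContMDiffSection.coe_smul, Pi.smul_apply, map_smul, map_smul]
  rfl

variable (L) in
/-- The Lie derivative along `η` of the local coframe: the matrix of `β ↦ -[η, β]` on the local
frame. -/
def lieOp (η : Sec B F E) (x : M) : F →L[ℝ] F :=
  LinearMap.toContinuousLinearMap
    { toFun c := -d.Y x (L.bracket η (d.sec c) x)
      map_add' c c' := by simp [add_comm]
      map_smul' r c := by simp }

lemma lieOp_apply (η : Sec B F E) (x : M) (c : F) :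
    d.lieOp L η x c = -d.Y x (L.bracket η (d.sec c) x) := rfl

lemma contMDiff_lieOp (η : Sec B F E) : ContMDiff 𝓘(ℝ, B) 𝓘(ℝ, F →L[ℝ] F) ∞ (d.lieOp L η) := by
  set b := Module.finBasis ℝ F with hb
  have h1 : d.lieOp L η = fun x ↦ ∑ j, ContinuousLinearMap.smulRightL ℝ F F
      (LinearMap.toContinuousLinearMap (b.coord j)) (-d.Y x (L.bracket η (d.sec (b j)) x)) := by
    funext x
    ext c
    rw [_root_.sum_apply]
    conv_lhs => rw [← b.sum_repr c, map_sum]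
    exact Finset.sum_congr rfl fun j _ ↦ map_smul _ _ _
  rw [h1]
  refine contMDiff_finsetSum fun j _ ↦ ?_
  have h2 : ContMDiff 𝓘(ℝ, B) 𝓘(ℝ, F) ∞ (fun x ↦ -d.Y x (L.bracket η (d.sec (b j)) x)) :=
    contDiff_neg.contMDiff.comp (d.contMDiff_Y_sec _)
  exact (ContinuousLinearMap.contDiff _).contMDiff.comp h2

variable (L) in
/-- The Lie derivative along `η` of the fibre coordinates, as a function on `E`. -/
def lieY (η : Sec B F E) (e : TotalSpace F E) : F := d.lieOp L η e.proj (d.Y e.proj e.2)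

lemma contMDiff_lieY (η : Sec B F E) :
    ContMDiff (𝓘(ℝ, B).prod 𝓘(ℝ, F)) 𝓘(ℝ, F) ∞ (d.lieY L η) :=
  ((d.contMDiff_lieOp η).comp (Bundle.contMDiff_proj E)).clm_apply d.contMDiff_Y

lemma exists_base_rep {R : Type*} [NormedAddCommGroup R] [NormedSpace ℝ R] {f : M → R}
    (hf : ContMDiff 𝓘(ℝ, B) 𝓘(ℝ, R) ∞ f) :
    ∃ g : B → R, ContDiff ℝ ∞ g ∧ ∀ x ∈ d.W, f x = g (extChartAt 𝓘(ℝ, B) x₀ x) := by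
  refine ⟨fun z ↦ d.bump z • f ((extChartAt 𝓘(ℝ, B) x₀).symm z), ?_, fun x hx ↦ ?_⟩
  · refine (contMDiff_cut (isOpen_chartImage x₀) d.contDiff_bump.contMDiff d.tsupport_bump ?_).contDiff
    exact hf.comp_contMDiffOn ((contMDiffOn_extChartAt_symm x₀).mono
      fun z hz ↦ mem_target_of_mem_chartImage hz)
  · beta_reduce
    rw [d.bump_eq x hx, one_smul, (extChartAt 𝓘(ℝ, B) x₀).left_inv (d.subset hx).1]

variable (L) in
/-- The anchor in coordinates, extended to the whole model space. -/
def R (z : B × F) : B := d.bump z.1 • L.anchorCoord x₀ z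

lemma contDiff_R : ContDiff ℝ ∞ (d.R L) :=
  contDiff_cut_fst (isOpen_chartImage x₀) d.contDiff_bump d.tsupport_bump (contDiffOn_anchorCoord x₀)

lemma R_eq {x : M} (hx : x ∈ d.W) (y : F) :
    d.R L (extChartAt 𝓘(ℝ, B) x₀ x, y) = L.anchorCoord x₀ (extChartAt 𝓘(ℝ, B) x₀ x, y) := by
  rw [R, d.bump_eq x hx, one_smul]

/-- The anchor of a vector of `E`, in coordinates. -/
lemma R_Y {x : M} (hx : x ∈ d.W) (b : E x) : d.R L (extChartAt 𝓘(ℝ, B) x₀ x, d.Y x b) =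
    mfderiv 𝓘(ℝ, B) 𝓘(ℝ, B) (extChartAt 𝓘(ℝ, B) x₀) x (L.anchor x b) := by
  rw [d.R_eq hx]
  have h1 := anchorCoord_chartCoord (L := L) (e := (⟨x, b⟩ : TotalSpace F E)) (d.subset hx)
  have h2 : chartCoord B F E x₀ (⟨x, b⟩ : TotalSpace F E) = (extChartAt 𝓘(ℝ, B) x₀ x, d.Y x b) :=
    Prod.ext rfl (d.Y_eq ⟨x, b⟩ hx).symm
  rw [← h2, h1]

lemma dirDeriv_rep {x : M} (hx : x ∈ d.W) {f : M → ℝ} {g : B → ℝ} (hg : ContDiff ℝ ∞ g)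
    (h : ∀ y ∈ d.W, f y = g (extChartAt 𝓘(ℝ, B) x₀ y)) (b : E x) :
    dirDeriv f x (L.anchor x b) = fderiv ℝ g (extChartAt 𝓘(ℝ, B) x₀ x)
      (d.R L (extChartAt 𝓘(ℝ, B) x₀ x, d.Y x b)) := by
  rw [d.R_Y hx]
  exact dirDeriv_eq_fderiv (d.mem_chart hx) (hg.differentiable (by simp) _)
    (by filter_upwards [d.isOpen.mem_nhds hx] with y hy using h y hy) _

lemma R_linear {x : M} (hx : x ∈ d.W) : ∃ T : F →L[ℝ] B, ∀ y,
    d.R L (extChartAt 𝓘(ℝ, B) x₀ x, y) = T y := by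
  let T : F →ₗ[ℝ] B :=
    { toFun y := mfderiv 𝓘(ℝ, B) 𝓘(ℝ, B) (extChartAt 𝓘(ℝ, B) x₀) x (L.anchor x (d.sec y x))
      map_add' y y' := by
        rw [map_add, ContMDiffSection.coe_add, Pi.add_apply, map_add, map_add]; rfl
      map_smul' c y := by
        rw [map_smul, ContMDiffSection.coe_smul, Pi.smul_apply, map_smul, map_smul]; rfl }
  refine ⟨LinearMap.toContinuousLinearMap T, fun y ↦ ?_⟩
  refine Eq.trans ?_ (d.R_Y hx (d.sec y x))
  rw [d.Y_sec x hx]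

/-- The anchor intertwines the infinitesimal flow on `E` and the one on `M`. -/
lemma fderiv_R {η : Sec B F E} {yη : B → F} (hy : ContDiff ℝ ∞ yη)
    (hyη : ∀ x ∈ d.W, d.Y x (η x) = yη (extChartAt 𝓘(ℝ, B) x₀ x)) {x : M} (hx : x ∈ d.W) (c : F) :
    fderiv ℝ (d.R L) (extChartAt 𝓘(ℝ, B) x₀ x, c)
      (d.R L (extChartAt 𝓘(ℝ, B) x₀ x, yη (extChartAt 𝓘(ℝ, B) x₀ x)), d.lieOp L η x c) =
    fderiv ℝ (fun z ↦ d.R L (z, yη z)) (extChartAt 𝓘(ℝ, B) x₀ x)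
      (d.R L (extChartAt 𝓘(ℝ, B) x₀ x, c)) := by
  set z := extChartAt 𝓘(ℝ, B) x₀ x with hz
  refine eq_of_forall_dual fun ℓ ↦ ?_
  let ℓ' := LinearMap.toContinuousLinearMap ℓ
  let f : BaseFun B M := ⟨fun y ↦ ℓ (d.X y), ℓ'.contDiff.contMDiff.comp d.contMDiff_X⟩
  have hf (σ : Sec B F E) (y : M) (hy : y ∈ d.W) : L.anchorDeriv σ f y =
      ℓ (d.R L (extChartAt 𝓘(ℝ, B) x₀ y, d.Y y (σ y))) := by
    rw [L.anchorDeriv_apply]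
    refine (dirDeriv_lin_X hy ℓ _).trans ?_
    rw [d.X_eq y hy, d.R_eq hy]
  have hRd : DifferentiableAt ℝ (d.R L) (z, c) := d.contDiff_R.differentiable (by simp) _
  -- Compatibility of the anchor with the bracket of `η` and the frame section with constant
  -- coordinate `c`, tested on the coordinate function `ℓ ∘ X`.
  have key := L.dirDeriv_anchor_bracket η (d.sec c) f x
  have hrη : ContDiff ℝ ∞ (fun z ↦ ℓ' (d.R L (z, yη z))) :=
    ℓ'.contDiff.comp (d.contDiff_R.comp (contDiff_id.prodMk hy))
  have hrc : ContDiff ℝ ∞ (fun z ↦ ℓ' (d.R L (z, c))) :=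
    ℓ'.contDiff.comp (d.contDiff_R.comp (contDiff_id.prodMk contDiff_const))
  rw [← L.anchorDeriv_apply, hf _ x hx, L.anchorDeriv_apply, L.anchorDeriv_apply,
    d.dirDeriv_rep hx hrc (fun y hy ↦ by rw [hf _ y hy, d.Y_sec y hy]; rfl),
    d.dirDeriv_rep hx hrη (fun y hy ↦ by rw [hf _ y hy, hyη y hy]; rfl), d.Y_sec x hx, hyη x hx] at key
  have hcomp1 : fderiv ℝ (fun z ↦ ℓ' (d.R L (z, c))) z (d.R L (z, yη z)) =
      ℓ (fderiv ℝ (d.R L) (z, c) (d.R L (z, yη z), 0)) := by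
    have := (ℓ'.hasFDerivAt.comp z (hRd.hasFDerivAt.comp z
      ((hasFDerivAt_id z).prodMk (hasFDerivAt_const c z)))).fderiv
    refine (congrArg (fun T : B →L[ℝ] ℝ ↦ T (d.R L (z, yη z))) this).trans ?_
    rfl
  have hrd : DifferentiableAt ℝ (fun z ↦ d.R L (z, yη z)) z :=
    (d.contDiff_R.comp (contDiff_id.prodMk hy)).differentiable (by simp) _
  have hcomp2 : fderiv ℝ (fun z ↦ ℓ' (d.R L (z, yη z))) z (d.R L (z, c)) =
      ℓ (fderiv ℝ (fun z ↦ d.R L (z, yη z)) z (d.R L (z, c))) := by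
    have := (ℓ'.hasFDerivAt.comp z hrd.hasFDerivAt).fderiv
    exact congrArg (fun T : B →L[ℝ] ℝ ↦ T (d.R L (z, c))) this
  obtain ⟨T, hT⟩ := d.R_linear (L := L) hx
  -- `R` is linear on fibres, hence equal to its own vertical derivative; this turns the component
  -- `lieOp` of the direction into `-ρ([η, sec c])`.
  have hvert (w : F) : fderiv ℝ (d.R L) (z, c) (0, w) = T w := by
    have h1 := (hRd.hasFDerivAt.comp c ((hasFDerivAt_const z c).prodMk (hasFDerivAt_id c))).fderiv
    have h2 : (d.R L ∘ fun y ↦ (z, y)) = T := funext fun y ↦ hT y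
    have h3 : fderiv ℝ (d.R L ∘ fun y ↦ (z, y)) c = T := by rw [h2]; exact T.fderiv
    have h4 := h1.symm.trans h3
    exact congrArg (fun T : F →L[ℝ] B ↦ T w) h4
  have hsplit : ((d.R L (z, yη z), d.lieOp L η x c) : B × F) =
      (d.R L (z, yη z), 0) + (0, d.lieOp L η x c) := by simp
  rw [hsplit, map_add, map_add, ← hcomp1, ← hcomp2, hvert, d.lieOp_apply, map_neg, map_neg, ← hT, key]
  ring

end LocalData

/-! ### The components of the complete lift -/

namespace IsLocalFlow

variable {η : Sec B F E} {ε : ℝ} {U : Set M} {φ : ℝ → M → M}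
  {Φ : ℝ → TotalSpace F E → TotalSpace F E}

lemma proj_eq (h : L.IsLocalFlow η ε U φ Φ) {s : ℝ} (hs : s ∈ Ioo (-ε) ε) {e : TotalSpace F E}
    (he : e.proj ∈ U) : (Φ s e).proj = φ s e.proj := by
  obtain ⟨ℓ, hℓ⟩ := h.linear s hs e.proj he
  exact congrArg TotalSpace.proj (hℓ e.2)

lemma zero_mem (h : L.IsLocalFlow η ε U φ Φ) : (0 : ℝ) ∈ Ioo (-ε) ε := by simp [h.pos]

lemma contMDiffAt (h : L.IsLocalFlow η ε U φ Φ) {s : ℝ} (hs : s ∈ Ioo (-ε) ε)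
    {e : TotalSpace F E} (he : e.proj ∈ U) :
    ContMDiffAt (𝓘(ℝ, ℝ).prod (𝓘(ℝ, B).prod 𝓘(ℝ, F))) (𝓘(ℝ, B).prod 𝓘(ℝ, F)) ∞
      (fun q : ℝ × TotalSpace F E ↦ Φ q.1 q.2) (s, e) :=
  h.smooth.contMDiffAt ((isOpen_Ioo.prod (h.isOpen.preimage
    (FiberBundle.continuous_proj F E))).mem_nhds ⟨hs, he⟩)

variable {x₀ : M} (d : LocalData B F E x₀)

/-- The derivative of the fibre coordinates along the flow. -/
lemma hasDerivAt_Y (h : L.IsLocalFlow η ε U φ Φ) {e : TotalSpace F E} (heU : e.proj ∈ U)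
    (heW : e.proj ∈ d.W) :
    HasDerivAt (fun s ↦ d.Y (Φ s e).proj (Φ s e).2) (d.lieY L η e) 0 := by
  obtain ⟨x, b⟩ := e
  set β := d.sec (d.Y x b) with hβ
  have hβx : β x = b := d.sec_Y x heW b
  have h00 : Φ 0 ⟨x, b⟩ = ⟨x, b⟩ := h.zero x heU b
  set ψ : ℝ → M := fun s ↦ (Φ s ⟨x, b⟩).proj with hψ
  have hψ0 : ψ 0 = x := by simp only [hψ, h00]
  have hΦc : ContMDiffAt 𝓘(ℝ, ℝ) (𝓘(ℝ, B).prod 𝓘(ℝ, F)) ∞ (fun s ↦ Φ s ⟨x, b⟩) 0 :=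
    (h.contMDiffAt h.zero_mem heU).comp (0 : ℝ) (contMDiffAt_id.prodMk contMDiffAt_const)
  have hψc : ContMDiffAt 𝓘(ℝ, ℝ) 𝓘(ℝ, B) ∞ ψ 0 := (Bundle.contMDiff_proj E).contMDiffAt.comp _ hΦc
  have hψU : ∀ᶠ s in 𝓝 (0 : ℝ), ψ s ∈ U ∩ d.W := hψc.continuousAt.preimage_mem_nhds
    (by rw [hψ0]; exact (h.isOpen.inter d.isOpen).mem_nhds ⟨heU, heW⟩)
  have hI : ∀ᶠ s in 𝓝 (0 : ℝ), s ∈ Ioo (-ε) ε := isOpen_Ioo.mem_nhds h.zero_mem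
  have hψφ : ∀ s ∈ Ioo (-ε) ε, ψ s = φ s x := fun s hs ↦ h.proj_eq hs heU
  -- `β` is the frame section through `e`, and `ψ` the base curve of the flow. Along `(0, s)` the
  -- function `H` is constant, as `β` has constant coordinates; along `(-s, s)` its derivative is
  -- `[η, β]` by definition of the flow. The direction `(1, 0)` is the difference of these two,
  -- which gives `-[η, β]`, the value of `lieY`.
  let H : ℝ × ℝ → F := fun q ↦ d.Y (Φ q.1 ⟨ψ q.2, β (ψ q.2)⟩).proj (Φ q.1 ⟨ψ q.2, β (ψ q.2)⟩).2
  have hH : DifferentiableAt ℝ H (0, 0) := by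
    have h1 : ContMDiffAt 𝓘(ℝ, ℝ × ℝ) (𝓘(ℝ, ℝ).prod (𝓘(ℝ, B).prod 𝓘(ℝ, F))) ∞
        (fun q : ℝ × ℝ ↦ (q.1, (⟨ψ q.2, β (ψ q.2)⟩ : TotalSpace F E))) (0, 0) := by
      refine contDiff_fst.contMDiff.contMDiffAt.prodMk ?_
      refine (β.contMDiff.contMDiffAt (x := ψ 0)).comp (0, 0) (f := fun q : ℝ × ℝ ↦ ψ q.2) ?_
      have h3 : ContMDiffAt 𝓘(ℝ, ℝ × ℝ) 𝓘(ℝ, ℝ) ∞ (fun q : ℝ × ℝ ↦ q.2) (0, 0) :=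
        contDiff_snd.contMDiff.contMDiffAt
      exact ContMDiffAt.comp (g := ψ) (f := fun q : ℝ × ℝ ↦ q.2) ((0, 0) : ℝ × ℝ) hψc h3
    have h2 : ContMDiffAt 𝓘(ℝ, ℝ × ℝ) 𝓘(ℝ, F) ∞ H (0, 0) :=
      d.contMDiff_Y.contMDiffAt.comp (0, 0) ((h.contMDiffAt h.zero_mem
        (e := ⟨ψ 0, β (ψ 0)⟩) (by rw [hψ0]; exact heU)).comp (0, 0) h1)
    exact h2.contDiffAt.differentiableAt (by simp)
  have e1 : HasDerivAt (fun s ↦ H (s, 0)) (fderiv ℝ H (0, 0) (1, 0)) 0 :=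
    HasFDerivAt.comp_hasDerivAt (l := H) (f := fun s : ℝ ↦ (s, (0 : ℝ))) (0 : ℝ) hH.hasFDerivAt
      ((hasDerivAt_id (0 : ℝ)).prodMk (hasDerivAt_const (0 : ℝ) (0 : ℝ)))
  have e2 : HasDerivAt (fun s ↦ H (0, s)) (fderiv ℝ H (0, 0) (0, 1)) 0 :=
    HasFDerivAt.comp_hasDerivAt (l := H) (f := fun s : ℝ ↦ ((0 : ℝ), s)) (0 : ℝ) hH.hasFDerivAt
      ((hasDerivAt_const (0 : ℝ) (0 : ℝ)).prodMk (hasDerivAt_id (0 : ℝ)))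
  have e3 : HasDerivAt (fun s ↦ H (-s, s)) (fderiv ℝ H (0, 0) (-1, 1)) 0 := by
    refine HasFDerivAt.comp_hasDerivAt (l := H) (f := fun s : ℝ ↦ (-s, s)) (0 : ℝ) ?_
      ((hasDerivAt_id 0).neg.prodMk (hasDerivAt_id 0))
    simpa using hH.hasFDerivAt
  have e2' : fderiv ℝ H (0, 0) (0, 1) = 0 := by
    refine e2.unique ((hasDerivAt_const (0 : ℝ) (d.Y x b)).congr_of_eventuallyEq ?_)
    filter_upwards [hψU] with s hs
    simp only [H]
    rw [h.zero _ hs.1]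
    exact d.Y_sec _ hs.2 _
  have e3' : fderiv ℝ H (0, 0) (-1, 1) = d.Y x (L.bracket η β x) := by
    set t := trivializationAt F E x with ht
    have hx : x ∈ t.baseSet := FiberBundle.mem_baseSet_trivializationAt' x
    -- The flow property is stated in the trivialization at `x`. A fixed linear map converts it to
    -- the coordinate `Y`, since `Φ_{-s}` returns to the fibre over `x` by the group law.
    let T : F →L[ℝ] F := LinearMap.toContinuousLinearMap (d.Y x ∘ₗ t.symmₗ ℝ x)
    have hT (v : E x) : T (t ⟨x, v⟩).2 = d.Y x v := by
      refine congrArg (d.Y x) ?_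
      have := t.symmₗ_linearMapAt (R := ℝ) hx v
      rwa [Trivialization.linearMapAt_apply, if_pos hx] at this
    rw [← hT]
    refine e3.unique (((T.hasFDerivAt.comp_hasDerivAt (0 : ℝ) (h.deriv x heU β))).congr_of_eventuallyEq ?_)
    filter_upwards [hψU, hI] with s hs hsI
    have hsI' : -s ∈ Ioo (-ε) ε := ⟨by linarith [hsI.2], by linarith [hsI.1]⟩
    have hp : (Φ (-s) ⟨φ s x, β (φ s x)⟩).proj = x := by
      rw [h.proj_eq hsI' (by rw [← hψφ s hsI]; exact hs.1)]
      have h4 := h.add (-s) hsI' s hsI (by rw [neg_add_cancel]; exact h.zero_mem) x heU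
        (by rw [← hψφ s hsI]; exact hs.1) b
      rw [neg_add_cancel, h00] at h4
      have h5 := congrArg TotalSpace.proj h4
      rw [h.proj_eq hsI' (by change ψ s ∈ U; exact hs.1)] at h5
      change x = φ (-s) (ψ s) at h5
      rw [← hψφ s hsI]
      exact h5.symm
    have hval (e' : TotalSpace F E) (he' : e'.proj = x) : d.Y e'.proj e'.2 = T (t e').2 := by
      obtain ⟨x', v'⟩ := e'
      subst he'
      exact (hT v').symm
    have hE : (⟨ψ s, β (ψ s)⟩ : TotalSpace F E) = ⟨φ s x, β (φ s x)⟩ := by rw [hψφ s hsI]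
    exact (hval (Φ (-s) ⟨ψ s, β (ψ s)⟩) (by rw [hE]; exact hp)).trans
      (congrArg (fun e ↦ T (t (Φ (-s) e)).2) hE)
  have e4 : fderiv ℝ H (0, 0) (1, 0) = d.lieY L η ⟨x, b⟩ := by
    have h6 : ((1, 0) : ℝ × ℝ) = (0, 1) - (-1, 1) := by simp
    rw [h6, map_sub, e2', e3', zero_sub]
    rfl
  rw [← e4]
  refine e1.congr_of_eventuallyEq (Filter.Eventually.of_forall fun s ↦ ?_)
  have hE : (⟨ψ 0, β (ψ 0)⟩ : TotalSpace F E) = ⟨x, b⟩ := by rw [hψ0, hβx]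
  exact (congrArg (fun e ↦ d.Y (Φ s e).proj (Φ s e).2) hE).symm

end IsLocalFlow

namespace LocalData

variable {x₀ : M} (d : LocalData B F E x₀) {η : Sec B F E}

lemma vjet_trunc {R : Type*} [NormedAddCommGroup R] [NormedSpace ℝ R] [FiniteDimensional ℝ R]
    (A : L.EJet (k + 1)) {h : TotalSpace F E → R}
    (hh : ContMDiff (𝓘(ℝ, B).prod 𝓘(ℝ, F)) 𝓘(ℝ, R) ∞ h) (r : Fin k) :
    A.trunc.vjet h r = A.vjet h r :=
  (A.isJetOf_choose.trunc).vjet_eq hh r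

lemma comp_snd (A : L.EJet k) (z : ETangent A) :
    (d.comp A z).2 = vderiv (vec z).1 (jetMap L k d.contMDiff_Y) := by
  have := vderiv_pair (vec z).1 (baseMap L k d.contMDiff_X) (jetMap L k d.contMDiff_Y)
  exact (Prod.ext_iff.mp this).2

/-- The derivative of the jet coordinates along the prolonged flow. -/
lemma hasDerivAt_jet_flow {A : L.EJet k} {ε : ℝ} {U : Set M} {φ : ℝ → M → M}
    {Φ : ℝ → TotalSpace F E → TotalSpace F E} (hΦ : L.IsLocalFlow η ε U φ Φ) (hU : A.base ∈ U)
    (hA : A.base ∈ d.W) {a : ℝ → TotalSpace F E} (ha : A.IsJetOf a) (r : Fin k) :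
    HasDerivAt (fun s ↦ iteratedDeriv (r : ℕ) (fun t ↦ d.Y (Φ s (a t)).proj (Φ s (a t)).2) 0)
      (A.vjet (d.lieY L η) r) 0 := by
  have ha0 : (a 0).proj ∈ U ∩ d.W := by rw [ha.2.1]; exact ⟨hU, hA⟩
  have hev : ∀ᶠ t in 𝓝 (0 : ℝ), (a t).proj ∈ U ∩ d.W :=
    ha.1.eventually_mem ((hΦ.isOpen.inter d.isOpen).mem_nhds ha0)
  let H : ℝ × ℝ → F := fun q ↦ d.Y (Φ q.1 (a q.2)).proj (Φ q.1 (a q.2)).2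
  have hj := ha.vjet_eq (d.contMDiff_lieY (L := L) η) r
  obtain ⟨O, hO, hO0, hOs, -⟩ := ha.1
  have hH : ∀ᶠ q in 𝓝 ((0, 0) : ℝ × ℝ), ContDiffAt ℝ ∞ H q := by
    have hq : ∀ᶠ q in 𝓝 ((0, 0) : ℝ × ℝ), q.1 ∈ Ioo (-ε) ε ∧ (a q.2).proj ∈ U ∩ d.W ∧ q.2 ∈ O := by
      rw [nhds_prod_eq]
      have h1 : ∀ᶠ s in 𝓝 (0 : ℝ), s ∈ Ioo (-ε) ε := isOpen_Ioo.mem_nhds hΦ.zero_mem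
      exact h1.prod_mk (hev.and (hO.mem_nhds hO0))
    filter_upwards [hq] with q hq
    have h1 : ContMDiffAt 𝓘(ℝ, ℝ × ℝ) (𝓘(ℝ, ℝ).prod (𝓘(ℝ, B).prod 𝓘(ℝ, F))) ∞
        (fun q : ℝ × ℝ ↦ (q.1, a q.2)) q :=
      contDiff_fst.contMDiff.contMDiffAt.prodMk ((hOs.contMDiffAt (hO.mem_nhds hq.2.2)).comp q
        contDiff_snd.contMDiff.contMDiffAt)
    have h2 : ContMDiffAt 𝓘(ℝ, ℝ × ℝ) 𝓘(ℝ, F) ∞ H q :=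
      d.contMDiff_Y.contMDiffAt.comp q ((hΦ.contMDiffAt hq.1 hq.2.1.1).comp q h1)
    exact h2.contDiffAt
  have key := hasDerivAt_iteratedDeriv_swap r hH
  have hlie : (fun t ↦ deriv (fun s ↦ H (s, t)) 0) =ᶠ[𝓝 0] fun t ↦ d.lieY L η (a t) := by
    filter_upwards [hev] with t ht
    exact (hΦ.hasDerivAt_Y d ht.1 ht.2).deriv
  rw [hlie.iteratedDeriv_eq, ← hj] at key
  exact key

/-- The components of the complete lift. -/
lemma comp_of_isCompleteLiftAt {A : L.EJet k} {z : ETangent A} (hz : IsCompleteLiftAt η A z)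
    (hA : A.base ∈ d.W) :
    d.comp A z = (d.Y A.base (η A.base), fun r : Fin k ↦ A.vjet (d.lieY L η) r) := by
  obtain ⟨hf, ε, U, φ, Φ, a, c, hΦ, hU, ha, hc, hv⟩ := hz
  refine Prod.ext (congrArg (d.Y A.base) hf) ?_
  rw [comp_snd]
  funext r
  refine eq_of_forall_dual fun ℓ ↦ ?_
  rw [vderiv_jetMap]
  -- The derivative found below involves only `η` and `A`; hence the independence of the flow, the
  -- curve `a` and the curve `c`.
  refine (hv (jetFun L (dualTotFun d.contMDiff_Y ℓ) r)).unique ?_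
  refine ((LinearMap.toContinuousLinearMap ℓ).hasFDerivAt.comp_hasDerivAt (0 : ℝ)
    (d.hasDerivAt_jet_flow hΦ hU hA ha r)).congr_of_eventuallyEq ?_
  filter_upwards [hc] with s hs
  refine (map_vjet d.contMDiff_Y ℓ r (c s)).symm.trans (congrArg ℓ ?_)
  exact hs.vjet_eq d.contMDiff_Y r

end LocalData

/-! ### Existence of the flow and of the complete lift -/

namespace LocalData

variable {x₀ : M} (d : LocalData B F E x₀)

lemma chartCoord_eq {e : TotalSpace F E} (he : e.proj ∈ d.W) :
    chartCoord B F E x₀ e = (extChartAt 𝓘(ℝ, B) x₀ e.proj, d.Y e.proj e.2) :=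
  Prod.ext rfl (d.Y_eq e he).symm

lemma image_subset : extChartAt 𝓘(ℝ, B) x₀ '' d.W ⊆ chartImage B F E x₀ := image_mono d.subset

lemma symm_mem {z : B} (hz : z ∈ extChartAt 𝓘(ℝ, B) x₀ '' d.W) :
    (extChartAt 𝓘(ℝ, B) x₀).symm z ∈ d.W := by
  obtain ⟨x, hx, rfl⟩ := hz
  rwa [(extChartAt 𝓘(ℝ, B) x₀).left_inv (d.subset hx).1]

lemma symm_right_inv {z : B} (hz : z ∈ extChartAt 𝓘(ℝ, B) x₀ '' d.W) :
    extChartAt 𝓘(ℝ, B) x₀ ((extChartAt 𝓘(ℝ, B) x₀).symm z) = z :=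
  (extChartAt 𝓘(ℝ, B) x₀).right_inv (mem_target_of_mem_chartImage (d.image_subset hz))

lemma symm_left_inv {x : M} (hx : x ∈ d.W) :
    (extChartAt 𝓘(ℝ, B) x₀).symm (extChartAt 𝓘(ℝ, B) x₀ x) = x :=
  (extChartAt 𝓘(ℝ, B) x₀).left_inv (d.subset hx).1

end LocalData

-- In a chart the flow is `(z, y) ↦ (ξ s z, Ψ s z y)`, where `ξ` is the flow of `ρ(η)` and `Ψ`
-- solves the linear equation along it with matrix `lieOp`, that is `-[η, ·]` on the frame.
-- Preservation of admissible curves is the last clause of `exists_linear_flow`, whose infinitesimal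
-- hypothesis is `fderiv_R`.
variable (L) in
lemma exists_isLocalFlow (η : Sec B F E) (x₀ : M) : ∃ (ε : ℝ) (U : Set M) (φ : ℝ → M → M)
    (Φ : ℝ → TotalSpace F E → TotalSpace F E), L.IsLocalFlow η ε U φ Φ ∧ x₀ ∈ U ∧
      ∀ a, L.IsAdmissible a → (a 0).proj ∈ U → ∀ s ∈ Ioo (-ε) ε,
        L.IsAdmissible (fun t ↦ Φ s (a t)) := by
  obtain ⟨d⟩ := exists_localData B F E x₀
  set κ := extChartAt 𝓘(ℝ, B) x₀ with hκ
  set tr := trivializationAt F E x₀ with htr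
  obtain ⟨yη, hyη, hyηe⟩ := d.exists_base_rep (d.contMDiff_Y_sec η)
  obtain ⟨D, hD, hDe⟩ := d.exists_base_rep (d.contMDiff_lieOp (L := L) η)
  have hr : ContDiff ℝ ∞ (fun z ↦ d.R L (z, yη z)) := d.contDiff_R.comp (contDiff_id.prodMk hyη)
  obtain ⟨ε, hε, N, hN, hxN, ξ, Ψ, hξs, hΨs, h0, hO, hder, hgrp, htrans⟩ :=
    exists_linear_flow hr hD (d.isOpen_image.mem_nhds (mem_image_of_mem κ d.mem))
  have htrans' := htrans (d.R L) d.contDiff_R (by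
    rintro z ⟨x, hx, rfl⟩ c
    rw [← hDe x hx]
    exact d.fderiv_R hyη hyηe hx c)
  set U := d.W ∩ κ ⁻¹' N with hUdef
  have hU : IsOpen U := ((continuousOn_extChartAt x₀).mono fun x hx ↦
    (d.subset hx).1).isOpen_inter_preimage d.isOpen hN
  let Γ : ℝ → B × F → B × F := fun s w ↦ (ξ s w.1, Ψ s w.1 w.2)
  let φ : ℝ → M → M := fun s x ↦ κ.symm (ξ s (κ x))
  let Φ : ℝ → TotalSpace F E → TotalSpace F E :=
    fun s e ↦ chartSymm B F E x₀ (Γ s (chartCoord B F E x₀ e))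
  have hI0 : (0 : ℝ) ∈ Ioo (-ε) ε := by simp [hε]
  have hξO {s : ℝ} (hs : s ∈ Ioo (-ε) ε) {x : M} (hx : x ∈ U) : ξ s (κ x) ∈ κ '' d.W :=
    hO s hs _ hx.2
  have hφW {s : ℝ} (hs : s ∈ Ioo (-ε) ε) {x : M} (hx : x ∈ U) : φ s x ∈ d.W :=
    d.symm_mem (hξO hs hx)
  have hκφ {s : ℝ} (hs : s ∈ Ioo (-ε) ε) {x : M} (hx : x ∈ U) : κ (φ s x) = ξ s (κ x) :=
    d.symm_right_inv (hξO hs hx)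
  have hΦc {s : ℝ} (hs : s ∈ Ioo (-ε) ε) {e : TotalSpace F E} (he : e.proj ∈ U) :
      chartCoord B F E x₀ (Φ s e) = Γ s (chartCoord B F E x₀ e) :=
    chartCoord_chartSymm (d.image_subset (hξO hs he))
  have hΦp {s : ℝ} (hs : s ∈ Ioo (-ε) ε) {e : TotalSpace F E} (he : e.proj ∈ U) :
      (Φ s e).proj = φ s e.proj := chartSymm_proj (d.image_subset (hξO hs he))
  have hext {e e' : TotalSpace F E} (he : e.proj ∈ d.W) (he' : e'.proj ∈ d.W)
      (h : chartCoord B F E x₀ e = chartCoord B F E x₀ e') : e = e' := by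
    rw [← chartSymm_chartCoord (d.subset he), h, chartSymm_chartCoord (d.subset he')]
  have hφ0 {x : M} (hx : x ∈ U) : φ 0 x = x := by
    simp only [φ, (h0 _ hx.2).1]
    exact d.symm_left_inv hx.1
  have hφev {x : M} (hx : x ∈ U) : ∀ᶠ s in 𝓝 (0 : ℝ), s ∈ Ioo (-ε) ε ∧ φ s x ∈ U := by
    have h1 : ContinuousAt (fun s ↦ ξ s (κ x)) 0 := (hder 0 hI0 _ hx.2).1.continuousAt
    have h2 : ∀ᶠ s in 𝓝 (0 : ℝ), ξ s (κ x) ∈ N :=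
      h1.preimage_mem_nhds (by rw [(h0 _ hx.2).1]; exact hN.mem_nhds hx.2)
    filter_upwards [isOpen_Ioo.mem_nhds hI0, h2] with s hs hsN
    refine ⟨hs, hφW hs hx, ?_⟩
    rw [mem_preimage, hκφ hs hx]
    exact hsN
  have hΓs : ContDiffOn ℝ ∞ (fun q : ℝ × (B × F) ↦ Γ q.1 q.2) (Ioo (-ε) ε ×ˢ (N ×ˢ univ)) := by
    have e1 : ContDiffOn ℝ ∞ (fun q : ℝ × (B × F) ↦ ξ q.1 q.2.1) (Ioo (-ε) ε ×ˢ (N ×ˢ univ)) :=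
      hξs.comp (f := fun q : ℝ × (B × F) ↦ (q.1, q.2.1)) (ContDiff.contDiffOn (by fun_prop))
        fun q hq ↦ ⟨hq.1, hq.2.1⟩
    have e2 : ContDiffOn ℝ ∞ (fun q : ℝ × (B × F) ↦ Ψ q.1 q.2.1) (Ioo (-ε) ε ×ˢ (N ×ˢ univ)) :=
      hΨs.comp (f := fun q : ℝ × (B × F) ↦ (q.1, q.2.1)) (ContDiff.contDiffOn (by fun_prop))
        fun q hq ↦ ⟨hq.1, hq.2.1⟩
    exact e1.prodMk (e2.clm_apply (ContDiff.contDiffOn (by fun_prop)))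
  have hΓat {s : ℝ} (hs : s ∈ Ioo (-ε) ε) {e : TotalSpace F E} (he : e.proj ∈ U) :
      ContDiffAt ℝ ∞ (fun q : ℝ × (B × F) ↦ Γ q.1 q.2) (s, chartCoord B F E x₀ e) := by
    have h1 : (s, chartCoord B F E x₀ e) ∈ Ioo (-ε) ε ×ˢ (N ×ˢ (univ : Set F)) :=
      ⟨hs, (show κ e.proj ∈ N from he.2), trivial⟩
    exact hΓs.contDiffAt ((isOpen_Ioo.prod (hN.prod isOpen_univ)).mem_nhds h1)
  refine ⟨ε, U, φ, Φ, ?_, ⟨d.mem, hxN⟩, ?_⟩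
  · refine ⟨hε, hU, ?_, ?_, ?_, ?_, ?_, ?_⟩
    · rintro ⟨s, e⟩ ⟨hs, he⟩
      refine ContMDiffAt.contMDiffWithinAt ?_
      have h1 : ContMDiffAt (𝓘(ℝ, ℝ).prod (𝓘(ℝ, B).prod 𝓘(ℝ, F))) 𝓘(ℝ, ℝ × (B × F)) ∞
          (fun q : ℝ × TotalSpace F E ↦ (q.1, chartCoord B F E x₀ q.2)) (s, e) := by
        refine contMDiffAt_fst.prodMk_space ?_
        exact ((contMDiffOn_chartCoord x₀).contMDiffAt (((isOpen_chartDomain x₀).preimage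
          (FiberBundle.continuous_proj F E)).mem_nhds (d.subset he.1))).comp (s, e) contMDiffAt_snd
      have h2 : ContMDiffAt 𝓘(ℝ, ℝ × (B × F)) 𝓘(ℝ, B × F) ∞ (fun q : ℝ × (B × F) ↦ Γ q.1 q.2)
          (s, chartCoord B F E x₀ e) := (hΓat hs he).contMDiffAt
      have h3 := (contMDiffOn_chartSymm (F := F) (E := E) x₀).contMDiffAt
        (((isOpen_chartImage x₀).prod isOpen_univ).mem_nhds
          (show Γ s (chartCoord B F E x₀ e) ∈ _ from ⟨d.image_subset (hξO hs he), trivial⟩))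
      exact ContMDiffAt.comp (g := chartSymm B F E x₀)
        (f := fun q : ℝ × TotalSpace F E ↦ Γ q.1 (chartCoord B F E x₀ q.2)) (s, e) h3
        (h2.comp (s, e) h1)
    · intro s hs x hx
      refine ⟨tr.symmₗ ℝ (φ s x) ∘ₗ (Ψ s (κ x)).toLinearMap ∘ₗ tr.linearMapAt ℝ x, fun b ↦ ?_⟩
      have h1 : tr.linearMapAt ℝ x b = (tr ⟨x, b⟩).2 := by
        rw [Trivialization.linearMapAt_apply, if_pos (d.subset hx.1).2]
      simp only [LinearMap.comp_apply, h1]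
      rw [Trivialization.symmₗ_apply _ (d.subset (hφW hs hx)).2]
      exact (tr.mk_symm (d.subset (hφW hs hx)).2 _).symm
    · intro x hx b
      have h1 : Γ 0 (chartCoord B F E x₀ (⟨x, b⟩ : TotalSpace F E)) = chartCoord B F E x₀ ⟨x, b⟩ := by
        simp only [Γ]
        have h2 := h0 _ hx.2
        change (ξ 0 (κ x), Ψ 0 (κ x) _) = _
        rw [h2.1, h2.2]
        rfl
      simp only [Φ, h1]
      exact chartSymm_chartCoord (d.subset hx.1)
    · intro s hs s' hs' hss x hx hx' b
      have hp : (Φ s' ⟨x, b⟩).proj ∈ U := by rw [hΦp hs' hx]; exact hx'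
      have hg := hgrp s hs s' hs' hss (κ x) hx.2 (by rw [← hκφ hs' hx]; exact hx'.2)
      refine hext ?_ ?_ ?_
      · rw [hΦp hss hx]; exact hφW hss hx
      · rw [hΦp hs hp]; exact hφW hs hp
      · rw [hΦc hss hx, hΦc hs hp, hΦc hs' hx]
        change (ξ (s + s') (κ x), Ψ (s + s') (κ x) _) = (ξ s (ξ s' (κ x)), _)
        rw [hg.1, hg.2]
        rfl
    · intro x hx f
      obtain ⟨g, hg, hge⟩ := d.exists_base_rep f.contMDiff
      rw [d.dirDeriv_rep hx.1 hg hge, hyηe x hx.1]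
      have h1 := (hg.differentiable (by simp) (ξ 0 (κ x))).hasFDerivAt.comp_hasDerivAt (0 : ℝ)
        (hder 0 hI0 _ hx.2).1
      rw [(h0 _ hx.2).1] at h1
      refine h1.congr_of_eventuallyEq ?_
      filter_upwards [hφev hx] with s hs
      rw [hge _ hs.2.1]
      exact congrArg g (hκφ hs.1 hx)
    · intro x hx β
      obtain ⟨yβ, hyβ, hyβe⟩ := d.exists_base_rep (d.contMDiff_Y_sec β)
      set t := trivializationAt F E x with ht
      have hxt : x ∈ t.baseSet := FiberBundle.mem_baseSet_trivializationAt' x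
      let S : F →L[ℝ] F := LinearMap.toContinuousLinearMap
        { toFun y := t.linearMapAt ℝ x (d.sec y x)
          map_add' y y' := by simp
          map_smul' c y := by simp }
      have hS (v : E x) : S (d.Y x v) = (t ⟨x, v⟩).2 := by
        change t.linearMapAt ℝ x (d.sec (d.Y x v) x) = _
        rw [d.sec_Y x hx.1, Trivialization.linearMapAt_apply, if_pos hxt]
      have hval (e : TotalSpace F E) (he : e.proj = x) : (t e).2 = S (d.Y e.proj e.2) := by
        obtain ⟨x', v⟩ := e
        simp only at he
        subst he
        exact (hS v).symm
      set z := κ x with hz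
      have hΨat : HasFDerivAt (fun q : ℝ × B ↦ Ψ q.1 q.2)
          (fderiv ℝ (fun q : ℝ × B ↦ Ψ q.1 q.2) (0, z)) (0, z) :=
        ((hΨs.contDiffAt ((isOpen_Ioo.prod hN).mem_nhds
          (show ((0 : ℝ), z) ∈ Ioo (-ε) ε ×ˢ N from ⟨hI0, hx.2⟩))).differentiableAt
          (by simp)).hasFDerivAt
      set P := fderiv ℝ (fun q : ℝ × B ↦ Ψ q.1 q.2) (0, z) with hP
      have hP1 : P (1, 0) = D z := by
        have h1 : HasDerivAt (fun s ↦ Ψ s z) (P (1, 0)) 0 :=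
          HasFDerivAt.comp_hasDerivAt (l := fun q : ℝ × B ↦ Ψ q.1 q.2) (f := fun s : ℝ ↦ (s, z))
            (0 : ℝ) hΨat ((hasDerivAt_id (0 : ℝ)).prodMk (hasDerivAt_const (0 : ℝ) z))
        have h2 := (hder 0 hI0 z hx.2).2
        rw [(h0 z hx.2).1, (h0 z hx.2).2, ContinuousLinearMap.comp_id] at h2
        exact h1.unique h2
      -- `Ψ 0` is the identity over every point, so moving the base point does not contribute to
      -- first order.
      have hP2 (w : B) : P (0, w) = 0 := by
        have h1 : HasFDerivAt (fun y ↦ Ψ 0 y) (P ∘L ContinuousLinearMap.inr ℝ ℝ B) z := by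
          have := HasFDerivAt.comp (g := fun q : ℝ × B ↦ Ψ q.1 q.2) (f := fun y : B ↦ ((0 : ℝ), y))
            z hΨat ((hasFDerivAt_const (0 : ℝ) z).prodMk (hasFDerivAt_id z))
          exact this
        have h2 : (fun y ↦ Ψ 0 y) =ᶠ[𝓝 z] fun _ ↦ ContinuousLinearMap.id ℝ F := by
          filter_upwards [hN.mem_nhds hx.2] with y hy using (h0 y hy).2
        have h3 := h1.unique ((hasFDerivAt_const _ z).congr_of_eventuallyEq h2)
        have h4 := congrArg (fun T : B →L[ℝ] (F →L[ℝ] F) ↦ T w) h3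
        simpa using h4
      have hξd := (hder 0 hI0 z hx.2).1
      rw [(h0 z hx.2).1] at hξd
      have hm : HasDerivAt (fun s ↦ Ψ (-s) (ξ s z) (yβ (ξ s z)))
          (-(D z (yβ z)) + fderiv ℝ yβ z (d.R L (z, yη z))) 0 := by
        have e1 : HasDerivAt (fun s ↦ Ψ (-s) (ξ s z)) (P (-1, d.R L (z, yη z))) 0 := by
          refine HasFDerivAt.comp_hasDerivAt (l := fun q : ℝ × B ↦ Ψ q.1 q.2)
            (f := fun s : ℝ ↦ (-s, ξ s z)) (0 : ℝ) ?_ ((hasDerivAt_id (0 : ℝ)).neg.prodMk hξd)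
          simpa [(h0 z hx.2).1] using hΨat
        have e2 : P (-1, d.R L (z, yη z)) = -D z := by
          have h5 : ((-1, d.R L (z, yη z)) : ℝ × B) = -(1, 0) + (0, d.R L (z, yη z)) := by simp
          rw [h5, map_add, map_neg, hP1, hP2, add_zero]
        have e3 : HasDerivAt (fun s ↦ yβ (ξ s z)) (fderiv ℝ yβ z (d.R L (z, yη z))) 0 := by
          have h6 := (hyβ.differentiable (by simp) (ξ 0 z)).hasFDerivAt.comp_hasDerivAt (0 : ℝ)
            (hder 0 hI0 z hx.2).1
          rwa [(h0 z hx.2).1] at h6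
        have e4 := e1.clm_apply e3
        rw [e2, neg_zero, (h0 z hx.2).1, (h0 z hx.2).2] at e4
        exact e4
      -- `Y_bracket` in coordinates: the bracket with the frozen frame section plus the derivative
      -- of the components of `β` along `ρ(η)`.
      have hbr : d.Y x (L.bracket η β x) = -(D z (yβ z)) + fderiv ℝ yβ z (d.R L (z, yη z)) := by
        refine eq_of_forall_dual fun ℓ ↦ ?_
        have h7 : ContDiff ℝ ∞ (fun y ↦ ℓ (yβ y)) :=
          (LinearMap.toContinuousLinearMap ℓ).contDiff.comp hyβ
        rw [d.Y_bracket hx.1, d.dirDeriv_rep hx.1 (f := d.secComp β ℓ) h7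
          fun y hy ↦ congrArg ℓ (hyβe y hy), map_add,
          ← hDe x hx.1, ← hyβe x hx.1, d.lieOp_apply, neg_neg, hyηe x hx.1]
        congr 1
        have h8 := ((LinearMap.toContinuousLinearMap ℓ).hasFDerivAt.comp z
          (hyβ.differentiable (by simp) z).hasFDerivAt).fderiv
        exact congrArg (fun T : B →L[ℝ] ℝ ↦ T (d.R L (z, yη z))) h8
      rw [← hS, hbr]
      refine (S.hasFDerivAt.comp_hasDerivAt (0 : ℝ) hm).congr_of_eventuallyEq ?_
      filter_upwards [hφev hx] with s hs
      have hs' : -s ∈ Ioo (-ε) ε := ⟨by linarith [hs.1.2], by linarith [hs.1.1]⟩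
      have hξN : ξ s z ∈ N := by rw [hz, ← hκφ hs.1 hx]; exact hs.2.2
      have hg := hgrp (-s) hs' s hs.1 (by rw [neg_add_cancel]; exact hI0) z hx.2 hξN
      rw [neg_add_cancel, (h0 z hx.2).1] at hg
      have hpr : (Φ (-s) ⟨φ s x, β (φ s x)⟩).proj = x := by
        rw [hΦp hs' hs.2]
        change κ.symm (ξ (-s) (κ (φ s x))) = x
        rw [hκφ hs.1 hx, ← hg.1]
        exact d.symm_left_inv hx.1
      rw [hval _ hpr]
      refine congrArg S ?_
      have h9 := hΦc hs' (e := ⟨φ s x, β (φ s x)⟩) hs.2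
      rw [d.chartCoord_eq (by rw [hpr]; exact hx.1), d.chartCoord_eq hs.2.1] at h9
      refine (congrArg Prod.snd h9).trans ?_
      change Ψ (-s) (κ (φ s x)) (d.Y (φ s x) (β (φ s x))) = _
      rw [hyβe _ hs.2.1]
      change Ψ (-s) (κ (φ s x)) (yβ (κ (φ s x))) = _
      rw [hκφ hs.1 hx]
  · intro a ha ha0 s hs
    have hev := ha.eventually_mem (hU.mem_nhds ha0)
    obtain ⟨O, hOo, hO0, hOs, had⟩ := ha
    refine isAdmissible_chartSymm ?_
    filter_upwards [hev, hOo.mem_nhds hO0] with t ht htO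
    have hat := hOs.contMDiffAt (hOo.mem_nhds htO)
    have hcc := contDiffAt_chartCoord_comp hat (d.subset ht.1)
    have hda := (mfderiv_proj_eq_anchor_iff hat (d.subset ht.1)).mp (had t htO)
    refine ⟨?_, d.image_subset (hξO hs ht), ?_⟩
    · exact (hΓat hs ht).comp t (f := fun t ↦ (s, chartCoord B F E x₀ (a t)))
        (contDiffAt_const.prodMk hcc)
    · have h1 : HasFDerivAt (ξ s) (fderiv ℝ (ξ s) (κ (a t).proj)) (κ (a t).proj) := by
        have h2 := hξs.contDiffAt ((isOpen_Ioo.prod hN).mem_nhds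
          (show (s, κ (a t).proj) ∈ _ from ⟨hs, ht.2⟩))
        exact ((h2.comp (κ (a t).proj) (f := fun y ↦ (s, y)) (by fun_prop)).differentiableAt
          (by simp)).hasFDerivAt
      refine (h1.comp_hasDerivAt t hda).congr_deriv ?_
      have h3 : L.anchorCoord x₀ (chartCoord B F E x₀ (a t)) =
          d.R L (κ (a t).proj, (chartCoord B F E x₀ (a t)).2) := (d.R_eq ht.1 _).symm
      rw [h3, htrans' s hs _ ht.2]
      obtain ⟨x', hx', hxe⟩ := hξO hs ht
      rw [← hxe, d.R_eq hx', hxe]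
      rfl

lemma EJet.IsJetOf.eq {A A' : L.EJet k} {a a' : ℝ → TotalSpace F E} (h : A.IsJetOf a)
    (h' : A'.IsJetOf a') (haa : a =ᶠ[𝓝 0] a') : A = A' := by
  obtain ⟨x, J, hJ⟩ := A
  obtain ⟨x', J', hJ'⟩ := A'
  have h1 : x = x' := by
    have e1 := h.2.1
    have e2 := h'.2.1
    rw [haa.self_of_nhds] at e1
    exact e1.symm.trans e2
  have h2 : J = J' := by
    funext f j
    refine (h.2.2 f j).trans ((Filter.EventuallyEq.iteratedDeriv_eq _ ?_).trans (h'.2.2 f j).symm)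
    filter_upwards [haa] with t ht
    rw [ht]
  subst h1 h2
  rfl

/-- The flow preserves admissibility, so `s ↦ [Φ_s ∘ a]` is a curve in `E^k` through `A`. Its
coordinates are differentiable at `0`, hence so is every smooth function along it, and these
derivatives form a tangent vector. -/
lemma exists_isCompleteLiftAt (η : Sec B F E) (A : L.EJet k) : ∃ z, IsCompleteLiftAt η A z := by
  classical
  obtain ⟨ε, U, φ, Φ, hΦ, hU, hadm⟩ := exists_isLocalFlow L η A.base
  obtain ⟨d⟩ := exists_localData B F E A.base
  set a := A.exists_curve.choose with hadef
  have ha : A.IsJetOf a := A.isJetOf_choose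
  have haU : (a 0).proj ∈ U := by rw [ha.2.1]; exact hU
  let c : ℝ → L.EJet k := fun s ↦ if h : L.IsAdmissible (fun t ↦ Φ s (a t)) then jetOf k h else A
  have hc {s : ℝ} (hs : s ∈ Ioo (-ε) ε) : (c s).IsJetOf (fun t ↦ Φ s (a t)) := by
    simp only [c, dif_pos (hadm a ha.1 haU s hs)]
    exact isJetOf_jetOf _
  have hI : ∀ᶠ s in 𝓝 (0 : ℝ), s ∈ Ioo (-ε) ε := isOpen_Ioo.mem_nhds hΦ.zero_mem
  have hc0 : c 0 = A := by
    refine (hc hΦ.zero_mem).eq ha ?_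
    filter_upwards [ha.1.eventually_mem (hΦ.isOpen.mem_nhds haU)] with t ht
    exact hΦ.zero _ ht _
  have hΦc : ContMDiffAt 𝓘(ℝ, ℝ) (𝓘(ℝ, B).prod 𝓘(ℝ, F)) ∞ (fun s ↦ Φ s (a 0)) 0 :=
    (hΦ.contMDiffAt hΦ.zero_mem haU).comp (0 : ℝ) (contMDiffAt_id.prodMk contMDiffAt_const)
  have hpr : ContMDiffAt 𝓘(ℝ, ℝ) 𝓘(ℝ, B) ∞ (fun s ↦ (Φ s (a 0)).proj) 0 :=
    (Bundle.contMDiff_proj E).contMDiffAt.comp _ hΦc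
  have hX : ContDiffAt ℝ ∞ (fun s ↦ d.X (Φ s (a 0)).proj) 0 :=
    (d.contMDiff_X.contMDiffAt.comp (0 : ℝ) hpr).contDiffAt
  have hbase {s : ℝ} (hs : s ∈ Ioo (-ε) ε) : (c s).base = (Φ s (a 0)).proj := (hc hs).2.1.symm
  have hW : ∀ᶠ s in 𝓝 (0 : ℝ), (c s).base ∈ d.W := by
    have h1 : ∀ᶠ s in 𝓝 (0 : ℝ), (Φ s (a 0)).proj ∈ d.W := hpr.continuousAt.preimage_mem_nhds (by
      rw [← hbase hΦ.zero_mem, hc0]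
      exact d.isOpen.mem_nhds d.mem)
    filter_upwards [h1, hI] with s hs hsI
    rw [hbase hsI]; exact hs
  have hu : HasDerivAt (fun s ↦ (d.u L k).1 (c s)) (deriv (fun s ↦ d.X (Φ s (a 0)).proj) 0,
      fun r : Fin k ↦ A.vjet (d.lieY L η) r) 0 := by
    have h1 := (hX.differentiableAt (by simp)).hasDerivAt.prodMk
      (hasDerivAt_pi.mpr fun r : Fin k ↦ d.hasDerivAt_jet_flow hΦ hU d.mem ha r)
    refine h1.congr_of_eventuallyEq ?_
    filter_upwards [hI] with s hs
    rw [d.u_apply, hbase hs]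
    exact Prod.ext rfl (funext fun r ↦ (hc hs).vjet_eq d.contMDiff_Y r)
  have hd (f : L.smoothFun k) : DifferentiableAt ℝ (fun s ↦ f.1 (c s)) 0 := by
    obtain ⟨g, hg⟩ := d.exists_rep f
    have h1 := ((hg.1.differentiable (by simp) ((d.u L k).1 (c 0))).hasFDerivAt.comp_hasDerivAt
      (0 : ℝ) hu).differentiableAt
    refine h1.congr_of_eventuallyEq ?_
    filter_upwards [hW] with s hs using hg.2 _ hs
  let v : L.smoothFun k →ₗ[ℝ] ℝ :=
    { toFun f := deriv (fun s ↦ f.1 (c s)) 0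
      map_add' f f' := ((hd f).hasDerivAt.add (hd f').hasDerivAt).deriv
      map_smul' r f := ((hd f).hasDerivAt.const_mul r).deriv }
  have hv : v ∈ tangentAt A := by
    intro f f'
    have := ((hd f).hasDerivAt.mul (hd f').hasDerivAt).deriv
    rw [hc0] at this
    refine Eq.trans this ?_
    simp only [v, LinearMap.coe_mk, AddHom.coe_mk]
    ring
  refine ⟨⟨(η A.base, ⟨v, hv⟩), fun f ↦ ?_⟩, rfl, ε, U, φ, Φ, a, c, hΦ, hU, ha, ?_,
    fun f ↦ (hd f).hasDerivAt⟩
  · refine ((hΦ.base_deriv A.base hU f).congr_of_eventuallyEq ?_).deriv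
    filter_upwards [hI] with s hs
    refine congrArg f ((hbase hs).trans ?_)
    rw [hΦ.proj_eq hs haU, ha.2.1]
  · filter_upwards [hI] with s hs using hc hs

lemma completeLift_spec (η : Sec B F E) (A : L.EJet k) :
    IsCompleteLiftAt η A (L.completeLift η k A) := by
  rw [completeLift, dif_pos (exists_isCompleteLiftAt η A)]
  exact (exists_isCompleteLiftAt η A).choose_spec

/-! ### Smoothness of the complete lift. -/

namespace LocalData

variable {x₀ : M} (d : LocalData B F E x₀)

lemma comp_completeLift (η : Sec B F E) {A : L.EJet k} (hA : A.base ∈ d.W) :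
    d.comp A (L.completeLift η k A) =
      (d.Y A.base (η A.base), fun r : Fin k ↦ A.vjet (d.lieY L η) r) :=
  d.comp_of_isCompleteLiftAt (completeLift_spec η A) hA

/-- The derivative of a function along a vector with given components. -/
def vecFrameAt (φ : L.smoothFun k) (A : L.EJet k) : (F × (Fin k → F)) →ₗ[ℝ] ℝ where
  toFun c := (vec (d.frameAt A c)).1 φ
  map_add' c c' := by rw [map_add]; rfl
  map_smul' r c := by rw [map_smul]; rfl

lemma vecFrameAt_mem (φ : L.smoothFun k) (c : F × (Fin k → F)) :
    (fun A ↦ d.vecFrameAt φ A c) ∈ L.smoothFun k := (d.frame L k c).smooth_vec φ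

end LocalData

/-- For fixed `φ`, the derivative of `φ` is linear in the frame components with smooth coefficients,
so smooth components suffice. -/
lemma vec_mem_of_comp {z : ∀ A : L.EJet k, ETangent A} (h : ∀ x₀ : M, ∃ (d : LocalData B F E x₀)
    (c : smoothMap L k (F × (Fin k → F))), ∀ A : L.EJet k, A.base ∈ d.W → d.comp A (z A) = c.1 A)
    (φ : L.smoothFun k) : (fun A ↦ (vec (z A)).1 φ) ∈ L.smoothFun k := by
  refine isSmooth_of_locally fun x₀ ↦ ?_
  obtain ⟨d, c, hc⟩ := h x₀
  refine ⟨⟨_, linearFamily_mem (d.vecFrameAt_mem φ) c⟩, d.core, d.core_mem_nhds, fun A hA ↦ ?_⟩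
  have h1 : d.frameAt A (c.1 A) = z A := by rw [← hc A (d.core_subset hA), d.frameAt_comp hA]
  exact (congrArg (fun w : ETangent A ↦ (vec w).1 φ) h1).symm

variable (L k) in
/-- The complete lift as a smooth section. -/
def liftSection (η : Sec B F E) : L.ESection k where
  toFun := L.completeLift η k
  smooth_vec φ := vec_mem_of_comp (fun x₀ ↦ by
    obtain ⟨d⟩ := exists_localData B F E x₀
    refine ⟨d, smoothMap.pair (baseMap L k (d.contMDiff_Y_sec η))
      (jetMap L k (d.contMDiff_lieY (L := L) η)), fun A hA ↦ ?_⟩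
    rw [d.comp_completeLift η hA, smoothMap.pair_apply]
    rfl) φ
  smooth_fib f := by
    refine (congrArg (· ∈ L.smoothFun k) (funext fun A ↦ ?_)).mp
      (pullbackBase L k ⟨fun x ↦ f ⟨x, η x⟩, f.contMDiff.comp η.contMDiff⟩).2
    exact congrArg f (congrArg (TotalSpace.mk A.base) (completeLift_spec η A).1.symm)

lemma liftSection_projectsTo (η : Sec B F E) : (liftSection L k η).ProjectsTo η :=
  fun A ↦ (completeLift_spec η A).1

/-! ### The complete lift, the projections and the canonical section. -/

namespace LocalData

variable {x₀ : M} (d : LocalData B F E x₀)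

lemma comp_trunc (A : L.EJet (k + 1)) (z : ETangent A) :
    d.comp A.trunc (ETangent.trunc A z) = ((d.comp A z).1, fun r ↦ (d.comp A z).2 r.castSucc) := by
  refine Prod.ext rfl ?_
  rw [comp_snd, comp_snd]
  funext r
  refine eq_of_forall_dual fun ℓ ↦ ?_
  rw [vderiv_jetMap, vderiv_jetMap]
  rfl

/-- `T` consists of `a(0)` and of the velocity of the prolonged curve, so its components are the
jets of the fibre coordinate of orders `0` and `r + 1`. -/
lemma comp_canonicalT (A : L.EJet (k + 1)) : d.comp A.trunc (canonicalT A) =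
    (A.vjet (fun e ↦ d.Y e.proj e.2) 0,
      fun r : Fin k ↦ A.vjet (fun e ↦ d.Y e.proj e.2) (r.succ : Fin (k + 1))) := by
  refine Prod.ext ?_ ?_
  · obtain ⟨a, c, ha, hab, -⟩ := canonicalT_spec A
    have h1 := ha.vjet_eq d.contMDiff_Y (0 : Fin (k + 1))
    refine Eq.trans ?_ h1.symm
    exact congrArg (fun e : TotalSpace F E ↦ d.Y e.proj e.2) hab
  · rw [comp_snd]
    funext r
    refine eq_of_forall_dual fun ℓ ↦ ?_
    rw [vderiv_jetMap, map_vjet d.contMDiff_Y, ← tDeriv_apply, tDeriv_jetFun]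
    rfl

lemma vjet_lieY_zero (η : Sec B F E) (A : L.EJet k) : A.vjet (d.lieY L η) 0 =
    d.lieOp L η A.base (A.vjet (fun e ↦ d.Y e.proj e.2) 0) := by
  simp only [EJet.vjet, iteratedDeriv_zero, lieY, A.isJetOf_choose.2.1]

end LocalData

/-- The jet components of every complete lift of `η` are jets of the same function `lieY`, and
truncation only drops the highest one. -/
lemma trunc_completeLift (η : Sec B F E) (A : L.EJet (k + 1)) :
    ETangent.trunc A (L.completeLift η (k + 1) A) = L.completeLift η k A.trunc := by
  obtain ⟨d⟩ := exists_localData B F E A.base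
  refine LocalData.comp_injective (d := d) (A := A.trunc) d.mem ?_
  rw [d.comp_trunc, d.comp_completeLift η (A := A) d.mem, d.comp_completeLift η (A := A.trunc) d.mem]
  refine Prod.ext rfl (funext fun r ↦ ?_)
  exact (LocalData.vjet_trunc A (d.contMDiff_lieY η) r).symm

lemma deriv_pullbackBase {Z : L.ESection k} {σ : Sec B F E} (hZ : Z.ProjectsTo σ) (g : BaseFun B M) :
    Z.deriv (pullbackBase L k g) = pullbackBase L k (L.anchorDeriv σ g) := by
  ext A
  refine ((Z.toFun A).2 g).trans ?_
  exact congrArg (fun b ↦ dirDeriv g A.base (L.anchor A.base b)) (hZ A)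

lemma ESection.deriv_mul (Z : L.ESection k) (φ ψ : L.smoothFun k) :
    Z.deriv (φ * ψ) = φ * Z.deriv ψ + ψ * Z.deriv φ := by
  ext A; exact (vec (Z.toFun A)).2 φ ψ

lemma tDeriv_mul (φ ψ : L.smoothFun k) :
    tDeriv (φ * ψ) = pullbackTrunc φ * tDeriv ψ + pullbackTrunc ψ * tDeriv φ := by
  ext A; exact (vec (A := A.trunc) (canonicalT A)).2 φ ψ

lemma ESection.deriv_add (Z : L.ESection k) (φ ψ : L.smoothFun k) :
    Z.deriv (φ + ψ) = Z.deriv φ + Z.deriv ψ := by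
  ext A; exact map_add _ _ _

lemma ESection.deriv_smul (Z : L.ESection k) (c : ℝ) (φ : L.smoothFun k) :
    Z.deriv (c • φ) = c • Z.deriv φ := by
  ext A; exact map_smul _ _ _

/-- The derivation `T Z - W T` along `τ_{k+1,k}`, for a section `W` over `Z`. -/
def commDeriv {Z : L.ESection (k + 1)} {W : L.ESection k}
    (h : ∀ A, ETangent.trunc A (Z.toFun A) = W.toFun A.trunc) (A : L.EJet (k + 1)) :
    tangentAt A.trunc :=
  ⟨{ toFun φ := (tDeriv (W.deriv φ)).1 A - (Z.deriv (tDeriv φ)).1 A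
     map_add' φ ψ := by
      rw [W.deriv_add, map_add, map_add, Z.deriv_add]
      exact add_sub_add_comm _ _ _ _
     map_smul' c φ := by
      rw [W.deriv_smul, map_smul, map_smul, Z.deriv_smul]
      exact (mul_sub _ _ _).symm },
    fun φ ψ ↦ by
      -- Because `Z` lies over `W`, the mixed terms of the two second-order products cancel and a
      -- derivation is left.
      have h1 (φ : L.smoothFun k) : (Z.deriv (pullbackTrunc φ)).1 A = (W.deriv φ).1 A.trunc :=
        congrArg (fun w : ETangent A.trunc ↦ (vec (A := A.trunc) w).1 φ) (h A)
      simp only [LinearMap.coe_mk, AddHom.coe_mk]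
      rw [W.deriv_mul, map_add, tDeriv_mul, tDeriv_mul, tDeriv_mul, Z.deriv_add, Z.deriv_mul,
        Z.deriv_mul]
      have h2 (α β : L.smoothFun (k + 1)) : (α + β).1 A = α.1 A + β.1 A := rfl
      have h3 (α β : L.smoothFun (k + 1)) : (α * β).1 A = α.1 A * β.1 A := rfl
      have h4 (α : L.smoothFun k) : (pullbackTrunc α).1 A = α.1 A.trunc := rfl
      simp only [h2, h3, h4, h1]
      ring⟩

lemma commDeriv_apply {Z : L.ESection (k + 1)} {W : L.ESection k}
    (h : ∀ A, ETangent.trunc A (Z.toFun A) = W.toFun A.trunc) (A : L.EJet (k + 1))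
    (φ : L.smoothFun k) :
    (commDeriv h A).1 φ = (tDeriv (W.deriv φ)).1 A - (Z.deriv (tDeriv φ)).1 A := rfl

/-- The complete lifts commute with the canonical derivation. -/
lemma tDeriv_liftSection (η : Sec B F E) (φ : L.smoothFun k) :
    tDeriv ((liftSection L k η).deriv φ) = (liftSection L (k + 1) η).deriv (tDeriv φ) := by
  ext A
  obtain ⟨d⟩ := exists_localData B F E A.base
  have hd : A.base ∈ d.W := d.mem
  have htr (A : L.EJet (k + 1)) : ETangent.trunc A ((liftSection L (k + 1) η).toFun A) =
      (liftSection L k η).toFun A.trunc := trunc_completeLift η A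
  set w := commDeriv htr A with hw
  -- The difference of the two sides is a tangent vector at `A.trunc`, so it vanishes once it
  -- annihilates the coordinates.
  suffices h : vderiv w.1 (d.u L k) = 0 by
    obtain ⟨g, hg⟩ := d.exists_rep φ
    have h1 := hg.vec_apply (A := A.trunc) hd w
    rw [h, map_zero] at h1
    exact sub_eq_zero.mp h1
  obtain ⟨yη, hyη, hyηe⟩ := d.exists_base_rep (d.contMDiff_Y_sec η)
  have hr : ContDiff ℝ ∞ (fun z ↦ d.R L (z, yη z)) := d.contDiff_R.comp (contDiff_id.prodMk hyη)
  set z := extChartAt 𝓘(ℝ, B) A.base A.base with hz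
  rw [LocalData.u, vderiv_pair]
  refine Prod.ext (eq_of_forall_dual fun ℓ ↦ ?_)
    (funext fun r ↦ eq_of_forall_dual fun ℓ ↦ ?_)
  -- Base coordinates: `T` gives the anchor of the curve, and the equality is `fderiv_R`.
  · rw [vderiv_baseMap]
    set f : BaseFun B M := ⟨fun x ↦ ℓ (d.X x),
      ((LinearMap.toContinuousLinearMap ℓ).contDiff.contMDiff.comp d.contMDiff_X)⟩ with hf
    have hfa (x : M) (hx : x ∈ d.W) (b : E x) : dirDeriv f x (L.anchor x b) =
        ℓ (d.R L (extChartAt 𝓘(ℝ, B) A.base x, d.Y x b)) := by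
      rw [d.R_eq hx, ← d.X_eq x hx]
      exact LocalData.dirDeriv_lin_X hx ℓ b
    have hT (A' : L.EJet (k + 1)) (g : BaseFun B M) : (tDeriv (pullbackBase L k g)).1 A' =
        dirDeriv g A'.base (L.anchor A'.base (fib (A := A'.trunc) (canonicalT A'))) :=
      (canonicalT A').2 g
    have hYT (A' : L.EJet (k + 1)) : d.Y A'.base (fib (A := A'.trunc) (canonicalT A')) =
        A'.vjet (fun e ↦ d.Y e.proj e.2) 0 := (Prod.ext_iff.mp (d.comp_canonicalT A')).1
    refine Eq.trans ?_ (map_zero ℓ).symm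
    rw [hw, commDeriv_apply, deriv_pullbackBase (liftSection_projectsTo η), sub_eq_zero, hT]
    have hrep : ContDiff ℝ ∞ (fun y ↦ LinearMap.toContinuousLinearMap ℓ (d.R L (y, yη y))) :=
      (LinearMap.toContinuousLinearMap ℓ).contDiff.comp hr
    have hG : ContDiff ℝ ∞ (fun q : B × (Fin (k + 1) → F) ↦
        LinearMap.toContinuousLinearMap ℓ (d.R L (q.1, q.2 0))) :=
      (LinearMap.toContinuousLinearMap ℓ).contDiff.comp (d.contDiff_R.comp (by fun_prop))
    have hGr : d.Rep L (k + 1) (tDeriv (pullbackBase L k f)) (fun q : B × (Fin (k + 1) → F) ↦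
        LinearMap.toContinuousLinearMap ℓ (d.R L (q.1, q.2 0))) := by
      refine ⟨hG, fun A' hA' ↦ ?_⟩
      refine (hT A' f).trans ((hfa _ hA' _).trans ((congrArg
        (fun y ↦ ℓ (d.R L (extChartAt 𝓘(ℝ, B) A.base A'.base, y))) (hYT A')).trans ?_))
      rw [d.u_apply, ← d.X_eq _ hA']
      rfl
    have e1 : dirDeriv (L.anchorDeriv η f) A.base (L.anchor A.base
        (fib (A := A.trunc) (canonicalT A))) = _ := d.dirDeriv_rep hd hrep
      (fun y hy ↦ by rw [L.anchorDeriv_apply, hfa y hy, hyηe y hy]; rfl) _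
    have e2 := hGr.vec_eq hd (L.completeLift η (k + 1) A)
    refine e1.trans (Eq.trans ?_ e2.symm)
    rw [d.comp_completeLift η hd, hYT]
    have e3 := ((LinearMap.toContinuousLinearMap ℓ).hasFDerivAt.comp z
      (hr.differentiable (by simp) z).hasFDerivAt).fderiv
    refine (congrArg (fun S : B →L[ℝ] ℝ ↦ S _) e3).trans ?_
    have hu1 : ((d.u L (k + 1)).1 A) = (z, fun r : Fin (k + 1) ↦
        A.vjet (fun e ↦ d.Y e.proj e.2) r) := by rw [d.u_apply, d.X_eq _ hd]
    have e4 : HasFDerivAt (fun q : B × (Fin (k + 1) → F) ↦ (q.1, q.2 0))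
        ((ContinuousLinearMap.fst ℝ B (Fin (k + 1) → F)).prod
          ((ContinuousLinearMap.proj 0).comp (ContinuousLinearMap.snd ℝ B (Fin (k + 1) → F))))
        ((d.u L (k + 1)).1 A) :=
      hasFDerivAt_fst.prodMk ((ContinuousLinearMap.proj (R := ℝ) (φ := fun _ : Fin (k + 1) ↦ F) 0).comp
        (ContinuousLinearMap.snd ℝ B (Fin (k + 1) → F))).hasFDerivAt
    have e7 := (d.contDiff_R (L := L)).differentiable (by simp)
      ((fun q : B × (Fin (k + 1) → F) ↦ (q.1, q.2 0)) ((d.u L (k + 1)).1 A))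
    have e5 := ((LinearMap.toContinuousLinearMap ℓ).hasFDerivAt.comp _
      (HasFDerivAt.comp ((d.u L (k + 1)).1 A) e7.hasFDerivAt e4)).fderiv
    refine Eq.trans ?_ (congrArg (fun S : (B × (Fin (k + 1) → F)) →L[ℝ] ℝ ↦ S _) e5).symm
    have e6 := d.fderiv_R (L := L) hyη hyηe hd (A.vjet (fun e ↦ d.Y e.proj e.2) 0)
    refine (congrArg ℓ e6.symm).trans (congrArg ℓ ?_)
    rw [hu1, ← d.vjet_lieY_zero, d.X_eq _ hd, hyηe _ hd, ← d.R_eq hd]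
    rfl
  -- Jet coordinates: in either order the result is the jet of order `r + 1` of `ℓ ∘ lieY`.
  · rw [vderiv_jetMap, hw, commDeriv_apply, tDeriv_jetFun]
    have e1 : (tDeriv ((liftSection L k η).deriv (jetFun L (dualTotFun d.contMDiff_Y ℓ) r))).1 A =
        (tDeriv (jetFun L (dualTotFun (d.contMDiff_lieY (L := L) η) ℓ) r)).1 A := by
      refine tangent_congr _ (d.isOpen.mem_nhds hd) fun A' hA' ↦ ?_
      refine (vderiv_jetMap (vec (L.completeLift η k A')).1 d.contMDiff_Y ℓ r).symm.trans ?_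
      rw [← d.comp_snd, d.comp_completeLift η hA']
      exact map_vjet _ ℓ r A'
    rw [e1, tDeriv_jetFun, sub_eq_zero.mpr]
    · exact (map_zero ℓ).symm
    · refine Eq.trans ?_ (vderiv_jetMap (vec (L.completeLift η (k + 1) A)).1 d.contMDiff_Y ℓ r.succ)
      rw [← d.comp_snd, d.comp_completeLift η hd]
      exact (map_vjet _ ℓ r.succ A).symm


/-! ### Alternating forms and the Koszul formula with torsion. -/

section Alternating

open Function

variable {V : Type*} [AddCommGroup V] [Module ℝ V] {p : ℕ}

lemma sum_sum_eq_sum_Iio {n : ℕ} {f : Fin n → Fin n → ℝ} (hf : ∀ i, f i i = 0) :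
    ∑ j, ∑ i, f i j = ∑ j, ∑ i ∈ Finset.Iio j, (f i j + f j i) := by
  have h1 (j : Fin n) : ∑ i, f i j = ∑ i ∈ Finset.Iio j, f i j + ∑ i ∈ Finset.Ioi j, f i j := by
    have h2 : Disjoint (Finset.Iio j) (Finset.Ioi j) := by
      rw [Finset.disjoint_left]
      intro i hi hi'
      rw [Finset.mem_Iio] at hi
      rw [Finset.mem_Ioi] at hi'
      exact lt_asymm hi hi'
    rw [← Finset.sum_union h2]
    refine (Finset.sum_subset (Finset.subset_univ _) fun i _ hi ↦ ?_).symm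
    have : i = j := by
      simp only [Finset.mem_union, Finset.mem_Iio, Finset.mem_Ioi, not_or, not_lt] at hi
      exact le_antisymm hi.2 hi.1
    rw [this, hf]
  simp only [h1, Finset.sum_add_distrib]
  congr 1
  exact Finset.sum_comm' fun x y ↦ by simp

lemma update_comp_succAbove (z : Fin (p + 1) → V) (j : Fin (p + 1)) (l : Fin p) (x : V) :
    update (fun m ↦ z (j.succAbove m)) l x = fun m ↦ update z (j.succAbove l) x (j.succAbove m) :=
  (update_comp_eq_of_injective z j.succAbove_right_injective l x).symm

/-- Put `x` in both slots `i` and `j` of `z`. Omitting one slot or the other leaves the same vectors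
up to a permutation, whose sign is the one stated. -/
lemma alternating_swap (θ : V [⋀^Fin p]→ₗ[ℝ] ℝ) (z : Fin (p + 1) → V) {i j : Fin (p + 1)}
    (hij : i ≠ j) (x : V) : (-1 : ℝ) ^ (i : ℕ) * θ (fun l ↦ update z j x (i.succAbove l)) =
      -((-1 : ℝ) ^ (j : ℕ) * θ (fun l ↦ update z i x (j.succAbove l))) := by
  have h := AlternatingMap.neg_one_pow_smul_map_removeNth_add_eq_zero_of_eq θ
    (v := update (update z i x) j x) (i := i) (j := j) (by simp [hij]) hij
  have h1 : i.removeNth (update (update z i x) j x) = fun l ↦ update z j x (i.succAbove l) := by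
    funext l
    rw [update_comm hij, Fin.removeNth_apply, update_of_ne (i.succAbove_ne l)]
  have h2 : j.removeNth (update (update z i x) j x) = fun l ↦ update z i x (j.succAbove l) := by
    funext l
    rw [Fin.removeNth_apply, update_of_ne (j.succAbove_ne l)]
  rw [h1, h2] at h
  simp only [zsmul_eq_mul, Int.cast_pow, Int.cast_neg, Int.cast_one] at h
  linarith

/-- The action of an endomorphism on an alternating form as a derivation. -/
def derivAction : ∀ {p : ℕ}, (V [⋀^Fin p]→ₗ[ℝ] ℝ) → (V →ₗ[ℝ] V) →ₗ[ℝ] V [⋀^Fin p]→ₗ[ℝ] ℝ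
  | 0, _ => 0
  | _ + 1, θ => AlternatingMap.alternatizeUncurryFinLM ∘ₗ LinearMap.compRight ℝ θ.curryLeft

lemma derivAction_apply (θ : V [⋀^Fin p]→ₗ[ℝ] ℝ) (N : V →ₗ[ℝ] V) (v : Fin p → V) :
    derivAction θ N v = ∑ l, θ (update v l (N (v l))) := by
  cases p with
  | zero => simp [derivAction]
  | succ p =>
    refine (AlternatingMap.alternatizeUncurryFin_apply _ v).trans
      (Finset.sum_congr rfl fun l _ ↦ ?_)
    refine (θ.map_insertNth l (N (v l)) (l.removeNth v)).symm.trans ?_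
    rw [Fin.insertNth_removeNth]

/-- The alternating form defined by a covariant derivative of an alternating form and a torsion. -/
def torsionForm (D : V →ₗ[ℝ] V [⋀^Fin p]→ₗ[ℝ] ℝ) (C : V →ₗ[ℝ] V →ₗ[ℝ] V)
    (θ : V [⋀^Fin p]→ₗ[ℝ] ℝ) : V [⋀^Fin (p + 1)]→ₗ[ℝ] ℝ :=
  AlternatingMap.alternatizeUncurryFin (D - (1 / 2 : ℝ) • (derivAction θ ∘ₗ C))

/-- With `N j m` standing for `∇_{z_j} z_m`, the right side is the Koszul formula for the bracket
`∇_i z_j - ∇_j z_i + C(z_i, z_j)`. The terms in `N` cancel between the two sums, whatever `N` is.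
Alternation meets each pair of indices twice in the term with `C`, whence the factor `1 / 2`. -/
lemma torsionForm_apply (D : V →ₗ[ℝ] V [⋀^Fin p]→ₗ[ℝ] ℝ) {C : V →ₗ[ℝ] V →ₗ[ℝ] V}
    (hC : ∀ x y, C x y = -C y x) (θ : V [⋀^Fin p]→ₗ[ℝ] ℝ) (N : Fin (p + 1) → Fin (p + 1) → V)
    (z : Fin (p + 1) → V) : torsionForm D C θ z =
      ∑ j : Fin (p + 1), (-1 : ℝ) ^ (j : ℕ) * (D (z j) (fun l ↦ z (j.succAbove l)) +
        ∑ l, θ (update (fun m ↦ z (j.succAbove m)) l (N j (j.succAbove l)))) +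
      ∑ j : Fin (p + 1), ∑ i ∈ Finset.Iio j, (-1 : ℝ) ^ (j : ℕ) *
        θ (fun l ↦ update z i (N i j - N j i + C (z i) (z j)) (j.succAbove l)) := by
  set G : Fin (p + 1) → Fin (p + 1) → V → ℝ := fun i j x ↦
    if i = j then 0 else (-1 : ℝ) ^ (j : ℕ) * θ (fun l ↦ update z i x (j.succAbove l)) with hG
  have hG0 (i : Fin (p + 1)) (x : V) : G i i x = 0 := if_pos rfl
  have hG1 {i j : Fin (p + 1)} (h : i ≠ j) (x : V) :
      G i j x = (-1 : ℝ) ^ (j : ℕ) * θ (fun l ↦ update z i x (j.succAbove l)) := if_neg h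
  have hGs {i j : Fin (p + 1)} (h : i ≠ j) (x : V) : G j i x = -G i j x := by
    rw [hG1 h, hG1 h.symm, alternating_swap θ z h]
  have hGl {i j : Fin (p + 1)} (h : i ≠ j) (x y w : V) :
      G i j (x - y + w) = G i j x - G i j y + G i j w := by
    obtain ⟨l, rfl⟩ := Fin.exists_succAbove_eq h
    simp only [hG1 h, ← update_comp_succAbove, AlternatingMap.map_update_add,
      AlternatingMap.map_update_sub]
    ring
  have hGn {i j : Fin (p + 1)} (h : i ≠ j) (x : V) : G i j (-x) = -G i j x := by
    obtain ⟨l, rfl⟩ := Fin.exists_succAbove_eq h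
    simp only [hG1 h, ← update_comp_succAbove, AlternatingMap.map_update_neg]
    ring
  have hsum (j : Fin (p + 1)) (x : Fin (p + 1) → V) : (-1 : ℝ) ^ (j : ℕ) *
      ∑ l, θ (update (fun m ↦ z (j.succAbove m)) l (x (j.succAbove l))) = ∑ i, G i j (x i) := by
    rw [Fin.sum_univ_succAbove _ j, hG0, zero_add, Finset.mul_sum]
    refine Finset.sum_congr rfl fun l _ ↦ ?_
    rw [hG1 (j.succAbove_ne l), update_comp_succAbove]
  have e1 : torsionForm D C θ z = ∑ j : Fin (p + 1), (-1 : ℝ) ^ (j : ℕ) * D (z j) (fun l ↦ z (j.succAbove l)) -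
      (1 / 2) * ∑ j, ∑ i, G i j (C (z j) (z i)) := by
    rw [torsionForm, AlternatingMap.alternatizeUncurryFin_apply, Finset.mul_sum,
      ← Finset.sum_sub_distrib]
    refine Finset.sum_congr rfl fun j _ ↦ ?_
    rw [← hsum j fun i ↦ C (z j) (z i), LinearMap.sub_apply, AlternatingMap.sub_apply,
      LinearMap.smul_apply, AlternatingMap.smul_apply, LinearMap.comp_apply, derivAction_apply,
      zsmul_eq_mul, smul_eq_mul, mul_sub, mul_left_comm]
    push_cast
    rfl
  rw [e1]
  simp only [mul_add, Finset.sum_add_distrib, hsum _ (N _)]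
  rw [sum_sum_eq_sum_Iio fun i ↦ hG0 i _, sum_sum_eq_sum_Iio fun i ↦ hG0 i _, add_assoc,
    ← Finset.sum_add_distrib, sub_eq_add_neg, Finset.mul_sum, ← Finset.sum_neg_distrib]
  congr 1
  refine Finset.sum_congr rfl fun j _ ↦ ?_
  rw [← Finset.sum_add_distrib, Finset.mul_sum, ← Finset.sum_neg_distrib]
  refine Finset.sum_congr rfl fun i hi ↦ ?_
  have hij : i ≠ j := (Finset.mem_Iio.mp hi).ne
  rw [← hG1 hij, hGl hij, hGs hij, hGs hij, hC (z j) (z i), hGn hij]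
  ring

end Alternating


/-! ### The local connection with parallel frame, and brackets of projectable sections. -/

instance tangentAt.instAddCommGroup (A : L.EJet k) : AddCommGroup (tangentAt A) :=
  Submodule.addCommGroup (tangentAt A)

instance ETangent.instAddCommGroup (A : L.EJet k) : AddCommGroup (ETangent A) :=
  Submodule.addCommGroup (ETangent A)

lemma tangentApp_eq {A : L.EJet k} (v : tangentAt A) {φ : L.EJet k → ℝ} (h : φ ∈ L.smoothFun k) :
    tangentApp v φ = v.1 ⟨φ, h⟩ := dif_pos h

namespace LocalData

variable {x₀ : M} (d : LocalData B F E x₀)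

/-- The derivative of the components of a section of `𝒯^E E^k` along a tangent vector. -/
def nabla {A : L.EJet k} (v : tangentAt A) (Z : L.ESection k) : ETangent A :=
  d.frameAt A (vderiv v.1 (d.compMap Z))

lemma comp_nabla {A : L.EJet k} (hA : A.base ∈ d.core) (v : tangentAt A) (Z : L.ESection k) :
    d.comp A (d.nabla v Z) = vderiv v.1 (d.compMap Z) := d.comp_frameAt hA _

/-- The derivative of the first component. -/
lemma vderiv_compMap_fst {Z : L.ESection k} {σ : Sec B F E} (hZ : Z.ProjectsTo σ) {A : L.EJet k}
    (z : ETangent A) (ℓ : F →ₗ[ℝ] ℝ) : ℓ (vderiv (vec z).1 (d.compMap Z)).1 =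
      dirDeriv (d.secComp σ ℓ) A.base (L.anchor A.base (fib z)) := by
  refine (map_vderiv (vec z).1 (d.compMap Z) (ℓ ∘ₗ LinearMap.fst ℝ F (Fin k → F))).trans
    (Eq.trans (congrArg (vec z).1 (Subtype.ext (funext fun A' ↦ ?_))) (z.2 (d.secComp σ ℓ)))
  exact congrArg (fun b ↦ ℓ (d.Y A'.base b)) (hZ A')

/-- The second derivative splits into a part with the components of `W` frozen at `A` and a part
differentiating these components, which is `nabla`. -/
lemma deriv_leibniz {A : L.EJet k} (hA : A.base ∈ d.core) (v : tangentAt A) (W : L.ESection k)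
    (φ : L.smoothFun k) : v.1 (W.deriv φ) =
      v.1 ((d.frame L k (d.comp A (W.toFun A))).deriv φ) + (vec (d.nabla v W)).1 φ := by
  refine Eq.trans ?_ (linearFamily_leibniz (d.vecFrameAt_mem φ) (d.compMap W) v)
  exact tangent_congr v (d.core_mem_nhds_of_mem hA) fun A' hA' ↦
    (congrArg (fun w : ETangent A' ↦ (vec w).1 φ) (d.frameAt_compMap W hA')).symm

variable (k) in
lemma frame_deriv_add (c c' : F × (Fin k → F)) (φ : L.smoothFun k) :
    (d.frame L k (c + c')).deriv φ = (d.frame L k c).deriv φ + (d.frame L k c').deriv φ := by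
  ext A
  exact congrArg (fun w : ETangent A ↦ (vec w).1 φ) (map_add (d.frameAt A) c c')

variable (k) in
lemma frame_deriv_smul (r : ℝ) (c : F × (Fin k → F)) (φ : L.smoothFun k) :
    (d.frame L k (r • c)).deriv φ = r • (d.frame L k c).deriv φ := by
  ext A
  exact congrArg (fun w : ETangent A ↦ (vec w).1 φ) (map_smul (d.frameAt A) r c)

lemma cutSec_add (c c' : F) : d.cutSec (c + c') = d.cutSec c + d.cutSec c' := by
  ext x
  have h : d.sec (c + c') x = d.sec c x + d.sec c' x := by rw [map_add]; rfl
  exact (congrArg (d.cut x • ·) h).trans (smul_add _ _ _)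

lemma cutSec_smul (r : ℝ) (c : F) : d.cutSec (r • c) = r • d.cutSec c := by
  ext x
  have h : d.sec (r • c) x = r • d.sec c x := by rw [map_smul]; rfl
  exact (congrArg (d.cut x • ·) h).trans (smul_comm (d.cut x) r (d.sec c x))

lemma projBracket_frame_skew (A : L.EJet k) (c c' : F × (Fin k → F)) :
    projBracket (d.frame_projectsTo c) (d.frame_projectsTo c') A =
      -projBracket (d.frame_projectsTo c') (d.frame_projectsTo c) A := by
  refine Subtype.ext (Prod.ext ?_ (Subtype.ext ?_))
  · exact (congrArg (fun τ : Sec B F E ↦ τ A.base)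
      (bracket_skew (L := L) (d.cutSec c.1) (d.cutSec c'.1)))
  · ext φ
    exact (neg_sub _ _).symm

lemma projBracket_frame_add (A : L.EJet k) (c₁ c₂ c' : F × (Fin k → F)) :
    projBracket (d.frame_projectsTo (c₁ + c₂)) (d.frame_projectsTo c') A =
      projBracket (d.frame_projectsTo c₁) (d.frame_projectsTo c') A +
        projBracket (d.frame_projectsTo c₂) (d.frame_projectsTo c') A := by
  refine Subtype.ext (Prod.ext ?_ (Subtype.ext ?_))
  · refine congrArg (fun τ : Sec B F E ↦ τ A.base)
      (?_ : L.bracket (d.cutSec (c₁.1 + c₂.1)) (d.cutSec c'.1) = L.bracket (d.cutSec c₁.1)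
        (d.cutSec c'.1) + L.bracket (d.cutSec c₂.1) (d.cutSec c'.1))
    rw [cutSec_add, map_add, LinearMap.add_apply]
  · ext φ
    change (vec (d.frameAt A (c₁ + c₂))).1 _ - (vec ((d.frame L k c').toFun A)).1
      ((d.frame L k (c₁ + c₂)).deriv φ) = _
    rw [map_add, frame_deriv_add, map_add]
    exact add_sub_add_comm _ _ _ _

lemma projBracket_frame_smul (A : L.EJet k) (r : ℝ) (c c' : F × (Fin k → F)) :
    projBracket (d.frame_projectsTo (r • c)) (d.frame_projectsTo c') A =
      r • projBracket (d.frame_projectsTo c) (d.frame_projectsTo c') A := by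
  refine Subtype.ext (Prod.ext ?_ (Subtype.ext ?_))
  · refine congrArg (fun τ : Sec B F E ↦ τ A.base)
      (?_ : L.bracket (d.cutSec (r • c.1)) (d.cutSec c'.1) = r • L.bracket (d.cutSec c.1)
        (d.cutSec c'.1))
    rw [cutSec_smul, map_smul, LinearMap.smul_apply]
  · ext φ
    change (vec (d.frameAt A (r • c))).1 _ - (vec ((d.frame L k c').toFun A)).1
      ((d.frame L k (r • c)).deriv φ) = _
    rw [map_smul, frame_deriv_smul, map_smul]
    exact (mul_sub r _ _).symm

/-- The brackets of the elements of the local frame. -/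
def bracketAt (A : L.EJet k) :
    (F × (Fin k → F)) →ₗ[ℝ] (F × (Fin k → F)) →ₗ[ℝ] ETangent A :=
  LinearMap.mk₂ ℝ (fun c c' ↦ projBracket (d.frame_projectsTo c) (d.frame_projectsTo c') A)
    (d.projBracket_frame_add A) (d.projBracket_frame_smul A)
    (fun c c₁ c₂ ↦ (d.projBracket_frame_skew A _ _).trans
      ((congrArg Neg.neg (d.projBracket_frame_add A c₁ c₂ c)).trans ((neg_add _ _).trans
        (congrArg₂ (· + ·) (d.projBracket_frame_skew A _ _).symm
          (d.projBracket_frame_skew A _ _).symm))))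
    (fun r c c' ↦ (d.projBracket_frame_skew A _ _).trans
      ((congrArg Neg.neg (d.projBracket_frame_smul A r c' c)).trans ((smul_neg r _).symm.trans
        (congrArg (r • ·) (d.projBracket_frame_skew A _ _).symm))))

/-- `Y_bracket` used twice, the second time through skew-symmetry, isolates the derivatives of both
arguments and leaves the bracket of two frame sections. -/
lemma Y_bracket_sub {x : M} (hx : x ∈ d.core) (σ τ : Sec B F E) (ℓ : F →ₗ[ℝ] ℝ) :
    ℓ (d.Y x (L.bracket σ τ x)) = dirDeriv (d.secComp τ ℓ) x (L.anchor x (σ x)) -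
      dirDeriv (d.secComp σ ℓ) x (L.anchor x (τ x)) +
      ℓ (d.Y x (L.bracket (d.cutSec (d.Y x (σ x))) (d.cutSec (d.Y x (τ x))) x)) := by
  have hcore := d.core_mem_nhds_of_mem hx
  have hcut (c : F) (y : M) (hy : y ∈ d.core) : d.cutSec c y = d.sec c y := by
    refine (congrArg (· • d.sec c y) (d.cut_core hy)).trans (one_smul _ _)
  have h1 := d.Y_bracket (L := L) (d.core_subset hx) σ τ ℓ
  have h2 := d.Y_bracket (L := L) (d.core_subset hx) (d.sec (d.Y x (τ x))) σ ℓ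
  rw [bracket_skew, ContMDiffSection.coe_neg, Pi.neg_apply, map_neg, map_neg,
    bracket_skew _ (d.sec (d.Y x (σ x))), ContMDiffSection.coe_neg, Pi.neg_apply, map_neg, map_neg,
    d.sec_Y _ (d.core_subset hx)] at h2
  rw [bracket_congr hcore (hcut _), bracket_congr_left hcore (hcut _), h1]
  linarith

/-- Derivatives of `Z` and `W` enter a bracket only through the connection for which the frame is
parallel; what remains is a tensor, minus the torsion, given by the brackets of the frame. -/
lemma projBracket_eq {Z W : L.ESection k} {σ τ : Sec B F E} (hZ : Z.ProjectsTo σ)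
    (hW : W.ProjectsTo τ) {A : L.EJet k} (hA : A.base ∈ d.core) : projBracket hZ hW A =
      d.nabla (vec (Z.toFun A)) W - d.nabla (vec (W.toFun A)) Z +
        d.bracketAt A (d.comp A (Z.toFun A)) (d.comp A (W.toFun A)) := by
  refine Subtype.ext (Prod.ext (d.Y_injective (d.core_subset hA) (eq_of_forall_dual fun ℓ ↦ ?_))
    (Subtype.ext ?_))
  · refine (d.Y_bracket_sub hA σ τ ℓ).trans ?_
    have e1 (Z W : L.ESection k) {τ : Sec B F E} (hW : W.ProjectsTo τ) :
        ℓ (d.Y A.base (fib (d.nabla (vec (Z.toFun A)) W))) = _ :=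
      (congrArg (fun c : F × (Fin k → F) ↦ ℓ c.1) (d.comp_nabla hA (vec (Z.toFun A)) W)).trans
        (d.vderiv_compMap_fst hW (Z.toFun A) ℓ)
    refine Eq.trans (congrArg₂ (· + ·) (congrArg₂ (· - ·) ?_ ?_) ?_)
      ((congrArg (· + _) (map_sub (ℓ ∘ₗ d.Y A.base) _ _).symm).trans
        (map_add (ℓ ∘ₗ d.Y A.base) _ _).symm)
    · rw [← hZ A]; exact (e1 Z W hW).symm
    · rw [← hW A]; exact (e1 W Z hZ).symm
    · rw [← hZ A, ← hW A]
      rfl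
  · ext φ
    change (vec (Z.toFun A)).1 (W.deriv φ) - (vec (W.toFun A)).1 (Z.deriv φ) =
      (vec (d.nabla (vec (Z.toFun A)) W)).1 φ - (vec (d.nabla (vec (W.toFun A)) Z)).1 φ +
        ((vec (d.frameAt A (d.comp A (Z.toFun A)))).1
            ((d.frame L k (d.comp A (W.toFun A))).deriv φ) -
          (vec (d.frameAt A (d.comp A (W.toFun A)))).1
            ((d.frame L k (d.comp A (Z.toFun A))).deriv φ))
    have h1 (z : ETangent A) (ψ : L.smoothFun k) :
        (vec (d.frameAt A (d.comp A z))).1 ψ = (vec z).1 ψ :=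
      congrArg (fun w : ETangent A ↦ (vec w).1 ψ) (d.frameAt_comp hA z)
    rw [h1, h1, d.deriv_leibniz hA _ W φ, d.deriv_leibniz hA _ Z φ]
    ring

end LocalData


/-! ### Existence of the exterior differential. -/

namespace LocalData

variable {x₀ : M} (d : LocalData B F E x₀) {p : ℕ}

/-- The components of a smooth form in the local frame. -/
def formComp {θ : L.EForm k p} (hθ : θ.IsSmooth) :
    (F × (Fin k → F)) [⋀^Fin p]→ₗ[ℝ] L.smoothFun k where
  toFun c := ⟨fun A ↦ θ A fun i ↦ d.frameAt A (c i), hθ fun i ↦ d.frame L k (c i)⟩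
  map_update_add' c i x y := Subtype.ext (funext fun A ↦
    ((θ A).compLinearMap (d.frameAt A)).toMultilinearMap.map_update_add' c i x y)
  map_update_smul' c i r x := Subtype.ext (funext fun A ↦
    ((θ A).compLinearMap (d.frameAt A)).toMultilinearMap.map_update_smul' c i r x)
  map_eq_zero_of_eq' c i j hc hij := Subtype.ext (funext fun A ↦
    ((θ A).compLinearMap (d.frameAt A)).map_eq_zero_of_eq' c i j hc hij)

/-- The covariant derivative of a form for which the local frame is parallel. -/
def covDeriv {θ : L.EForm k p} (hθ : θ.IsSmooth) (A : L.EJet k) :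
    ETangent A →ₗ[ℝ] (ETangent A) [⋀^Fin p]→ₗ[ℝ] ℝ where
  toFun z := ((vec z).1.compAlternatingMap (d.formComp hθ)).compLinearMap (d.comp A)
  map_add' _ _ := rfl
  map_smul' _ _ := rfl

/-- The multilinear product rule in the frame; `covDeriv` is the term in which the components of the
arguments are frozen. -/
lemma form_leibniz {θ : L.EForm k p} (hθ : θ.IsSmooth) {A : L.EJet k} (hA : A.base ∈ d.core)
    (z : ETangent A) (W : Fin p → L.ESection k) :
    (vec z).1 ⟨fun A' ↦ θ A' fun i ↦ (W i).toFun A', hθ W⟩ =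
      d.covDeriv hθ A z (fun i ↦ (W i).toFun A) +
        ∑ l, θ A (Function.update (fun i ↦ (W i).toFun A) l (d.nabla (vec z) (W l))) := by
  have hM (c : Fin p → F × (Fin k → F)) : (fun A ↦
      ((θ A).compLinearMap (d.frameAt A)).toMultilinearMap c) ∈ L.smoothFun k :=
    hθ fun i ↦ d.frame L k (c i)
  have h1 := multilinearFamily_leibniz hM (fun i ↦ d.compMap (W i)) (vec z)
  refine Eq.trans (tangent_congr _ (d.core_mem_nhds_of_mem hA) fun A' hA' ↦ ?_)
    (h1.trans (congrArg₂ (· + ·) rfl (Finset.sum_congr rfl fun l _ ↦ ?_)))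
  · exact congrArg (θ A') (funext fun i ↦ (d.frameAt_compMap (W i) hA').symm)
  · refine congrArg (θ A) (funext fun i ↦ ?_)
    by_cases hi : i = l
    · subst hi
      simp only [Function.update_self]
      rfl
    · simp only [Function.update_of_ne hi]
      exact d.frameAt_compMap (W i) hA

lemma bracketAt_skew (A : L.EJet k) (c c' : F × (Fin k → F)) :
    d.bracketAt A c c' = -d.bracketAt A c' c := d.projBracket_frame_skew A c c'

end LocalData

variable {p : ℕ}

/-- `torsionForm_apply`, with the bracket expressed by `projBracket_eq`, is the Koszul formula. That
formula is checked at one point `A` at a time, so the connection may be chosen separately for each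
`A` and nothing has to be glued. -/
lemma exists_isExtDeriv {θ : L.EForm k p} (hθ : θ.IsSmooth) : ∃ μ, IsExtDeriv θ μ := by
  have hd (x : M) := exists_localData B F E x
  let d (x : M) : LocalData B F E x := (hd x).some
  refine ⟨fun A ↦ torsionForm ((d A.base).covDeriv hθ A)
    (((d A.base).bracketAt A).compl₁₂ ((d A.base).comp A) ((d A.base).comp A)) (θ A),
    fun Z σ h A ↦ ?_⟩
  have hA : A.base ∈ (d A.base).core := mem_of_mem_nhds (d A.base).core_mem_nhds
  refine (torsionForm_apply _ (fun x y ↦ (d A.base).bracketAt_skew A _ _) (θ A)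
    (fun j m ↦ (d A.base).nabla (vec ((Z j).toFun A)) (Z m)) _).trans
    (congrArg₂ (· + ·) (Finset.sum_congr rfl fun j _ ↦ congrArg (_ * ·) ?_)
      (Finset.sum_congr rfl fun j _ ↦ Finset.sum_congr rfl fun i _ ↦ congrArg (_ * ·) ?_))
  · rw [tangentApp_eq _ (hθ fun l ↦ Z (j.succAbove l)), (d A.base).form_leibniz hθ hA]
  · refine congrArg (θ A) (funext fun l ↦ congrArg
      (fun w ↦ Function.update (fun m ↦ (Z m).toFun A) i w (j.succAbove l)) ?_)
    exact ((d A.base).projBracket_eq (h i) (h j) hA).symm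

lemma extDeriv_spec {θ : L.EForm k p} (hθ : θ.IsSmooth) : IsExtDeriv θ (extDeriv θ) := by
  have h := exists_isExtDeriv hθ
  rw [extDeriv, dif_pos h]
  exact h.choose_spec

lemma isSmooth_contract {θ : L.EForm k (p + 1)} (hθ : θ.IsSmooth) (Z : L.ESection k) :
    (contract Z.toFun θ).IsSmooth := fun W ↦ by
  refine (congrArg (· ∈ L.smoothFun k) (funext fun A ↦ congrArg (θ A) (funext fun i ↦ ?_))).mp
    (hθ (Matrix.vecCons Z W))
  refine Fin.cases rfl (fun i ↦ rfl) i

/-! ### The canonical section in components, and smoothness of `i_T θ`. -/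

namespace LocalData

variable {x₀ : M} (d : LocalData B F E x₀)

variable (k F) in
/-- The components of an element of `𝒯^E E^k` from the fibre derivatives of a curve. -/
def shiftComp : (Fin (k + 1) → F) →ₗ[ℝ] F × (Fin k → F) :=
  (LinearMap.proj 0).prod (LinearMap.funLeft ℝ F Fin.succ)

variable (k F) in
/-- The map `𝒯τ_{k+1,k}` on components. -/
def truncComp : (F × (Fin (k + 1) → F)) →ₗ[ℝ] F × (Fin k → F) :=
  LinearMap.prodMap LinearMap.id (LinearMap.funLeft ℝ F Fin.castSucc)

variable (L k) in
/-- The components of the canonical section `T`. -/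
def canonicalComp : smoothMap L (k + 1) (F × (Fin k → F)) :=
  smoothMap.lin (shiftComp F k) (jetMap L (k + 1) d.contMDiff_Y)

lemma canonicalComp_apply (A : L.EJet (k + 1)) :
    (d.canonicalComp L k).1 A = d.comp A.trunc (canonicalT A) := (d.comp_canonicalT A).symm

lemma truncComp_comp (A : L.EJet (k + 1)) (z : ETangent A) :
    truncComp F k (d.comp A z) = d.comp A.trunc (ETangent.trunc A z) := (d.comp_trunc A z).symm

lemma trunc_frameAt (A : L.EJet (k + 1)) (c : F × (Fin (k + 1) → F)) :
    ETangent.trunc A (d.frameAt A c) = d.frameAt A.trunc (truncComp F k c) := by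
  by_cases hA : A.base ∈ d.W
  · have h : ETangent.trunc A (d.ofComp A c) = d.ofComp A.trunc (truncComp F k c) := by
      refine comp_injective (d := d) (A := A.trunc) hA ?_
      rw [← truncComp_comp, comp_ofComp hA, comp_ofComp (A := A.trunc) hA]
    exact (map_smul (ETangent.trunc A) (d.cut A.base) (d.ofComp A c)).trans
      (congrArg (d.cut A.base • ·) h)
  · have h0 : d.cut A.base = 0 := d.cut_eq_zero hA
    have h1 : d.frameAt A c = 0 :=
      (congrArg (· • d.ofComp A c) h0).trans (zero_smul ℝ (d.ofComp A c))
    have h2 : d.frameAt A.trunc (truncComp F k c) = 0 :=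
      (congrArg (· • d.ofComp A.trunc (truncComp F k c)) h0).trans
        (zero_smul ℝ (d.ofComp A.trunc (truncComp F k c)))
    rw [h1, h2, map_zero]

lemma frameAt_canonicalComp {A : L.EJet (k + 1)} (hA : A.base ∈ d.core) :
    d.frameAt A.trunc ((d.canonicalComp L k).1 A) = canonicalT A := by
  rw [canonicalComp_apply, d.frameAt_comp (A := A.trunc) hA]

end LocalData

/-- In the frame the components of `θ` are pulled back from `E^k`, and those of `T` and of the
truncated arguments are smooth on `E^{k+1}`. -/
lemma isSmooth_contractT {θ : L.EForm k (p + 1)} (hθ : θ.IsSmooth) :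
    (contractT θ).IsSmooth := fun Z ↦ isSmooth_of_locally fun x₀ ↦ by
  obtain ⟨d⟩ := exists_localData B F E x₀
  have hM (c : Fin (p + 1) → F × (Fin k → F)) : (fun A : L.EJet (k + 1) ↦
      ((θ A.trunc).compLinearMap (d.frameAt A.trunc)).toMultilinearMap c) ∈ L.smoothFun (k + 1) :=
    (pullbackTrunc ⟨_, hθ fun i ↦ d.frame L k (c i)⟩).2
  have h1 := multilinearFamily_mem hM (Matrix.vecCons (d.canonicalComp L k)
      fun i ↦ smoothMap.lin (LocalData.truncComp F k) (d.compMap (Z i)))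
  refine ⟨⟨_, h1⟩, d.core, d.core_mem_nhds, fun A hA ↦
    congrArg (θ A.trunc) (funext fun i ↦ ?_)⟩
  refine Fin.cases (d.frameAt_canonicalComp hA).symm (fun i ↦ ?_) i
  refine Eq.symm ((d.trunc_frameAt A ((d.compMap (Z i)).1 A)).symm.trans ?_)
  rw [d.frameAt_compMap (Z i) hA]
  rfl


/-! ### The bracket of the canonical section with a projectable section. -/

lemma deriv_pullbackTrunc {Z : L.ESection (k + 1)} {W : L.ESection k}
    (h : ∀ A, ETangent.trunc A (Z.toFun A) = W.toFun A.trunc) (φ : L.smoothFun k) :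
    Z.deriv (pullbackTrunc φ) = pullbackTrunc (W.deriv φ) := by
  ext A
  exact congrArg (fun w : ETangent A.trunc ↦ (vec (A := A.trunc) w).1 φ) (h A)

/-- On functions pulled back from `E^k` the upper sections act as the lower ones, twice in
succession; hence brackets project to brackets. -/
lemma trunc_projBracket {Z Z' : L.ESection (k + 1)} {W W' : L.ESection k} {σ σ' : Sec B F E}
    (hZ : Z.ProjectsTo σ) (hZ' : Z'.ProjectsTo σ') (hW : W.ProjectsTo σ) (hW' : W'.ProjectsTo σ')
    (h : ∀ A, ETangent.trunc A (Z.toFun A) = W.toFun A.trunc)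
    (h' : ∀ A, ETangent.trunc A (Z'.toFun A) = W'.toFun A.trunc) (A : L.EJet (k + 1)) :
    ETangent.trunc A (projBracket hZ hZ' A) = projBracket hW hW' A.trunc := by
  refine Subtype.ext (Prod.ext rfl (Subtype.ext ?_))
  ext φ
  change (Z.deriv (Z'.deriv (pullbackTrunc φ))).1 A - (Z'.deriv (Z.deriv (pullbackTrunc φ))).1 A =
    (W.deriv (W'.deriv φ)).1 A.trunc - (W'.deriv (W.deriv φ)).1 A.trunc
  rw [deriv_pullbackTrunc h, deriv_pullbackTrunc h', deriv_pullbackTrunc h, deriv_pullbackTrunc h']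
  rfl

namespace LocalData

variable {x₀ : M} (d : LocalData B F E x₀) {p : ℕ}

/-- A form with its first argument in components and the others given by sections. -/
def headForm (θ : L.EForm k (p + 1)) (W : Fin p → L.ESection k) (A : L.EJet k) :
    (F × (Fin k → F)) →ₗ[ℝ] ℝ where
  toFun c := (θ A).curryLeft (d.frameAt A c) fun i ↦ (W i).toFun A
  map_add' c c' := congrArg (fun f : (ETangent A) [⋀^Fin p]→ₗ[ℝ] ℝ ↦ f fun i ↦ (W i).toFun A)
    (map_add ((θ A).curryLeft ∘ₗ d.frameAt A) c c')
  map_smul' r c := congrArg (fun f : (ETangent A) [⋀^Fin p]→ₗ[ℝ] ℝ ↦ f fun i ↦ (W i).toFun A)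
    (map_smul ((θ A).curryLeft ∘ₗ d.frameAt A) r c)

lemma headForm_mem {θ : L.EForm k (p + 1)} (hθ : θ.IsSmooth) (W : Fin p → L.ESection k)
    (c : F × (Fin k → F)) : (fun A ↦ d.headForm θ W A c) ∈ L.smoothFun k :=
  isSmooth_contract hθ (d.frame L k c) W

/-- `T` lives only along `τ_{k+1,k}`. The derivative of `θ(T, …)` is therefore the derivative on
`E^k` with the components of `T` frozen at `A`, plus the contribution of their variation along `z`.
-/
lemma contractT_leibniz {θ : L.EForm k (p + 1)} (hθ : θ.IsSmooth) {Z : Fin p → L.ESection (k + 1)}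
    {W : Fin p → L.ESection k} (h : ∀ i A, ETangent.trunc A ((Z i).toFun A) = (W i).toFun A.trunc)
    {A : L.EJet (k + 1)} (hA : A.base ∈ d.core) (z : ETangent A) :
    (vec z).1 ⟨fun A' ↦ contractT θ A' fun i ↦ (Z i).toFun A', isSmooth_contractT hθ Z⟩ =
      (vec (A := A.trunc) (ETangent.trunc A z)).1
        ⟨_, d.headForm_mem hθ W ((d.canonicalComp L k).1 A)⟩ +
      d.headForm θ W A.trunc (vderiv (vec z).1 (d.canonicalComp L k)) := by
  have hN (c : F × (Fin k → F)) : (fun A : L.EJet (k + 1) ↦ d.headForm θ W A.trunc c) ∈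
      L.smoothFun (k + 1) := (pullbackTrunc ⟨_, d.headForm_mem hθ W c⟩).2
  refine Eq.trans (tangent_congr _ (d.core_mem_nhds_of_mem hA) fun A' hA' ↦ ?_)
    (linearFamily_leibniz hN (d.canonicalComp L k) (vec z))
  refine congrArg₂ (fun x w ↦ (θ A'.trunc).curryLeft x w) (d.frameAt_canonicalComp hA').symm
    (funext fun i ↦ h i A')

/-- The Lie bracket of the canonical section `T` with a section of `𝒯^E E^k` and a lift of it. -/
def lieT {W : L.ESection k} {σ : Sec B F E} (hW : W.ProjectsTo σ) {A : L.EJet (k + 1)}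
    (z : ETangent A) : ETangent A.trunc :=
  -- `T` is first replaced by the section with its components frozen at `A`; the second term
  -- corrects for their variation along the lift `z`.
  projBracket (d.frame_projectsTo ((d.canonicalComp L k).1 A)) hW A.trunc -
    d.frameAt A.trunc (vderiv (vec z).1 (d.canonicalComp L k))

/-- The frozen part and the correction recombine, so that the vector part of `lieT` is the
commutator and no longer refers to the frame. -/
lemma vec_lieT {Z : L.ESection (k + 1)} {W : L.ESection k} {σ : Sec B F E} (hW : W.ProjectsTo σ)
    (h : ∀ A, ETangent.trunc A (Z.toFun A) = W.toFun A.trunc) {A : L.EJet (k + 1)}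
    (hA : A.base ∈ d.core) (φ : L.smoothFun k) :
    (vec (A := A.trunc) (d.lieT hW (Z.toFun A))).1 φ =
      (tDeriv (W.deriv φ)).1 A - (Z.deriv (tDeriv φ)).1 A := by
  set S := d.frame L k ((d.canonicalComp L k).1 A) with hS
  have hT : S.toFun A.trunc = canonicalT A := d.frameAt_canonicalComp hA
  have hN (c : F × (Fin k → F)) : (fun A : L.EJet (k + 1) ↦ d.vecFrameAt φ A.trunc c) ∈
      L.smoothFun (k + 1) := (pullbackTrunc ⟨_, d.vecFrameAt_mem φ c⟩).2
  have h1 : (Z.deriv (tDeriv φ)).1 A = (Z.deriv (pullbackTrunc (S.deriv φ))).1 A +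
      (vec (A := A.trunc) (d.frameAt A.trunc
        (vderiv (vec (Z.toFun A)).1 (d.canonicalComp L k)))).1 φ := by
    refine Eq.trans (tangent_congr _ (d.core_mem_nhds_of_mem hA) fun A' hA' ↦ ?_)
      (linearFamily_leibniz hN (d.canonicalComp L k) (vec (Z.toFun A)))
    exact congrArg (fun w : ETangent A'.trunc ↦ (vec (A := A'.trunc) w).1 φ)
      (d.frameAt_canonicalComp hA').symm
  rw [h1, deriv_pullbackTrunc h, ← sub_sub]
  have h2 : (tDeriv (W.deriv φ)).1 A = (S.deriv (W.deriv φ)).1 A.trunc :=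
    congrArg (fun w : ETangent A.trunc ↦ (vec (A := A.trunc) w).1 (W.deriv φ)) hT.symm
  rw [h2]
  rfl

lemma Y_fib_lieT {W : L.ESection k} {σ : Sec B F E} (hW : W.ProjectsTo σ) {A : L.EJet (k + 1)}
    (hA : A.base ∈ d.core) (z : ETangent A) :
    d.Y A.base (fib (A := A.trunc) (d.lieT hW z)) =
      d.Y A.base (L.bracket (d.cutSec ((d.canonicalComp L k).1 A).1) σ A.base) -
        (vderiv (vec z).1 (d.canonicalComp L k)).1 :=
  (map_sub (d.Y A.base) _ _).trans (congrArg (_ - ·)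
    (Prod.ext_iff.mp (d.comp_frameAt (A := A.trunc) hA _)).1)

end LocalData


/-! ### Cartan's formula for the total derivative. -/

section Cartan

open Function

variable {p : ℕ}

lemma sum_Iio_succ {n : ℕ} (j : Fin n) (f : Fin (n + 1) → ℝ) :
    ∑ i ∈ Finset.Iio j.succ, f i = f 0 + ∑ i ∈ Finset.Iio j, f i.succ := by
  rw [← Finset.filter_gt_eq_Iio, ← Finset.filter_gt_eq_Iio, Finset.sum_filter, Finset.sum_filter,
    Fin.sum_univ_succ, if_pos j.succ_pos]
  simp only [Fin.succ_lt_succ_iff]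

lemma vecCons_succAbove {α : Type*} (x : α) (w : Fin (p + 1) → α) (j l : Fin (p + 1)) :
    Matrix.vecCons x w (j.succ.succAbove l) = Matrix.vecCons x (fun m ↦ w (j.succAbove m)) l := by
  refine Fin.cases ?_ (fun l ↦ ?_) l
  · rw [Fin.succ_succAbove_zero]; rfl
  · rw [Fin.succ_succAbove_succ]; rfl

lemma alternating_update {V : Type*} [AddCommGroup V] [Module ℝ V]
    (θ : V [⋀^Fin (p + 1)]→ₗ[ℝ] ℝ) (w : Fin (p + 1) → V) (j : Fin (p + 1)) (x : V) :
    θ (update w j x) = (-1 : ℝ) ^ (j : ℕ) * θ.curryLeft x fun m ↦ w (j.succAbove m) := by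
  have h := θ.map_insertNth j x (j.removeNth w)
  rw [Fin.insertNth_removeNth, zsmul_eq_mul] at h
  push_cast at h
  exact h

lemma add_sum_neg {ι : Type*} {s : Finset ι} (t : ℝ) (x y : ι → ℝ) :
    (t + ∑ j ∈ s, -x j) + (0 + ∑ j ∈ s, -y j) = t - (∑ j ∈ s, x j + ∑ j ∈ s, y j) := by
  rw [Finset.sum_neg_distrib, Finset.sum_neg_distrib]
  ring

namespace LocalData

variable {x₀ : M} (d : LocalData B F E x₀)

/-- To evaluate `dθ` on `T` at one point, `T` is extended by any projectable section `V 0` of `𝒯^E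
E^k` with the right value there. The term `j = 0` of the Koszul formula is `T(θ(W))`; the shift of
the other indices by one changes their signs. -/
lemma contractT_extDeriv_apply {θ : L.EForm k p} (hθ : θ.IsSmooth) (Z : Fin p → L.ESection (k + 1))
    {W : Fin p → L.ESection k} {V : Fin (p + 1) → L.ESection k} {σ : Fin (p + 1) → Sec B F E}
    (hV : ∀ i, (V i).ProjectsTo (σ i)) (hVW : ∀ i, V i.succ = W i)
    (h : ∀ i A, ETangent.trunc A ((Z i).toFun A) = (W i).toFun A.trunc) {A : L.EJet (k + 1)}
    (hT : (V 0).toFun A.trunc = canonicalT A) :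
    contractT (extDeriv θ) A (fun i ↦ (Z i).toFun A) = (tDeriv ⟨_, hθ W⟩).1 A -
      (∑ j : Fin p, (-1 : ℝ) ^ (j : ℕ) *
        (vec ((W j).toFun A.trunc)).1 ⟨_, hθ fun l ↦ V (j.succ.succAbove l)⟩ +
      ∑ j : Fin p, ∑ i ∈ Finset.Iio j.succ, (-1 : ℝ) ^ (j : ℕ) * θ A.trunc (fun l ↦
        update (fun m ↦ (V m).toFun A.trunc) i (projBracket (hV i) (hV j.succ) A.trunc)
          (j.succ.succAbove l))) := by
  have e1 := extDeriv_spec hθ V σ hV A.trunc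
  have e2 : contractT (extDeriv θ) A (fun i ↦ (Z i).toFun A) =
      extDeriv θ A.trunc (fun i ↦ (V i).toFun A.trunc) := by
    refine congrArg (extDeriv θ A.trunc) (funext fun i ↦ ?_)
    refine Fin.cases hT.symm (fun i ↦ (h i A).trans ?_) i
    rw [hVW]
  have e4 : (vec ((V 0).toFun A.trunc)).1 ⟨_, hθ fun l ↦ V ((0 : Fin (p + 1)).succAbove l)⟩ =
      (tDeriv ⟨_, hθ W⟩).1 A := by
    have e5 : (⟨_, hθ fun l ↦ V ((0 : Fin (p + 1)).succAbove l)⟩ : L.smoothFun k) = ⟨_, hθ W⟩ := by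
      refine Subtype.ext (funext fun A' ↦ congrArg (θ A') (funext fun l ↦ ?_))
      rw [Fin.succAbove_zero, hVW]
    rw [e5]
    exact congrArg (fun w : ETangent A.trunc ↦ (vec (A := A.trunc) w).1 ⟨_, hθ W⟩) hT
  have e6 (j : Fin p) (x : ℝ) : (-1 : ℝ) ^ (j.succ : ℕ) * x = -((-1 : ℝ) ^ (j : ℕ) * x) := by
    rw [Fin.val_succ, pow_succ, mul_neg_one, neg_mul]
  refine (e2.trans e1).trans ((congrArg₂ (· + ·) (Fin.sum_univ_succ _) (Fin.sum_univ_succ _)).trans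
    (Eq.trans (congrArg₂ (· + ·) (congrArg₂ (· + ·) ((one_mul _).trans
      ((tangentApp_eq _ (hθ fun l ↦ V _)).trans e4)) (Finset.sum_congr rfl fun j _ ↦ ?_))
      (congrArg₂ (· + ·) (Finset.sum_eq_zero fun i hi ↦ absurd (Finset.mem_Iio.mp hi)
        (Fin.not_lt_zero i)) (Finset.sum_congr rfl fun j _ ↦
          (Finset.sum_congr rfl fun i _ ↦ e6 j _).trans (Finset.sum_neg_distrib _))))
      (add_sum_neg _ _ _)))
  rw [e6, tangentApp_eq _ (hθ fun l ↦ V _), hVW]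

/-- Cartan's formula for the total derivative of a function. -/
lemma totalDeriv_apply_zero {θ : L.EForm k 0} (hθ : θ.IsSmooth) {Z : Fin 0 → L.ESection (k + 1)}
    {W : Fin 0 → L.ESection k} {A : L.EJet (k + 1)} (hA : A.base ∈ d.core) :
    totalDeriv θ A (fun i ↦ (Z i).toFun A) = (tDeriv ⟨_, hθ W⟩).1 A := by
  have h1 := contractT_extDeriv_apply hθ Z (W := W)
    (V := fun _ ↦ d.frame L k ((d.canonicalComp L k).1 A))
    (fun _ ↦ d.frame_projectsTo _) (fun i ↦ i.elim0) (fun i ↦ i.elim0) (d.frameAt_canonicalComp hA)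
  refine h1.trans ?_
  rw [Finset.univ_eq_empty, Finset.sum_empty, Finset.sum_empty, add_zero, sub_zero]

/-- `V 0` is the frame section with the components of `T` frozen at `A`. The brackets with it, the
case `i = 0`, are separated from the brackets of the `W_i`. -/
lemma contractT_extDeriv_succ {θ : L.EForm k (p + 1)} (hθ : θ.IsSmooth)
    {Z : Fin (p + 1) → L.ESection (k + 1)} {W : Fin (p + 1) → L.ESection k}
    {σ : Fin (p + 1) → Sec B F E} (hW : ∀ i, (W i).ProjectsTo (σ i))
    (h : ∀ i A, ETangent.trunc A ((Z i).toFun A) = (W i).toFun A.trunc) {A : L.EJet (k + 1)}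
    (hA : A.base ∈ d.core) : contractT (extDeriv θ) A (fun i ↦ (Z i).toFun A) =
      (tDeriv ⟨_, hθ W⟩).1 A - (∑ j : Fin (p + 1), (-1 : ℝ) ^ (j : ℕ) *
        (vec ((W j).toFun A.trunc)).1
          ⟨_, d.headForm_mem hθ (fun m ↦ W (j.succAbove m)) ((d.canonicalComp L k).1 A)⟩ +
      ∑ j : Fin (p + 1), ((-1 : ℝ) ^ (j : ℕ) * (θ A.trunc).curryLeft
          (projBracket (d.frame_projectsTo ((d.canonicalComp L k).1 A)) (hW j) A.trunc)
          (fun m ↦ (W (j.succAbove m)).toFun A.trunc) +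
        ∑ i ∈ Finset.Iio j, (-1 : ℝ) ^ (j : ℕ) * (θ A.trunc).curryLeft (canonicalT A)
          (fun m ↦ update (fun m ↦ (W m).toFun A.trunc) i
            (projBracket (hW i) (hW j) A.trunc) (j.succAbove m)))) := by
  have hV : ∀ i, ((Matrix.vecCons (d.frame L k ((d.canonicalComp L k).1 A)) W :
      Fin (p + 2) → L.ESection k) i).ProjectsTo
      ((Matrix.vecCons (d.cutSec ((d.canonicalComp L k).1 A).1) σ : Fin (p + 2) → Sec B F E) i) :=
    Fin.cases (d.frame_projectsTo _) hW
  have hT : (d.frame L k ((d.canonicalComp L k).1 A)).toFun A.trunc = canonicalT A :=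
    d.frameAt_canonicalComp hA
  have hVA : (fun m ↦ ((Matrix.vecCons (d.frame L k ((d.canonicalComp L k).1 A)) W :
      Fin (p + 2) → L.ESection k) m).toFun A.trunc) =
      Matrix.vecCons (canonicalT A) (fun m ↦ (W m).toFun A.trunc) :=
    funext (Fin.cases hT fun i ↦ rfl)
  refine (contractT_extDeriv_apply hθ Z (W := W) hV (fun i ↦ rfl) h hT).trans
    (congrArg (_ - ·) (congrArg₂ (· + ·) (Finset.sum_congr rfl fun j _ ↦
      congrArg (_ * ·) ?_) (Finset.sum_congr rfl fun j _ ↦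
      (sum_Iio_succ j _).trans (congrArg₂ (· + ·) (congrArg (_ * ·) ?_)
        (Finset.sum_congr rfl fun i _ ↦ congrArg (_ * ·) ?_)))))
  · refine congrArg (vec ((W j).toFun A.trunc)).1
      (Subtype.ext (funext fun A' ↦ congrArg (θ A') (funext fun l ↦ ?_)))
    refine (congrArg (fun Z : L.ESection k ↦ Z.toFun A') (vecCons_succAbove _ _ j l)).trans ?_
    exact Fin.cases rfl (fun l ↦ rfl) l
  · refine congrArg (θ A.trunc) (funext fun l ↦ ?_)
    rw [hVA]
    refine Eq.trans (congrFun (Fin.update_cons_zero _ _ _) _) (vecCons_succAbove _ _ j l)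
  · refine congrArg (θ A.trunc) (funext fun l ↦ ?_)
    rw [hVA]
    refine Eq.trans (congrFun (Fin.cons_update _ _ _ _).symm _) (vecCons_succAbove _ _ j l)

/-- Here `T` varies with the point, so each derivative of `θ(T, …)` has an additional term, which is
the correction in `lieT`. -/
lemma extDeriv_contractT {θ : L.EForm k (p + 1)} (hθ : θ.IsSmooth)
    {Z : Fin (p + 1) → L.ESection (k + 1)} {W : Fin (p + 1) → L.ESection k}
    {σ : Fin (p + 1) → Sec B F E} (hZ : ∀ i, (Z i).ProjectsTo (σ i))
    (hW : ∀ i, (W i).ProjectsTo (σ i))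
    (h : ∀ i A, ETangent.trunc A ((Z i).toFun A) = (W i).toFun A.trunc) {A : L.EJet (k + 1)}
    (hA : A.base ∈ d.core) : extDeriv (contractT θ) A (fun i ↦ (Z i).toFun A) =
      ∑ j : Fin (p + 1), (-1 : ℝ) ^ (j : ℕ) * ((vec ((W j).toFun A.trunc)).1
          ⟨_, d.headForm_mem hθ (fun m ↦ W (j.succAbove m)) ((d.canonicalComp L k).1 A)⟩ +
        (θ A.trunc).curryLeft
          (d.frameAt A.trunc (vderiv (vec ((Z j).toFun A)).1 (d.canonicalComp L k)))
          (fun m ↦ (W (j.succAbove m)).toFun A.trunc)) +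
      ∑ j : Fin (p + 1), ∑ i ∈ Finset.Iio j, (-1 : ℝ) ^ (j : ℕ) *
        (θ A.trunc).curryLeft (canonicalT A) (fun m ↦ update (fun m ↦ (W m).toFun A.trunc) i
          (projBracket (hW i) (hW j) A.trunc) (j.succAbove m)) := by
  refine (extDeriv_spec (isSmooth_contractT hθ) Z σ hZ A).trans
    (congrArg₂ (· + ·) (Finset.sum_congr rfl fun j _ ↦ congrArg (_ * ·) ?_)
      (Finset.sum_congr rfl fun j _ ↦ Finset.sum_congr rfl fun i _ ↦ congrArg (_ * ·) ?_))
  · refine (tangentApp_eq _ (isSmooth_contractT hθ fun l ↦ Z (j.succAbove l))).trans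
      ((d.contractT_leibniz hθ (fun i ↦ h (j.succAbove i)) hA _).trans ?_)
    exact congrArg (· + _) (congrArg (fun w : ETangent A.trunc ↦ (vec (A := A.trunc) w).1
      ⟨_, d.headForm_mem hθ (fun m ↦ W (j.succAbove m)) ((d.canonicalComp L k).1 A)⟩) (h j A))
  · refine congrArg ((θ A.trunc).curryLeft (canonicalT A)) (funext fun l ↦ ?_)
    beta_reduce
    by_cases hl : j.succAbove l = i
    · rw [hl, update_self, update_self]
      exact trunc_projBracket _ _ _ _ (h i) (h j) A
    · rw [update_of_ne hl, update_of_ne hl]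
      exact h _ A

/-- In `i_T d + d i_T` the derivatives `a` along the `W_j` and the terms `c` with `[W_i, W_j]`
cancel. What is left of each slot is `b - e`, the contribution of `[T, W_j]`. -/
lemma cartan_sum (t : ℝ) (a b e : Fin (p + 1) → ℝ) (c : Fin (p + 1) → Fin (p + 1) → ℝ) :
    (t - (∑ j : Fin (p + 1), (-1 : ℝ) ^ (j : ℕ) * a j + ∑ j : Fin (p + 1),
      ((-1 : ℝ) ^ (j : ℕ) * b j + ∑ i ∈ Finset.Iio j, (-1 : ℝ) ^ (j : ℕ) * c i j))) +
    (∑ j : Fin (p + 1), (-1 : ℝ) ^ (j : ℕ) * (a j + e j) +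
      ∑ j : Fin (p + 1), ∑ i ∈ Finset.Iio j, (-1 : ℝ) ^ (j : ℕ) * c i j) =
    t - ∑ j : Fin (p + 1), (-1 : ℝ) ^ (j : ℕ) * (b j - e j) := by
  simp only [mul_add, mul_sub, Finset.sum_add_distrib, Finset.sum_sub_distrib]
  ring

/-- Cartan's formula for the total derivative of a form of positive degree. -/
lemma totalDeriv_apply_succ {θ : L.EForm k (p + 1)} (hθ : θ.IsSmooth)
    {Z : Fin (p + 1) → L.ESection (k + 1)} {W : Fin (p + 1) → L.ESection k}
    {σ : Fin (p + 1) → Sec B F E} (hZ : ∀ i, (Z i).ProjectsTo (σ i))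
    (hW : ∀ i, (W i).ProjectsTo (σ i))
    (h : ∀ i A, ETangent.trunc A ((Z i).toFun A) = (W i).toFun A.trunc) {A : L.EJet (k + 1)}
    (hA : A.base ∈ d.core) : totalDeriv θ A (fun i ↦ (Z i).toFun A) = (tDeriv ⟨_, hθ W⟩).1 A -
      ∑ j, θ A.trunc (update (fun i ↦ (W i).toFun A.trunc) j (d.lieT (hW j) ((Z j).toFun A))) := by
  refine (congrArg₂ (· + ·) (d.contractT_extDeriv_succ hθ hW h hA)
    (d.extDeriv_contractT hθ hZ hW h hA)).trans ((cartan_sum _ _ _ _ _).trans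
      (congrArg (_ - ·) (Finset.sum_congr rfl fun j _ ↦ Eq.symm ?_)))
  refine (alternating_update (θ A.trunc) _ j _).trans (congrArg (_ * ·) ?_)
  exact congrArg (fun f : (ETangent A.trunc) [⋀^Fin p]→ₗ[ℝ] ℝ ↦
    f fun m ↦ (W (j.succAbove m)).toFun A.trunc) (map_sub (θ A.trunc).curryLeft _ _)

/-- Cartan's formula for the total derivative. -/
lemma totalDeriv_apply {θ : L.EForm k p} (hθ : θ.IsSmooth)
    {Z : Fin p → L.ESection (k + 1)} {W : Fin p → L.ESection k} {σ : Fin p → Sec B F E}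
    (hZ : ∀ i, (Z i).ProjectsTo (σ i)) (hW : ∀ i, (W i).ProjectsTo (σ i))
    (h : ∀ i A, ETangent.trunc A ((Z i).toFun A) = (W i).toFun A.trunc) {A : L.EJet (k + 1)}
    (hA : A.base ∈ d.core) : totalDeriv θ A (fun i ↦ (Z i).toFun A) = (tDeriv ⟨_, hθ W⟩).1 A -
      ∑ j, θ A.trunc (update (fun i ↦ (W i).toFun A.trunc) j (d.lieT (hW j) ((Z j).toFun A))) := by
  cases p with
  | zero =>
    refine (d.totalDeriv_apply_zero hθ (W := W) hA).trans ?_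
    rw [Finset.univ_eq_empty, Finset.sum_empty, sub_zero]
  | succ p => exact d.totalDeriv_apply_succ hθ hZ hW h hA

end LocalData

end Cartan


/-! ### The commutation law and its converse. -/

section Main

open Function

variable {p : ℕ}

namespace LocalData

variable {x₀ : M} (d : LocalData B F E x₀)

lemma vderiv_canonicalComp_fst {A : L.EJet (k + 1)} (z : ETangent A) :
    (vderiv (vec z).1 (d.canonicalComp L k)).1 = (d.comp A z).2 0 := by
  rw [canonicalComp, lin_vderiv, d.comp_snd]
  rfl

/-- With `e` the frame section through the value of `T` at `A`, the first component is `[e, η]`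
minus the order-zero component of `η^{k+1}`, which is `-[η, e]`; skew-symmetry cancels them. The
vector part is the commutator treated in `tDeriv_liftSection`. -/
lemma lieT_liftSection (η : Sec B F E) {A : L.EJet (k + 1)} (hA : A.base ∈ d.core) :
    d.lieT (liftSection_projectsTo (L := L) (k := k) η) ((liftSection L (k + 1) η).toFun A) = 0 := by
  have htr (A : L.EJet (k + 1)) : ETangent.trunc A ((liftSection L (k + 1) η).toFun A) =
      (liftSection L k η).toFun A.trunc := trunc_completeLift η A
  refine Subtype.ext (Prod.ext (d.Y_injective (d.core_subset hA) ?_) (Subtype.ext ?_))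
  · refine (d.Y_fib_lieT (liftSection_projectsTo η) hA _).trans (Eq.trans ?_ (map_zero _).symm)
    have h1 : (vderiv (vec ((liftSection L (k + 1) η).toFun A)).1 (d.canonicalComp L k)).1 =
        -d.Y A.base (L.bracket η (d.sec ((d.canonicalComp L k).1 A).1) A.base) := by
      rw [vderiv_canonicalComp_fst]
      refine (congrArg (fun c : F × (Fin (k + 1) → F) ↦ c.2 0)
        (d.comp_completeLift η (d.core_subset hA))).trans ((d.vjet_lieY_zero η A).trans ?_)
      rfl
    have h2 : L.bracket (d.cutSec ((d.canonicalComp L k).1 A).1) η A.base =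
        -L.bracket η (d.sec ((d.canonicalComp L k).1 A).1) A.base := by
      rw [bracket_congr_left (d.core_mem_nhds_of_mem hA) fun y hy ↦
        (congrArg (· • d.sec ((d.canonicalComp L k).1 A).1 y) (d.cut_core hy)).trans (one_smul _ _),
        bracket_skew]
      rfl
    rw [h1, h2, map_neg, sub_self]
  · ext φ
    refine (d.vec_lieT (liftSection_projectsTo η) htr hA φ).trans ?_
    rw [tDeriv_liftSection]
    exact sub_self _

lemma frame_trunc (c : F × (Fin (k + 1) → F)) (A : L.EJet (k + 1)) :
    ETangent.trunc A ((d.frame L (k + 1) c).toFun A) =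
      (d.frame L k (truncComp F k c)).toFun A.trunc := d.trunc_frameAt A c

end LocalData

/-- Compare Cartan's formula for `i_{η^k} θ` with the one for `θ` with `η^{k+1}` in the first slot:
the only additional term contains `[T, η^k] = 0`. Frame sections are projectable and reach every
argument `z`. -/
lemma totalDeriv_contract (η : Sec B F E) {θ : L.EForm k (p + 1)} (hθ : θ.IsSmooth) :
    totalDeriv (contract (L.completeLift η k) θ) =
      contract (L.completeLift η (k + 1)) (totalDeriv θ) := by
  funext A
  ext z
  obtain ⟨d⟩ := exists_localData B F E A.base
  have hA : A.base ∈ d.core := mem_of_mem_nhds d.core_mem_nhds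
  obtain ⟨c, rfl⟩ : ∃ c : Fin p → F × (Fin (k + 1) → F),
      z = fun i ↦ (d.frame L (k + 1) (c i)).toFun A :=
    ⟨fun i ↦ d.comp A (z i), funext fun i ↦ (d.frameAt_comp hA (z i)).symm⟩
  have h1 := d.totalDeriv_apply (isSmooth_contract hθ (liftSection L k η))
    (fun i ↦ d.frame_projectsTo (c i))
    (fun i ↦ d.frame_projectsTo (L := L) (LocalData.truncComp F k (c i)))
    (fun i ↦ d.frame_trunc (c i)) hA
  have h2 := d.totalDeriv_apply hθ
    (Z := Matrix.vecCons (liftSection L (k + 1) η) fun i ↦ d.frame L (k + 1) (c i))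
    (W := Matrix.vecCons (liftSection L k η) fun i ↦ d.frame L k (LocalData.truncComp F k (c i)))
    (σ := Matrix.vecCons η fun i ↦ d.cutSec (c i).1)
    (Fin.cases (liftSection_projectsTo η) fun i ↦ d.frame_projectsTo (c i))
    (Fin.cases (liftSection_projectsTo η) fun i ↦ d.frame_projectsTo (LocalData.truncComp F k (c i)))
    (Fin.cases (trunc_completeLift η) fun i ↦ d.frame_trunc (c i)) hA
  refine h1.trans (Eq.trans ?_ (h2.symm.trans (congrArg (totalDeriv θ A) (funext fun i ↦ ?_))))
  · refine congrArg₂ (· - ·) ?_ ?_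
    · refine congrArg (fun φ : L.smoothFun k ↦ (tDeriv φ).1 A)
        (Subtype.ext (funext fun A' ↦ congrArg (θ A') (funext fun i ↦ ?_)))
      exact Fin.cases rfl (fun i ↦ rfl) i
    · refine Eq.trans ?_ (Fin.sum_univ_succ _).symm
      refine Eq.trans ?_ (congrArg (· + _) (Eq.symm
        ((congrArg (θ A.trunc) (congrArg (update _ 0) (d.lieT_liftSection η hA))).trans
          ((θ A.trunc).map_update_zero _ 0))))
      refine Eq.trans ?_ (zero_add _).symm
      refine Finset.sum_congr rfl fun j _ ↦ congrArg (θ A.trunc) ?_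
      refine (Fin.cons_update _ _ _ _).trans (congrArg (fun f ↦ update f j.succ _) (funext fun i ↦ ?_))
      exact Fin.cases rfl (fun i ↦ rfl) i
  · exact Fin.cases rfl (fun i ↦ rfl) i

variable (k) in
/-- The `1`-form with given values. -/
def oneForm (ℓ : ∀ A : L.EJet k, ETangent A →ₗ[ℝ] ℝ) : L.EForm k 1 :=
  fun A ↦ AlternatingMap.ofSubsingleton ℝ (ETangent A) ℝ 0 (ℓ A)

lemma totalDeriv_oneForm {x₀ : M} (d : LocalData B F E x₀) {ℓ : ∀ A : L.EJet k, ETangent A →ₗ[ℝ] ℝ}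
    (hℓ : ∀ Z : L.ESection k, (fun A ↦ ℓ A (Z.toFun A)) ∈ L.smoothFun k) {A : L.EJet (k + 1)}
    (hA : A.base ∈ d.core) (c : F × (Fin (k + 1) → F)) :
    totalDeriv (oneForm k ℓ) A (fun _ ↦ (d.frame L (k + 1) c).toFun A) =
      (tDeriv ⟨_, hℓ (d.frame L k (LocalData.truncComp F k c))⟩).1 A -
        ℓ A.trunc (d.lieT (d.frame_projectsTo (L := L) (LocalData.truncComp F k c))
          ((d.frame L (k + 1) c).toFun A)) := by
  have h1 := d.totalDeriv_apply (θ := oneForm k ℓ) (fun Z ↦ hℓ (Z 0))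
    (Z := fun _ ↦ d.frame L (k + 1) c) (W := fun _ ↦ d.frame L k (LocalData.truncComp F k c))
    (fun _ ↦ d.frame_projectsTo c) (fun _ ↦ d.frame_projectsTo (LocalData.truncComp F k c))
    (fun _ ↦ d.frame_trunc c) hA
  refine h1.trans (congrArg (_ - ·) ((Fin.sum_univ_one _).trans ?_))
  exact congrArg (ℓ A.trunc) (update_self _ _ _)

/-- Two kinds of test forms suffice. The form `(b, v) ↦ ℓ(Y b)` detects the jet component of order
`0`. The form `dφ`, with `φ` a jet coordinate of order `r`, has total derivative `d(T φ)` and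
detects the component of order `r + 1`. -/
lemma eq_zero_of_totalDeriv {A : L.EJet (k + 1)} {ζ : ETangent A} (h0 : fib ζ = 0)
    (h : ∀ θ : L.EForm k 1, θ.IsSmooth → totalDeriv θ A (fun _ ↦ ζ) = 0) : ζ = 0 := by
  obtain ⟨d⟩ := exists_localData B F E A.base
  have hA : A.base ∈ d.core := mem_of_mem_nhds d.core_mem_nhds
  set c := d.comp A ζ with hc
  have hζ : (d.frame L (k + 1) c).toFun A = ζ := d.frameAt_comp hA ζ
  have hc1 : c.1 = 0 := (congrArg (d.Y A.base) h0).trans (map_zero _)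
  refine d.comp_injective (d.core_subset hA) (Eq.trans (Prod.ext hc1 (funext fun i ↦ ?_))
    (map_zero _).symm)
  refine eq_of_forall_dual fun ℓ ↦ Eq.trans ?_ (map_zero ℓ).symm
  refine Fin.cases ?_ (fun r ↦ ?_) i
  · have hs (Z : L.ESection k) : (fun A ↦ ℓ (d.Y A.base (fib (Z.toFun A)))) ∈ L.smoothFun k :=
      Z.smooth_fib (dualTotFun d.contMDiff_Y ℓ)
    have h1 := totalDeriv_oneForm d (ℓ := fun A ↦ ℓ ∘ₗ d.Y A.base ∘ₗ LinearMap.fst ℝ _ _ ∘ₗ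
      (ETangent A).subtype) hs hA c
    have h2 := ((congrArg (fun w ↦ totalDeriv _ A fun _ ↦ w) hζ.symm).symm.trans
      (h _ fun Z ↦ hs (Z 0))).symm.trans h1
    -- As `c.1 = 0`, the frame section has zero first component everywhere, so the term of Cartan's
    -- formula differentiated by `T` vanishes.
    have h3 : (⟨_, hs (d.frame L k (LocalData.truncComp F k c))⟩ : L.smoothFun k) = 0 := by
      refine Subtype.ext (funext fun A' ↦ ?_)
      have e1 : fib ((d.frame L k (LocalData.truncComp F k c)).toFun A') = 0 := by
        refine (d.frame_projectsTo (LocalData.truncComp F k c) A').trans ?_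
        have e2 : d.sec c.1 A'.base = 0 := by rw [hc1, map_zero]; rfl
        exact (congrArg (d.cut A'.base • ·) e2).trans (smul_zero _)
      exact (congrArg (fun b ↦ ℓ (d.Y A'.base b)) e1).trans (by rw [map_zero, map_zero]; rfl)
    have h4 : ℓ (d.Y A.base (fib (A := A.trunc) (d.lieT
        (d.frame_projectsTo (L := L) (LocalData.truncComp F k c))
          ((d.frame L (k + 1) c).toFun A)))) = -ℓ (c.2 0) := by
      have e3 : d.cutSec (LocalData.truncComp F k c).1 = 0 := by
        ext y
        have e2 : d.sec c.1 y = 0 := by rw [hc1, map_zero]; rfl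
        exact (congrArg (d.cut y • ·) e2).trans (smul_zero _)
      rw [d.Y_fib_lieT _ hA, d.vderiv_canonicalComp_fst, hζ, e3, map_zero]
      refine (congrArg ℓ ((congrArg (· - _) (map_zero (d.Y A.base))).trans (zero_sub _))).trans
        (map_neg ℓ _)
    have h5 : (tDeriv (⟨_, hs (d.frame L k (LocalData.truncComp F k c))⟩ : L.smoothFun k)).1 A =
        0 := by
      rw [h3, map_zero]; rfl
    have h6 : (0 : ℝ) = 0 - -ℓ (c.2 0) := h2.trans (congrArg₂ (· - ·) h5 h4)
    linarith
  · set φ := jetFun L (dualTotFun d.contMDiff_Y ℓ) r with hφ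
    have hs (Z : L.ESection k) : (fun A ↦ (vec (Z.toFun A)).1 φ) ∈ L.smoothFun k := Z.smooth_vec φ
    have h1 := totalDeriv_oneForm d (ℓ := fun A ↦ LinearMap.applyₗ φ ∘ₗ (tangentAt A).subtype ∘ₗ
      LinearMap.snd ℝ _ _ ∘ₗ (ETangent A).subtype) hs hA c
    have h2 := ((congrArg (fun w ↦ totalDeriv _ A fun _ ↦ w) hζ.symm).symm.trans
      (h _ fun Z ↦ hs (Z 0))).symm.trans h1
    have h3 := d.vec_lieT (d.frame_projectsTo (L := L) (LocalData.truncComp F k c))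
      (d.frame_trunc c) hA φ
    have h4 : ((d.frame L (k + 1) c).deriv (tDeriv φ)).1 A = ℓ (c.2 r.succ) := by
      refine (congrArg (fun w : ETangent A ↦ (vec w).1 (tDeriv φ)) hζ).trans ?_
      rw [hφ, tDeriv_jetFun, hc, d.comp_snd]
      exact (vderiv_jetMap _ d.contMDiff_Y ℓ r.succ).symm
    -- The term `T(W φ)` of Cartan's formula cancels against the commutator and leaves `ζ(T φ)`.
    have h5 : (0 : ℝ) = ((d.frame L (k + 1) c).deriv (tDeriv φ)).1 A :=
      h2.trans ((congrArg (_ - ·) h3).trans (sub_sub_cancel _ _))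
    exact (h5.trans h4).symm

/-- `Z` and `η^{k+1}` have the same first component and the same contraction with every `d_T θ`, so
their difference falls under `eq_zero_of_totalDeriv`. -/
lemma eq_completeLift {η : Sec B F E} {Z : L.ESection (k + 1)} (hZ : Z.ProjectsTo η)
    (h : ∀ θ : L.EForm k 1, θ.IsSmooth → totalDeriv (contract (L.completeLift η k) θ) =
      contract Z.toFun (totalDeriv θ)) : Z.toFun = L.completeLift η (k + 1) := by
  funext A
  refine sub_eq_zero.mp (eq_zero_of_totalDeriv ?_ fun θ hθ ↦ ?_)
  · exact sub_eq_zero.mpr ((hZ A).trans (completeLift_spec η A).1.symm)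
  · have h1 := congrFun ((h θ hθ).symm.trans (totalDeriv_contract η hθ)) A
    have h2 := congrArg (fun f : (ETangent A) [⋀^Fin 0]→ₗ[ℝ] ℝ ↦ f ![])
      ((map_sub (totalDeriv θ A).curryLeft (Z.toFun A) (L.completeLift η (k + 1) A)).trans
        (sub_eq_zero.mpr h1))
    refine Eq.trans (congrArg (totalDeriv θ A) (funext fun i ↦ ?_)) h2
    exact Fin.cases rfl (fun i ↦ i.elim0) i

end Main

end LieAlgebroid

end

theorem mainTheorem8
    {B : Type*} [NormedAddCommGroup B] [NormedSpace ℝ B] [FiniteDimensional ℝ B]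
    {M : Type*} [TopologicalSpace M] [ChartedSpace B M] [IsManifold 𝓘(ℝ, B) ∞ M]
    [T2Space M] [SigmaCompactSpace M]
    {F : Type*} [NormedAddCommGroup F] [NormedSpace ℝ F] [FiniteDimensional ℝ F]
    {E : M → Type*} [∀ x, AddCommGroup (E x)] [∀ x, Module ℝ (E x)]
    [∀ x, TopologicalSpace (E x)] [TopologicalSpace (TotalSpace F E)]
    [FiberBundle F E] [VectorBundle ℝ F E] [ContMDiffVectorBundle ∞ F E 𝓘(ℝ, B)]
    (L : LieAlgebroid B F E) (η : Sec B F E) (k : ℕ) :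
    -- the complete lift is well defined and it is a smooth section
    (∀ A : L.EJet k, LieAlgebroid.IsCompleteLiftAt η A (L.completeLift η k A)) ∧
    (∃ Z : L.ESection k, Z.toFun = L.completeLift η k) ∧
    -- it commutes with the total derivative, on forms of every positive degree
    (∀ (p : ℕ) (θ : L.EForm k (p + 1)), θ.IsSmooth →
      LieAlgebroid.totalDeriv (LieAlgebroid.contract (L.completeLift η k) θ) =
        LieAlgebroid.contract (L.completeLift η (k + 1)) (LieAlgebroid.totalDeriv θ)) ∧
    -- and it is characterized by this property, already on 1-forms
    (∀ Z : L.ESection (k + 1), Z.ProjectsTo η →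
      (∀ θ : L.EForm k 1, θ.IsSmooth →
        LieAlgebroid.totalDeriv (LieAlgebroid.contract (L.completeLift η k) θ) =
          LieAlgebroid.contract Z.toFun (LieAlgebroid.totalDeriv θ)) →
      Z.toFun = L.completeLift η (k + 1)) := by
  exact ⟨LieAlgebroid.completeLift_spec η, ⟨LieAlgebroid.liftSection L k η, rfl⟩,
    fun _ _ hθ ↦ LieAlgebroid.totalDeriv_contract η hθ, fun _ hZ h ↦ LieAlgebroid.eq_completeLift hZ h⟩
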